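/- Identify $\mathcal{S}^6$ with the unit sphere of the imaginary octonions $\mathrm{Im}\,\mathbb{O}\cong\mathbb{R}^7$, with the round metric, the almost complex structure $J_p(u)=p\times u$ (octonionic cross product) and the 2-form $\omega_p(u,v)=\langle J_pu,v\rangle$. Let $L$ be a connected smooth 3-manifold and $\mathbf{x}:L\to\mathcal{S}^6$ a smooth immersion that is Lagrangian, i.e. $\mathbf{x}^*\omega=0$, and equip $L$ with the induced metric $g_L$. Let $h_L$ be the second fundamental form of $L$ in $\mathcal{S}^6$ and let $C_L(u,v,w)=\langle h_L(u,v),Jw\rangle$ be its fundamental cubic; the stabilizer of $C_L$ at $p$ is the group of all $A\in\mathrm{SO}(T_pL,g_L)$ with $C_L(Au,Av,Aw)=C_L(u,v,w)$ for all $u,v,w\in T_pL$. For $p\in L$ let $$\delta_L(p)=\sum_{1\le i<j\le 3}s(\mathbf{v}_i\wedge\mathbf{v}_j)-\inf_{\Pi}s(\Pi),$$ where $s$ is the sectional curvature of $g_L$, $\{\mathbf{v}_1,\mathbf{v}_2,\mathbf{v}_3\}$ is any orthonormal basis of $T_pL$, and $\Pi$ runs over the 2-planes in $T_pL$. Suppose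 that $L$ is non-simple, i.e. that $\mathbf{x}(L)$ is not contained in a totally geodesic $\mathcal{S}^3\subset\mathcal{S}^6$ (the intersection of $\mathcal{S}^6$ with a linear 4-plane). Then the following are equivalent: (a) there is an open dense subset $L^*\subseteq L$ such that for every $p\in L^*$ the stabilizer of $C_L$ at $p$ is isomorphic to the symmetric group $\mathsf{S}_3$; (b) $L$ satisfies Chen's equality: $\delta_L(p)=2$ for all $p\in L$. Moreover, if (b) holds, then the stabilizer of $C_L$ at $p$ is isomorphic to $\mathsf{S}_3$ at every point $p\in L$ with $C_L(p)\neq 0$. -/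

import Mathlib

open scoped Manifold ContDiff

noncomputable section

namespace S6

/-- The model space `ℝ³` of a 3-manifold. For a manifold `L` charted on `E3`, Mathlib's tangent
space at `p` is `E3`, a tangent vector being represented by its coordinates in the preferred
chart at `p`; all tangent vectors of `L` below are written in this way. -/
abbrev E3 : Type := EuclideanSpace ℝ (Fin 3)

/-- The imaginary octonions with their Euclidean metric; coordinate `i : Fin 7` is the
coefficient of the basis element `ε_{i+1}`. -/
abbrev ImO : Type := EuclideanSpace ℝ (Fin 7)

/-- The octonionic cross product on `ImO` (the imaginary part of the octonion product), for the
multiplication rules `ε₁ε₂ = ε₃`, `ε₁ε₄ = ε₅`, `ε₁ε₆ = ε₇`, `ε₂ε₄ = ε₆`, `ε₂ε₅ = -ε₇`,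
`ε₃ε₄ = -ε₇`, `ε₃ε₅ = -ε₆` and their cyclic permutations. -/
def cross (u v : ImO) : ImO :=
  !₂[(u 1 * v 2 - u 2 * v 1) + (u 3 * v 4 - u 4 * v 3) + (u 5 * v 6 - u 6 * v 5),
     (u 2 * v 0 - u 0 * v 2) + (u 3 * v 5 - u 5 * v 3) - (u 4 * v 6 - u 6 * v 4),
     (u 0 * v 1 - u 1 * v 0) - (u 3 * v 6 - u 6 * v 3) - (u 4 * v 5 - u 5 * v 4),
     (u 4 * v 0 - u 0 * v 4) + (u 5 * v 1 - u 1 * v 5) - (u 6 * v 2 - u 2 * v 6),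
     (u 0 * v 3 - u 3 * v 0) - (u 6 * v 1 - u 1 * v 6) - (u 5 * v 2 - u 2 * v 5),
     (u 6 * v 0 - u 0 * v 6) + (u 1 * v 3 - u 3 * v 1) - (u 2 * v 4 - u 4 * v 2),
     (u 0 * v 5 - u 5 * v 0) - (u 1 * v 4 - u 4 * v 1) - (u 2 * v 3 - u 3 * v 2)]

/-- The almost complex structure `J_p(u) = p × u` of the unit sphere `S⁶` in `ImO`, on
`T_p S⁶ = p^⊥`. -/
def J (p u : ImO) : ImO := cross p u

/-- The nondegenerate 2-form `ω_p(u, v) = ⟨J_p u, v⟩` of `S⁶`. -/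
def omega (p u v : ImO) : ℝ := inner ℝ (J p u) v

section Submanifold

variable {L : Type*} [TopologicalSpace L] [ChartedSpace E3 L]

/-- The differential `T_p L → ImO` of a map `x : L → ImO`. -/
def dx (x : L → ImO) (p : L) : E3 →L[ℝ] ImO :=
  mfderiv 𝓘(ℝ, E3) 𝓘(ℝ, ImO) x p

/-- `x : L → ImO` is a smooth immersion with values in the unit sphere `S⁶` and pulls the
2-form `ω` of `S⁶` back to zero: a Lagrangian immersion of the 3-manifold `L` in `S⁶`. -/
structure IsLagrangianImmersion (x : L → ImO) : Prop where
  smooth : ContMDiff 𝓘(ℝ, E3) 𝓘(ℝ, ImO) ∞ x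
  mem_sphere : ∀ p, x p ∈ Metric.sphere (0 : ImO) 1
  immersion : ∀ p, Function.Injective (dx x p)
  omega_eq_zero : ∀ p u v, omega (x p) (dx x p u) (dx x p v) = 0

/-- `L` lies in a totally geodesic `S³`, that is, in the intersection of `S⁶` with a linear
4-plane. -/
def IsSimple (x : L → ImO) : Prop :=
  ∃ V : Submodule ℝ ImO, Module.finrank ℝ V = 4 ∧ ∀ p, x p ∈ V

/-- The induced metric `g_L` on `T_p L`. -/
def metric (x : L → ImO) (p : L) (u v : E3) : ℝ := inner ℝ (dx x p u) (dx x p v)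

/-- The map `x` written in the preferred chart at `p`. -/
def localRep (x : L → ImO) (p : L) : E3 → ImO := x ∘ (extChartAt 𝓘(ℝ, E3) p).symm

/-- The normal space `N_p L` of `L` in `S⁶`: the vectors orthogonal to `x p` and to `T_p L`. -/
def normalSpace (x : L → ImO) (p : L) : Submodule ℝ ImO :=
  (Submodule.span ℝ {x p} ⊔ LinearMap.range (dx x p).toLinearMap)ᗮ

/-- The second fundamental form `h_L` of `L` in `S⁶` at `p`: the normal part of the second
derivative of `x` (this normal part does not depend on the chart). -/
def secondFundamentalForm (x : L → ImO) (p : L) (u v : E3) : ImO :=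
  (normalSpace x p).starProjection
    (fderiv ℝ (fderiv ℝ (localRep x p)) (extChartAt 𝓘(ℝ, E3) p p) u v)

/-- The fundamental cubic `C_L` at `p`, as a trilinear form: `C_L(u, v, w) = ⟨h_L(u, v), J w⟩`.
In an orthonormal frame, `C_L(e_i, e_j, e_k) = h_{ijk}`, where
`h_L(e_j, e_k) = ∑ i, h_{ijk} J e_i`. -/
def fundamentalCubic (x : L → ImO) (p : L) (u v w : E3) : ℝ :=
  inner ℝ (secondFundamentalForm x p u v) (J (x p) (dx x p w))

/-- The stabilizer of the fundamental cubic at `p` in `SO(T_p L, g_L) ≅ SO(3)`. -/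
def cubicStabilizer (x : L → ImO) (p : L) : Subgroup (E3 ≃ₗ[ℝ] E3) where
  carrier := {A | (∀ u v, metric x p (A u) (A v) = metric x p u v) ∧
    LinearEquiv.det A = 1 ∧
    ∀ u v w, fundamentalCubic x p (A u) (A v) (A w) = fundamentalCubic x p u v w}
  one_mem' := by simp
  mul_mem' := by
    rintro A B ⟨hA1, hA2, hA3⟩ ⟨hB1, hB2, hB3⟩
    refine ⟨fun u v => ?_, ?_, fun u v w => ?_⟩
    · simp only [LinearEquiv.mul_apply, hA1, hB1]
    · rw [map_mul, hA2, hB2, one_mul]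
    · simp only [LinearEquiv.mul_apply, hA3, hB3]
  inv_mem' := by
    rintro A ⟨hA1, hA2, hA3⟩
    have hA : ∀ u, A (A⁻¹ u) = u := fun u => A.apply_symm_apply u
    refine ⟨fun u v => ?_, ?_, fun u v w => ?_⟩
    · rw [← hA1, hA, hA]
    · rw [map_inv, hA2, inv_one]
    · rw [← hA3, hA, hA, hA]

/-- The stabilizer of the fundamental cubic at `p` is isomorphic to the symmetric group `S₃`. -/
def HasS3StabilizerAt (x : L → ImO) (p : L) : Prop :=
  Nonempty (cubicStabilizer x p ≃* Equiv.Perm (Fin 3))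

end Submanifold

section Curvature

/-- The partial derivative `∂_i f` on `ℝ³`. -/
def partialD (i : Fin 3) (f : E3 → ℝ) (y : E3) : ℝ :=
  fderiv ℝ f y (EuclideanSpace.single i 1)

/-- The Christoffel symbol `Γ^k_{ij}` of a metric `g = (g_{ij})` on an open subset of `ℝ³`. -/
def christoffel (g : E3 → Matrix (Fin 3) (Fin 3) ℝ) (k i j : Fin 3) (y : E3) : ℝ :=
  (1 / 2 : ℝ) * ∑ l, (g y)⁻¹ k l *
    (partialD i (fun z => g z j l) y + partialD j (fun z => g z i l) y
      - partialD l (fun z => g z i j) y)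

/-- The components of the curvature tensor: `R(∂_i, ∂_j)∂_k = ∑ l, curvature g l k i j • ∂_l`,
where `R(X, Y) = ∇_X ∇_Y - ∇_Y ∇_X - ∇_[X, Y]`. -/
def curvature (g : E3 → Matrix (Fin 3) (Fin 3) ℝ) (l k i j : Fin 3) (y : E3) : ℝ :=
  partialD i (christoffel g l j k) y - partialD j (christoffel g l i k) y
    + ∑ m, (christoffel g l i m y * christoffel g m j k y
      - christoffel g l j m y * christoffel g m i k y)

variable {L : Type*} [TopologicalSpace L] [ChartedSpace E3 L]

/-- The components `g_{ij} = ⟨∂_i x, ∂_j x⟩` of the induced metric in the preferred chart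
at `p`. -/
def metricMatrix (x : L → ImO) (p : L) (y : E3) : Matrix (Fin 3) (Fin 3) ℝ :=
  fun i j => inner ℝ (fderiv ℝ (localRep x p) y (EuclideanSpace.single i 1))
    (fderiv ℝ (localRep x p) y (EuclideanSpace.single j 1))

/-- `⟨R(u, v)v, u⟩` for the Levi-Civita connection of the induced metric at `p`. -/
def curvatureForm (x : L → ImO) (p : L) (u v : E3) : ℝ :=
  ∑ i, ∑ j, ∑ k, ∑ l, ∑ m, u i * v j * v k * u m *
    metricMatrix x p (extChartAt 𝓘(ℝ, E3) p p) l m *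
    curvature (metricMatrix x p) l k i j (extChartAt 𝓘(ℝ, E3) p p)

/-- The sectional curvature of `(L, g_L)` on the 2-plane of `T_p L` spanned by linearly
independent vectors `u`, `v`. -/
def sectionalCurvature (x : L → ImO) (p : L) (u v : E3) : ℝ :=
  curvatureForm x p u v /
    (metric x p u u * metric x p v v - metric x p u v ^ 2)

/-- `v` is an orthonormal basis of `(T_p L, g_L)`. -/
def IsOrthonormalBasis (x : L → ImO) (p : L) (v : Fin 3 → E3) : Prop :=
  ∀ i j, metric x p (v i) (v j) = if i = j then 1 else 0

/-- Chen's invariant `δ_L(p)`: the sum of the sectional curvatures of the coordinate planes of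
an orthonormal basis `v` of `T_p L` (the sum does not depend on `v`), minus the infimum of the
sectional curvatures of all 2-planes in `T_p L`. -/
def chenInvariant (x : L → ImO) (p : L) (v : Fin 3 → E3) : ℝ :=
  (∑ i, ∑ j ∈ Finset.Ioi i, sectionalCurvature x p (v i) (v j)) -
    sInf {s | ∃ u w : E3, LinearIndependent ℝ ![u, w] ∧ s = sectionalCurvature x p u w}

/-- Chen's equality `δ_L = 2`, at every point. -/
def SatisfiesChenEquality (x : L → ImO) : Prop :=
  ∀ p v, IsOrthonormalBasis x p v → chenInvariant x p v = 2

end Curvature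

end S6

end

/-! Everything is read off the fundamental cubic C. Differentiating x*ω = 0 shows that the 3-form
φ(u,v,w) = ⟨u × v, w⟩ vanishes on L and that C is symmetric; differentiating φ = 0 shows that C is
trace free (`LagOn.cub_trace`). The Gauss equation and an identity for harmonic cubics then give the
plane with normal n the sectional curvature 1 − |C|²/2 + |C(n,·,·)|²/|n|². The sum over an
orthonormal basis is 3 − |C|²/2, so δ = 2 at p exactly when the infimum is 1 − |C|²/2, that is, when
C has a null vector n at p (`IsLagrangianImmersion.chenInvariant_eq_two_iff`).

Null vectors match the stabilizer. If the stabilizer is S₃, the axis of the rotation of order three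
is null (`IsHarmonicForm.exists_null_of_S3`). Conversely a nonzero harmonic cubic with a null vector
is a multiple of Re (x + iy)³ in the orthogonal plane, whose stabilizer permutes three unit vectors
at angles 2π/3 (`IsHarmonicForm.nonempty_mulEquiv_of_null`). Having a null vector is the vanishing
of a continuous determinant, hence passes from a dense set to all of L. This gives (a) ⇒ (b) and the
last claim.

For (b) ⇒ (a) it remains to see that C vanishes on no open set unless L is simple. This is a unique
continuation argument. C is a Codazzi tensor for the metric connection obtained from Levi-Civita by
adding a quarter of the skew tensor ⟨u × v, Jw⟩, so A = |C|² satisfies a Bochner formula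
(`bochner`). The null direction improves the Kato inequality by the factor 1/2 (`kato`), which is
exactly what turns the formula into L log A ≥ −K wherever A > 0, for a second order elliptic
operator L (`LagOn.exists_laplacian_bound`). A maximum principle for log (A + ε) with a Gaussian
barrier shows that A vanishes on a whole chart if it vanishes on a ball (`eq_zero_of_ball`). As L is
connected, C either has a zero set with empty interior or vanishes identically; in the latter case
the span of the position and the tangent space is parallel, and L is simple
(`IsLagrangianImmersion.dense_ne_zero`). -/

noncomputable section
namespace S6

/-! ### Algebra of the octonionic cross product -/

section CrossProduct

theorem inner_eq_sum (a b : ImO) : inner ℝ a b = ∑ i, a i * b i := by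
  simp [PiLp.inner_apply, mul_comm]

theorem cross_antisymm (a b : ImO) : cross a b = -cross b a := by
  ext i
  fin_cases i <;> simp [cross] <;> ring

theorem inner_cross_self_left (a b : ImO) : inner ℝ (cross a b) a = 0 := by
  simp only [inner_eq_sum, Fin.sum_univ_seven]
  simp [cross]
  ring

theorem inner_cross_cyclic (a b c : ImO) : inner ℝ (cross a b) c = inner ℝ a (cross b c) := by
  simp only [inner_eq_sum, Fin.sum_univ_seven]
  simp [cross]
  ring

theorem inner_cross_cross (a b c : ImO) :
    inner ℝ (cross a b) (cross a c) = inner ℝ a a * inner ℝ b c - inner ℝ a b * inner ℝ a c := by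
  simp only [inner_eq_sum, Fin.sum_univ_seven]
  simp [cross]
  ring

/-- The cross product as a bilinear map. -/
def crossLin : ImO →ₗ[ℝ] ImO →ₗ[ℝ] ImO :=
  LinearMap.mk₂ ℝ cross
    (fun a b c => by ext i; fin_cases i <;> simp [cross] <;> ring)
    (fun r a b => by ext i; fin_cases i <;> simp [cross] <;> ring)
    (fun a b c => by ext i; fin_cases i <;> simp [cross] <;> ring)
    (fun r a b => by ext i; fin_cases i <;> simp [cross] <;> ring)

theorem isBoundedBilinearMap_cross :
    IsBoundedBilinearMap ℝ (fun q : ImO × ImO => cross q.1 q.2) := by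
  have h := (LinearMap.toContinuousLinearMap
    ((LinearMap.toContinuousLinearMap : (ImO →ₗ[ℝ] ImO) ≃ₗ[ℝ] _).toLinearMap ∘ₗ crossLin)
    : ImO →L[ℝ] ImO →L[ℝ] ImO).isBoundedBilinearMap
  exact h

theorem cross_add_left (a b c : ImO) : cross (a + b) c = cross a c + cross b c :=
  LinearMap.map_add₂ crossLin a b c

theorem cross_smul_right (r : ℝ) (a b : ImO) : cross a (r • b) = r • cross a b :=
  (crossLin a).map_smul r b

theorem cross_sum_right {ι : Type*} (s : Finset ι) (a : ImO) (b : ι → ImO) :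
    cross a (∑ i ∈ s, b i) = ∑ i ∈ s, cross a (b i) :=
  map_sum (crossLin a) b s

theorem cross_self (a : ImO) : cross a a = 0 := by
  ext i
  fin_cases i <;> simp [cross] <;> ring

theorem inner_cross_self_right (a b : ImO) : inner ℝ (cross a b) b = 0 := by
  rw [inner_cross_cyclic, cross_self, inner_zero_right]

theorem inner_cross_swap_right (a b c : ImO) :
    inner ℝ (cross a b) c = -inner ℝ (cross a c) b := by
  rw [inner_cross_cyclic, inner_cross_cyclic, cross_antisymm c b, inner_neg_right, neg_neg]

end CrossProduct

/-! ### Lagrangian frames and the splitting of Im 𝕆 that they induce -/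

/-- A Lagrangian frame of `S⁶` at the point `a`: three orthonormal vectors tangent to `S⁶` at `a`
and spanning an isotropic subspace for `omega`. -/
structure IsLagFrame (a : ImO) (F : Fin 3 → ImO) : Prop where
  base : inner ℝ a a = (1 : ℝ)
  orth : ∀ i j, inner ℝ (F i) (F j) = if i = j then (1 : ℝ) else 0
  tangent : ∀ i, inner ℝ a (F i) = (0 : ℝ)
  isotropic : ∀ i j, inner ℝ (cross a (F i)) (F j) = (0 : ℝ)

namespace IsLagFrame

variable {a : ImO} {F : Fin 3 → ImO} (h : IsLagFrame a F)

include h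

theorem inner_cross_cross_frame (i j : Fin 3) :
    inner ℝ (cross a (F i)) (cross a (F j)) = if i = j then (1 : ℝ) else 0 := by
  rw [inner_cross_cross, h.base, h.orth, h.tangent]
  simp

theorem orthonormal :
    Orthonormal ℝ (Sum.elim (fun _ : Unit => a) (Sum.elim F (fun i => cross a (F i)))) := by
  rw [orthonormal_iff_ite]
  rintro (i | i | i) (j | j | j)
  · simpa using h.base
  · simpa using h.tangent j
  · simpa [real_inner_comm] using inner_cross_self_left a (F j)
  · simpa [real_inner_comm] using h.tangent i
  · simpa using h.orth i j
  · simpa [real_inner_comm] using h.isotropic j i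
  · simpa using inner_cross_self_left a (F i)
  · simpa using h.isotropic i j
  · simpa using h.inner_cross_cross_frame i j

/-- The orthonormal basis of `ImO` formed by the base point, the frame and its image by `J`. -/
def basis : OrthonormalBasis (Unit ⊕ Fin 3 ⊕ Fin 3) ℝ ImO :=
  OrthonormalBasis.mk h.orthonormal
    (h.orthonormal.linearIndependent.span_eq_top_of_card_eq_finrank' (by simp)).ge

theorem inner_eq (u v : ImO) :
    inner ℝ u v = inner ℝ a u * inner ℝ a v + ∑ i, inner ℝ (F i) u * inner ℝ (F i) v
      + ∑ i, inner ℝ (cross a (F i)) u * inner ℝ (cross a (F i)) v := by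
  rw [← h.basis.sum_inner_mul_inner]
  simp only [Fintype.sum_sum_type, basis, OrthonormalBasis.coe_mk, Sum.elim_inl, Sum.elim_inr,
    real_inner_comm u]
  simp [add_assoc, real_inner_comm]

theorem eq_sum (u : ImO) :
    u = inner ℝ a u • a + ∑ i, inner ℝ (F i) u • F i
      + ∑ i, inner ℝ (cross a (F i)) u • cross a (F i) := by
  conv_lhs => rw [← h.basis.sum_repr' u]
  simp [Fintype.sum_sum_type, basis, add_assoc]

end IsLagFrame

open Filter Topology

/-! ### Lagrangian immersions of open sets of ℝ³: symmetry and tracelessness of the cubic -/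

section Cross

variable {E : Type*} [NormedAddCommGroup E] [NormedSpace ℝ E]

theorem _root_.ContDiffAt.cross {a b : E → ImO} {y : E} {n : WithTop ℕ∞} (ha : ContDiffAt ℝ n a y)
    (hb : ContDiffAt ℝ n b y) : ContDiffAt ℝ n (fun z => cross (a z) (b z)) y :=
  ContDiffAt.comp (g := fun q : ImO × ImO => S6.cross q.1 q.2) y
    isBoundedBilinearMap_cross.contDiff.contDiffAt (ha.prodMk hb)

theorem _root_.DifferentiableAt.cross {a b : E → ImO} {y : E} (ha : DifferentiableAt ℝ a y)
    (hb : DifferentiableAt ℝ b y) : DifferentiableAt ℝ (fun z => cross (a z) (b z)) y :=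
  DifferentiableAt.comp (g := fun q : ImO × ImO => S6.cross q.1 q.2) y
    (isBoundedBilinearMap_cross.differentiableAt (a y, b y)) (ha.prodMk hb)

theorem fderiv_cross_apply {a b : E → ImO} {y : E} (ha : DifferentiableAt ℝ a y)
    (hb : DifferentiableAt ℝ b y) (w : E) :
    fderiv ℝ (fun z => cross (a z) (b z)) y w
      = cross (a y) (fderiv ℝ b y w) + cross (fderiv ℝ a y w) (b y) := by
  have h := (isBoundedBilinearMap_cross.hasFDerivAt (a y, b y)).comp y
    (ha.hasFDerivAt.prodMk hb.hasFDerivAt)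
  have h2 := congrArg (fun T => T w) h.fderiv
  exact h2

end Cross

/-- A smooth map on the open set `Ω` of `ℝ³` that is a Lagrangian immersion in `S⁶` on `Ω`. -/
structure LagOn (f : E3 → ImO) (Ω : Set E3) : Prop where
  isOpen : IsOpen Ω
  smooth : ContDiffOn ℝ ∞ f Ω
  sphere : ∀ y ∈ Ω, inner ℝ (f y) (f y) = (1 : ℝ)
  inj : ∀ y ∈ Ω, Function.Injective (fderiv ℝ f y)
  isotropic : ∀ y ∈ Ω, ∀ u v, inner ℝ (cross (f y) (fderiv ℝ f y u)) (fderiv ℝ f y v) = (0 : ℝ)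

/-- The fundamental cubic of a map on an open set of `ℝ³`. -/
def cub (f : E3 → ImO) (y u v w : E3) : ℝ :=
  inner ℝ (fderiv ℝ (fderiv ℝ f) y u v) (cross (f y) (fderiv ℝ f y w))

/-- The metric induced by a map on an open set of `ℝ³`. -/
def met (f : E3 → ImO) (y u v : E3) : ℝ := inner ℝ (fderiv ℝ f y u) (fderiv ℝ f y v)

theorem fderiv_eq_zero_of_eq_on {F : Type*} [NormedAddCommGroup F] [NormedSpace ℝ F] {Ω : Set E3}
    (hΩ : IsOpen Ω) {g : E3 → F} {c : F}
    (hg : ∀ z ∈ Ω, g z = c) {y : E3} (hy : y ∈ Ω) : fderiv ℝ g y = 0 := by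
  have : g =ᶠ[𝓝 y] fun _ => c := by
    filter_upwards [hΩ.mem_nhds hy] with z hz using hg z hz
  rw [this.fderiv_eq]
  simp

namespace LagOn

variable {f : E3 → ImO} {Ω : Set E3} (h : LagOn f Ω) {y : E3} (hy : y ∈ Ω)

include h hy

theorem contDiffAt : ContDiffAt ℝ ∞ f y := h.smooth.contDiffAt (h.isOpen.mem_nhds hy)

theorem contDiffAt_fderiv : ContDiffAt ℝ ∞ (fderiv ℝ f) y :=
  (h.contDiffAt hy).fderiv_right (by simp)

theorem differentiableAt : DifferentiableAt ℝ f y := (h.contDiffAt hy).differentiableAt (by simp)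

theorem differentiableAt_fderiv : DifferentiableAt ℝ (fderiv ℝ f) y :=
  (h.contDiffAt_fderiv hy).differentiableAt (by simp)

theorem differentiableAt_fderiv_apply (u : E3) :
    DifferentiableAt ℝ (fun z => fderiv ℝ f z u) y :=
  (h.differentiableAt_fderiv hy).clm_apply (differentiableAt_const u)

theorem fderiv_fderiv_apply (u w : E3) :
    fderiv ℝ (fun z => fderiv ℝ f z u) y w = fderiv ℝ (fderiv ℝ f) y w u := by
  rw [fderiv_clm_apply (h.differentiableAt_fderiv hy) (differentiableAt_const u)]
  simp

theorem hess_symm (u v : E3) :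
    fderiv ℝ (fderiv ℝ f) y u v = fderiv ℝ (fderiv ℝ f) y v u :=
  (h.contDiffAt hy).isSymmSndFDerivAt (by simpa using (WithTop.coe_le_coe.mpr le_top : ((2 : ℕ∞) : WithTop ℕ∞) ≤ ∞)) u v

theorem inner_fderiv (u : E3) : inner ℝ (f y) (fderiv ℝ f y u) = (0 : ℝ) := by
  have h1 := fderiv_eq_zero_of_eq_on h.isOpen h.sphere hy
  have h2 := congrArg (fun T => T u) h1
  simp only [fderiv_inner_apply ℝ (h.differentiableAt hy) (h.differentiableAt hy)] at h2
  rw [real_inner_comm (f y) (fderiv ℝ f y u)] at h2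
  simpa using h2

theorem inner_hess (u v : E3) :
    inner ℝ (f y) (fderiv ℝ (fderiv ℝ f) y u v) = -met f y u v := by
  have h1 := fderiv_eq_zero_of_eq_on h.isOpen (g := fun z => (inner ℝ (f z) (fderiv ℝ f z v) : ℝ))
    (fun z hz => h.inner_fderiv hz v) hy
  have h2 := congrArg (fun T => T u) h1
  simp only [fderiv_inner_apply ℝ (h.differentiableAt hy) (h.differentiableAt_fderiv_apply hy v),
    h.fderiv_fderiv_apply hy] at h2
  simp only [met]
  simpa [add_eq_zero_iff_eq_neg] using h2

theorem cub_symm₁₂ (u v w : E3) : cub f y u v w = cub f y v u w := by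
  simp only [cub, h.hess_symm hy u v]

/-- This is the isotropy relation ⟨f × f_u, f_v⟩ = 0 differentiated along w; the right-hand side is
the term in which the base point of J is differentiated. -/
theorem cub_sub_swap (w u v : E3) : cub f y w u v - cub f y w v u =
    inner ℝ (cross (fderiv ℝ f y w) (fderiv ℝ f y u)) (fderiv ℝ f y v) := by
  have h1 := fderiv_eq_zero_of_eq_on h.isOpen
    (g := fun z => (inner ℝ (cross (f z) (fderiv ℝ f z u)) (fderiv ℝ f z v) : ℝ))
    (fun z hz => h.isotropic z hz u v) hy
  have h2 := congrArg (fun T => T w) h1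
  have d := h.differentiableAt hy
  have du := h.differentiableAt_fderiv_apply hy u
  have dv := h.differentiableAt_fderiv_apply hy v
  simp only [fderiv_inner_apply ℝ (d.cross du) dv, fderiv_cross_apply d du,
    h.fderiv_fderiv_apply hy, inner_add_left, _root_.zero_apply] at h2
  simp only [cub]
  rw [inner_cross_swap_right (f y) (fderiv ℝ (fderiv ℝ f) y w u)] at h2
  rw [real_inner_comm _ (fderiv ℝ (fderiv ℝ f) y w u),
    real_inner_comm _ (fderiv ℝ (fderiv ℝ f) y w v)]
  linarith

/-- In the cyclic sum of `cub_sub_swap` the left-hand sides cancel by symmetry in the first two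
slots, and the right-hand sides add up to three times the same cyclic quantity. -/
theorem phi_eq_zero (u v w : E3) :
    inner ℝ (cross (fderiv ℝ f y u) (fderiv ℝ f y v)) (fderiv ℝ f y w) = (0 : ℝ) := by
  have h1 := h.cub_sub_swap hy u v w
  have h2 := h.cub_sub_swap hy v w u
  have h3 := h.cub_sub_swap hy w u v
  rw [inner_cross_cyclic, real_inner_comm] at h3
  rw [real_inner_comm, ← inner_cross_cyclic] at h2
  rw [h.cub_symm₁₂ hy v w u, h.cub_symm₁₂ hy v u w] at h2
  rw [h.cub_symm₁₂ hy w u v] at h3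
  linarith

theorem cub_symm₂₃ (u v w : E3) : cub f y u v w = cub f y u w v := by
  have := h.cub_sub_swap hy u v w
  rw [h.phi_eq_zero hy] at this
  linarith

theorem deriv_phi (t u v w : E3) :
    inner ℝ (cross (fderiv ℝ (fderiv ℝ f) y t u) (fderiv ℝ f y v)) (fderiv ℝ f y w)
    + inner ℝ (cross (fderiv ℝ f y u) (fderiv ℝ (fderiv ℝ f) y t v)) (fderiv ℝ f y w)
    + inner ℝ (cross (fderiv ℝ f y u) (fderiv ℝ f y v)) (fderiv ℝ (fderiv ℝ f) y t w)
      = (0 : ℝ) := by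
  have h1 := fderiv_eq_zero_of_eq_on h.isOpen
    (g := fun z => (inner ℝ (cross (fderiv ℝ f z u) (fderiv ℝ f z v)) (fderiv ℝ f z w) : ℝ))
    (fun z hz => h.phi_eq_zero hz u v w) hy
  have h2 := congrArg (fun T => T t) h1
  have du := h.differentiableAt_fderiv_apply hy u
  have dv := h.differentiableAt_fderiv_apply hy v
  have dw := h.differentiableAt_fderiv_apply hy w
  simp only [fderiv_inner_apply ℝ (du.cross dv) dw, fderiv_cross_apply du dv,
    h.fderiv_fderiv_apply hy, inner_add_left, _root_.zero_apply] at h2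
  linarith

theorem isLagFrame {v : Fin 3 → E3} (hv : ∀ i j, met f y (v i) (v j) = if i = j then 1 else 0) :
    IsLagFrame (f y) (fun i => fderiv ℝ f y (v i)) where
  base := h.sphere y hy
  orth := hv
  tangent _ := h.inner_fderiv hy _
  isotropic _ _ := h.isotropic y hy _ _

end LagOn

namespace IsLagFrame

variable {a : ImO} {F : Fin 3 → ImO} (h : IsLagFrame a F)

include h

/-- The components `⟨F l × F k, J F m⟩` are totally skew. -/
theorem inner_cross_cross_base_swap (l k m : Fin 3) :
    inner ℝ (cross (F l) (F k)) (cross a (F m)) =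
      -inner ℝ (cross (F l) (F m)) (cross a (F k)) := by
  have h1 := inner_cross_cross (F k + F m) (F l) a
  have h2 := inner_cross_cross (F k) (F l) a
  have h3 := inner_cross_cross (F m) (F l) a
  have e (i : Fin 3) : inner ℝ (F i) a = (0 : ℝ) := by rw [real_inner_comm]; exact h.tangent i
  simp only [cross_add_left, inner_add_left, inner_add_right, e, mul_zero, add_zero, sub_zero,
    h2, h3] at h1
  rw [cross_antisymm (F l) (F k), cross_antisymm a (F m), cross_antisymm (F l) (F m),
    cross_antisymm a (F k)]
  simp only [inner_neg_left, inner_neg_right, neg_neg]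
  linarith

end IsLagFrame

/-- All components of F₀ × F₁ in the orthonormal basis (a, F, JF) vanish except the one along JF₂.
The sign s reflects the orientation of the frame. -/
theorem IsLagFrame.exists_sign {a : ImO} {F : Fin 3 → ImO} (h : IsLagFrame a F)
    (hphi : inner ℝ (cross (F 0) (F 1)) (F 2) = (0 : ℝ)) :
    ∃ s : ℝ, s ^ 2 = 1 ∧ cross (F 0) (F 1) = s • cross a (F 2) ∧
      cross (F 1) (F 2) = s • cross a (F 0) ∧ cross (F 2) (F 0) = s • cross a (F 1) := by
  set s : ℝ := inner ℝ (cross (F 0) (F 1)) (cross a (F 2)) with hs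
  have e12 : inner ℝ (cross (F 1) (F 2)) (cross a (F 0)) = s := by
    rw [hs, cross_antisymm (F 0), inner_neg_left, h.inner_cross_cross_base_swap 1 0 2, neg_neg]
  have e20 : inner ℝ (cross (F 2) (F 0)) (cross a (F 1)) = s := by
    rw [← e12, cross_antisymm (F 1), inner_neg_left, h.inner_cross_cross_base_swap 2 1 0, neg_neg]
  have z0 (l k : Fin 3) : inner ℝ a (cross (F l) (F k)) = (0 : ℝ) := by
    rw [← inner_cross_cyclic]; exact h.isotropic l k
  have z1 (l k : Fin 3) : inner ℝ (F l) (cross (F l) (F k)) = (0 : ℝ) := by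
    rw [real_inner_comm, inner_cross_self_left]
  have z2 (l k : Fin 3) : inner ℝ (F k) (cross (F l) (F k)) = (0 : ℝ) := by
    rw [real_inner_comm, inner_cross_self_right]
  have p1 : inner ℝ (F 2) (cross (F 0) (F 1)) = (0 : ℝ) := by rw [real_inner_comm, hphi]
  have p2 : inner ℝ (F 0) (cross (F 1) (F 2)) = (0 : ℝ) := by rw [← inner_cross_cyclic, hphi]
  have p3 : inner ℝ (F 1) (cross (F 2) (F 0)) = (0 : ℝ) := by rw [← inner_cross_cyclic, ← p2,
    real_inner_comm]
  have z3 (l k : Fin 3) : inner ℝ (cross a (F k)) (cross (F l) (F k)) = (0 : ℝ) := by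
    have := h.inner_cross_cross_base_swap l k k
    rw [real_inner_comm]; linarith
  have z4 (l k : Fin 3) : inner ℝ (cross a (F l)) (cross (F l) (F k)) = (0 : ℝ) := by
    rw [cross_antisymm (F l), inner_neg_right, z3, neg_zero]
  have q01 : cross (F 0) (F 1) = s • cross a (F 2) := by
    rw [h.eq_sum (cross (F 0) (F 1))]
    simp only [Fin.sum_univ_three, z0, z1, z2, z3, z4, p1, zero_smul, zero_add, add_zero]
    rw [real_inner_comm]
  have q12 : cross (F 1) (F 2) = s • cross a (F 0) := by
    rw [h.eq_sum (cross (F 1) (F 2))]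
    simp only [Fin.sum_univ_three, z0, z1, z2, z3, z4, p2, zero_smul, zero_add, add_zero]
    rw [real_inner_comm, e12]
  have q20 : cross (F 2) (F 0) = s • cross a (F 1) := by
    rw [h.eq_sum (cross (F 2) (F 0))]
    simp only [Fin.sum_univ_three, z0, z1, z2, z3, z4, p3, zero_smul, zero_add, add_zero]
    rw [real_inner_comm, e20]
  refine ⟨s, ?_, q01, q12, q20⟩
  -- Since F₀ and F₁ are orthonormal, F₀ × F₁ is a unit vector, whence s² = 1.
  have h1 := inner_cross_cross (F 0) (F 1) (F 1)
  rw [q01, inner_smul_left, inner_smul_right, h.inner_cross_cross_frame] at h1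
  simp only [h.orth] at h1
  simpa [pow_two] using h1

namespace LagOn

variable {f : E3 → ImO} {Ω : Set E3} (h : LagOn f Ω) {y : E3} (hy : y ∈ Ω)

include h hy

/-- Minimality comes from φ = 0: by `exists_sign`, differentiating φ(v₀, v₁, v₂) along w replaces
each product of two frame vectors by ± J of the third, and the three terms become ± the trace of
C(w,·,·). -/
theorem cub_trace {v : Fin 3 → E3} (hv : ∀ i j, met f y (v i) (v j) = if i = j then 1 else 0)
    (w : E3) : ∑ i, cub f y (v i) (v i) w = 0 := by
  have hF := h.isLagFrame hy hv
  obtain ⟨s, hs, q01, q12, q20⟩ := hF.exists_sign (h.phi_eq_zero hy _ _ _)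
  have h1 := h.deriv_phi hy w (v 0) (v 1) (v 2)
  have e0 : inner ℝ (cross (fderiv ℝ (fderiv ℝ f) y w (v 0)) (fderiv ℝ f y (v 1)))
      (fderiv ℝ f y (v 2)) = s * cub f y w (v 0) (v 0) := by
    rw [inner_cross_cyclic, q12, inner_smul_right]; rfl
  have e1 : inner ℝ (cross (fderiv ℝ f y (v 0)) (fderiv ℝ (fderiv ℝ f) y w (v 1)))
      (fderiv ℝ f y (v 2)) = s * cub f y w (v 1) (v 1) := by
    rw [real_inner_comm, ← inner_cross_cyclic, q20, inner_smul_left, real_inner_comm]; rfl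
  have e2 : inner ℝ (cross (fderiv ℝ f y (v 0)) (fderiv ℝ f y (v 1)))
      (fderiv ℝ (fderiv ℝ f) y w (v 2)) = s * cub f y w (v 2) (v 2) := by
    rw [q01, inner_smul_left, real_inner_comm]; rfl
  rw [e0, e1, e2] at h1
  have e (i : Fin 3) : cub f y (v i) (v i) w = cub f y w (v i) (v i) := by
    rw [h.cub_symm₂₃ hy, h.cub_symm₁₂ hy]
  simp only [Fin.sum_univ_three, e]
  have hs0 : s ≠ 0 := by rintro rfl; simp at hs
  have : s * (cub f y w (v 0) (v 0) + cub f y w (v 1) (v 1) + cub f y w (v 2) (v 2)) = 0 := by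
    linarith
  exact (mul_eq_zero.mp this).resolve_left hs0

end LagOn

/-! ### Behaviour under change of parameters -/

section Reparametrization

variable {f : E3 → ImO} {Ω : Set E3} {θ : E3 → E3} {y : E3}

theorem fderiv_comp_apply' (hf : DifferentiableAt ℝ f (θ y)) (hθ : DifferentiableAt ℝ θ y) (u : E3) :
    fderiv ℝ (f ∘ θ) y u = fderiv ℝ f (θ y) (fderiv ℝ θ y u) := by
  rw [fderiv_comp y hf hθ]; rfl

theorem LagOn.comp (h : LagOn f Ω) {Ω' : Set E3} (hΩ' : IsOpen Ω') (hθ : ContDiffOn ℝ ∞ θ Ω')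
    (hmaps : Set.MapsTo θ Ω' Ω) (hinj : ∀ z ∈ Ω', Function.Injective (fderiv ℝ θ z)) :
    LagOn (f ∘ θ) Ω' := by
  have key (z) (hz : z ∈ Ω') (u : E3) :
      fderiv ℝ (f ∘ θ) z u = fderiv ℝ f (θ z) (fderiv ℝ θ z u) :=
    fderiv_comp_apply' (h.differentiableAt (hmaps hz))
      ((hθ.contDiffAt (hΩ'.mem_nhds hz)).differentiableAt (by simp)) u
  refine ⟨hΩ', h.smooth.comp hθ hmaps, fun z hz => h.sphere _ (hmaps hz), fun z hz => ?_,
    fun z hz u v => ?_⟩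
  · intro u v huv
    rw [key z hz, key z hz] at huv
    exact hinj z hz (h.inj _ (hmaps hz) huv)
  · rw [key z hz, key z hz]
    exact h.isotropic _ (hmaps hz) _ _

/-- The non-tensorial term df(D²θ) of the second derivative is tangent, hence orthogonal to J of the
tangent space. -/
theorem LagOn.cub_comp (h : LagOn f Ω) (hy : θ y ∈ Ω) (hθ : ContDiffAt ℝ 2 θ y) (u v w : E3) :
    cub (f ∘ θ) y u v w =
      cub f (θ y) (fderiv ℝ θ y u) (fderiv ℝ θ y v) (fderiv ℝ θ y w) := by
  have hθd : ∀ᶠ z in 𝓝 y, DifferentiableAt ℝ θ z := by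
    filter_upwards [hθ.eventually (by simp)] with z hz using hz.differentiableAt (by simp)
  have hθ0 := hθd.self_of_nhds
  have hin : ∀ᶠ z in 𝓝 y, θ z ∈ Ω := hθ.continuousAt.eventually (h.isOpen.mem_nhds hy)
  have hθ' : DifferentiableAt ℝ (fderiv ℝ θ) y :=
    (hθ.fderiv_right (m := 1) (by norm_num)).differentiableAt (by simp)
  have e1 : fderiv ℝ (f ∘ θ) =ᶠ[𝓝 y] fun z => (fderiv ℝ f (θ z)).comp (fderiv ℝ θ z) := by
    filter_upwards [hθd, hin] with z hz hz' using fderiv_comp z (h.differentiableAt hz') hz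
  have e2 : DifferentiableAt ℝ (fun z => fderiv ℝ f (θ z)) y :=
    (h.differentiableAt_fderiv hy).comp y hθ0
  have e3 : fderiv ℝ (fun z => fderiv ℝ f (θ z)) y u =
      fderiv ℝ (fderiv ℝ f) (θ y) (fderiv ℝ θ y u) := by
    have := fderiv_comp y (h.differentiableAt_fderiv hy) hθ0
    exact congrArg (fun T => T u) this
  have e4 : fderiv ℝ (fderiv ℝ (f ∘ θ)) y u v =
      fderiv ℝ (fderiv ℝ f) (θ y) (fderiv ℝ θ y u) (fderiv ℝ θ y v)
        + fderiv ℝ f (θ y) (fderiv ℝ (fderiv ℝ θ) y u v) := by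
    rw [e1.fderiv_eq, fderiv_clm_comp e2 hθ']
    simp [e3, add_comm]
  simp only [cub]
  rw [e4, fderiv_comp_apply' (h.differentiableAt hy) hθ0, inner_add_left]
  have := h.isotropic _ hy (fderiv ℝ θ y w) (fderiv ℝ (fderiv ℝ θ) y u v)
  rw [real_inner_comm] at this
  simp only [Function.comp_apply]
  rw [this, add_zero]

theorem met_comp (hf : DifferentiableAt ℝ f (θ y)) (hθ : DifferentiableAt ℝ θ y) (u v : E3) :
    met (f ∘ θ) y u v = met f (θ y) (fderiv ℝ θ y u) (fderiv ℝ θ y v) := by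
  simp only [met, fderiv_comp_apply' hf hθ]

theorem _root_.Filter.EventuallyEq.cub_eq {g : E3 → ImO} (hfg : f =ᶠ[𝓝 y] g) (u v w : E3) :
    cub f y u v w = cub g y u v w := by
  simp only [cub, hfg.fderiv.fderiv_eq, hfg.fderiv_eq, hfg.eq_of_nhds]

theorem _root_.Filter.EventuallyEq.met_eq {g : E3 → ImO} (hfg : f =ᶠ[𝓝 y] g) (u v : E3) :
    met f y u v = met g y u v := by
  simp only [met, hfg.fderiv_eq]

theorem injective_fderiv_of_leftInverse {κ κ' : E3 → E3} (hκ : DifferentiableAt ℝ κ y)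
    (hκ' : DifferentiableAt ℝ κ' (κ y)) (hid : ∀ᶠ z in 𝓝 y, κ' (κ z) = z) :
    Function.Injective (fderiv ℝ κ y) := by
  have e : (κ' ∘ κ) =ᶠ[𝓝 y] id := hid
  have e2 := e.fderiv_eq (𝕜 := ℝ)
  rw [fderiv_comp y hκ' hκ, fderiv_id] at e2
  intro u v huv
  have hu := congrArg (fun T => T u) e2
  have hv := congrArg (fun T => T v) e2
  simp only [ContinuousLinearMap.comp_apply, ContinuousLinearMap.id_apply] at hu hv
  rw [← hu, ← hv, huv]

end Reparametrization

/-! ### From the manifold to maps on ℝ³ -/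

section Chart

variable {L : Type*} [TopologicalSpace L] [ChartedSpace E3 L]

theorem contDiffAt_chartChange [IsManifold 𝓘(ℝ, E3) ∞ L] (p q : L) {y : E3}
    (hy : y ∈ (extChartAt 𝓘(ℝ, E3) p).target)
    (hq : (extChartAt 𝓘(ℝ, E3) p).symm y ∈ (extChartAt 𝓘(ℝ, E3) q).source) :
    ContDiffAt ℝ ∞ (extChartAt 𝓘(ℝ, E3) q ∘ (extChartAt 𝓘(ℝ, E3) p).symm) y := by
  have := contDiffWithinAt_ext_coord_change (I := 𝓘(ℝ, E3)) (n := ∞) q p (y := y) (by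
    rw [PartialEquiv.trans_source, PartialEquiv.symm_source]; exact ⟨hy, hq⟩)
  rwa [ModelWithCorners.range_eq_univ, contDiffWithinAt_univ] at this

theorem eventually_symm_mem_source (p q : L) {y : E3}
    (hy : y ∈ (extChartAt 𝓘(ℝ, E3) p).target)
    (hq : (extChartAt 𝓘(ℝ, E3) p).symm y ∈ (extChartAt 𝓘(ℝ, E3) q).source) :
    ∀ᶠ z in 𝓝 y, z ∈ (extChartAt 𝓘(ℝ, E3) p).target ∧
      (extChartAt 𝓘(ℝ, E3) p).symm z ∈ (extChartAt 𝓘(ℝ, E3) q).source := by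
  have h1 : (extChartAt 𝓘(ℝ, E3) p).target ∈ 𝓝 y :=
    (isOpen_extChartAt_target p).mem_nhds hy
  have h2 : ContinuousAt (extChartAt 𝓘(ℝ, E3) p).symm y := continuousAt_extChartAt_symm'' hy
  filter_upwards [h1, h2.eventually ((isOpen_extChartAt_source (I := 𝓘(ℝ, E3)) q).mem_nhds hq)]
    with z hz hz' using ⟨hz, hz'⟩

theorem injective_fderiv_chartChange [IsManifold 𝓘(ℝ, E3) ∞ L] (p q : L) {y : E3}
    (hy : y ∈ (extChartAt 𝓘(ℝ, E3) p).target)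
    (hq : (extChartAt 𝓘(ℝ, E3) p).symm y ∈ (extChartAt 𝓘(ℝ, E3) q).source) :
    Function.Injective
      (fderiv ℝ (extChartAt 𝓘(ℝ, E3) q ∘ (extChartAt 𝓘(ℝ, E3) p).symm) y) := by
  refine injective_fderiv_of_leftInverse
    (κ' := extChartAt 𝓘(ℝ, E3) p ∘ (extChartAt 𝓘(ℝ, E3) q).symm)
    ((contDiffAt_chartChange p q hy hq).differentiableAt (by simp))
    ((contDiffAt_chartChange q p ?_ ?_).differentiableAt (by simp)) ?_
  · exact (extChartAt 𝓘(ℝ, E3) q).map_source hq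
  · simp only [Function.comp_apply]
    rw [(extChartAt 𝓘(ℝ, E3) q).left_inv hq]
    exact (extChartAt 𝓘(ℝ, E3) p).map_target hy
  · filter_upwards [eventually_symm_mem_source p q hy hq] with z hz
    simp only [Function.comp_apply]
    rw [(extChartAt 𝓘(ℝ, E3) q).left_inv hz.2, (extChartAt 𝓘(ℝ, E3) p).right_inv hz.1]

theorem localRep_eventuallyEq (x : L → ImO) (p q : L) {y : E3}
    (hy : y ∈ (extChartAt 𝓘(ℝ, E3) p).target)
    (hq : (extChartAt 𝓘(ℝ, E3) p).symm y ∈ (extChartAt 𝓘(ℝ, E3) q).source) :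
    localRep x p =ᶠ[𝓝 y]
      localRep x q ∘ (extChartAt 𝓘(ℝ, E3) q ∘ (extChartAt 𝓘(ℝ, E3) p).symm) := by
  filter_upwards [eventually_symm_mem_source p q hy hq] with z hz
  simp only [localRep, Function.comp_apply]
  rw [(extChartAt 𝓘(ℝ, E3) q).left_inv hz.2]

theorem localRep_apply (x : L → ImO) (p : L) :
    localRep x p (extChartAt 𝓘(ℝ, E3) p p) = x p := by
  simp only [localRep, Function.comp_apply, extChartAt_to_inv]

variable {x : L → ImO}

theorem IsLagrangianImmersion.dx_eq (hx : IsLagrangianImmersion x) (p : L) :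
    dx x p = fderiv ℝ (localRep x p) (extChartAt 𝓘(ℝ, E3) p p) := by
  have h : MDifferentiableAt 𝓘(ℝ, E3) 𝓘(ℝ, ImO) x p :=
    (hx.smooth p).mdifferentiableAt (by simp)
  have h2 : dx x p = fderivWithin ℝ (writtenInExtChartAt 𝓘(ℝ, E3) 𝓘(ℝ, ImO) p x)
      (Set.range 𝓘(ℝ, E3)) (extChartAt 𝓘(ℝ, E3) p p) := if_pos h
  rw [h2, ModelWithCorners.range_eq_univ, fderivWithin_univ]
  rfl

theorem IsLagrangianImmersion.contDiffAt_localRep (hx : IsLagrangianImmersion x) (p : L) :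
    ContDiffAt ℝ ∞ (localRep x p) (extChartAt 𝓘(ℝ, E3) p p) := by
  have h := (contMDiffAt_iff.mp (hx.smooth p)).2
  rw [ModelWithCorners.range_eq_univ, contDiffWithinAt_univ] at h
  exact h

theorem IsLagrangianImmersion.metric_eq (hx : IsLagrangianImmersion x) (p : L) (u v : E3) :
    metric x p u v = met (localRep x p) (extChartAt 𝓘(ℝ, E3) p p) u v := by
  simp only [metric, met, hx.dx_eq]

/-- J(dx w) is already normal by the Lagrangian condition, so the projection in the second
fundamental form is invisible to the cubic. -/
theorem IsLagrangianImmersion.fundamentalCubic_eq (hx : IsLagrangianImmersion x) (p : L)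
    (u v w : E3) :
    fundamentalCubic x p u v w = cub (localRep x p) (extChartAt 𝓘(ℝ, E3) p p) u v w := by
  have hmem : J (x p) (dx x p w) ∈ normalSpace x p := by
    rw [normalSpace, Submodule.mem_orthogonal]
    intro a ha
    obtain ⟨b, hb, c, hc, rfl⟩ := Submodule.mem_sup.mp ha
    obtain ⟨r, rfl⟩ := Submodule.mem_span_singleton.mp hb
    obtain ⟨u, rfl⟩ := hc
    rw [inner_add_left, inner_smul_left]
    have h1 : inner ℝ (x p) (J (x p) (dx x p w)) = (0 : ℝ) := by
      rw [real_inner_comm]; exact inner_cross_self_left _ _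
    have h2 := hx.omega_eq_zero p w u
    rw [omega, real_inner_comm] at h2
    simp [h1, h2]
  rw [fundamentalCubic, secondFundamentalForm, cub, Submodule.inner_starProjection_left_eq_right,
    Submodule.starProjection_eq_self_iff.mpr hmem, localRep_apply, hx.dx_eq]
  rfl

variable [IsManifold 𝓘(ℝ, E3) ∞ L]

/-- The hypotheses speak at each point through its own preferred chart. Comparing with the chart at
p by transition maps spreads them over the whole target of that chart. -/
theorem IsLagrangianImmersion.lagOn_localRep (hx : IsLagrangianImmersion x) (p : L) :
    LagOn (localRep x p) (extChartAt 𝓘(ℝ, E3) p).target := by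
  have hs (y) (hy : y ∈ (extChartAt 𝓘(ℝ, E3) p).target) :
      (extChartAt 𝓘(ℝ, E3) p).symm y ∈
        (extChartAt 𝓘(ℝ, E3) ((extChartAt 𝓘(ℝ, E3) p).symm y)).source :=
    mem_extChartAt_source _
  have key (y) (hy : y ∈ (extChartAt 𝓘(ℝ, E3) p).target) (u : E3) :
      fderiv ℝ (localRep x p) y u = dx x ((extChartAt 𝓘(ℝ, E3) p).symm y)
        (fderiv ℝ (extChartAt 𝓘(ℝ, E3) ((extChartAt 𝓘(ℝ, E3) p).symm y) ∘
          (extChartAt 𝓘(ℝ, E3) p).symm) y u) := by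
    rw [(localRep_eventuallyEq x p _ hy (hs y hy)).fderiv_eq, fderiv_comp_apply', hx.dx_eq]
    · rfl
    · exact (hx.contDiffAt_localRep _).differentiableAt (by simp)
    · exact (contDiffAt_chartChange p _ hy (hs y hy)).differentiableAt (by simp)
  refine ⟨isOpen_extChartAt_target p, fun y hy => ContDiffAt.contDiffWithinAt ?_, fun y hy => ?_,
    fun y hy u v huv => ?_, fun y hy u v => ?_⟩
  · refine ContDiffAt.congr_of_eventuallyEq ?_ (localRep_eventuallyEq x p _ hy (hs y hy))
    exact (hx.contDiffAt_localRep _).comp y (contDiffAt_chartChange p _ hy (hs y hy))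
  · have := hx.mem_sphere ((extChartAt 𝓘(ℝ, E3) p).symm y)
    rw [mem_sphere_zero_iff_norm] at this
    rw [real_inner_self_eq_norm_sq, localRep, Function.comp_apply, this, one_pow]
  · rw [key y hy, key y hy] at huv
    exact injective_fderiv_chartChange p _ hy (hs y hy) (hx.immersion _ huv)
  · rw [key y hy, key y hy]
    exact hx.omega_eq_zero _ _ _

/-- Around every point, `L` is parametrized by `ℝ³`. -/
theorem IsLagrangianImmersion.exists_param (hx : IsLagrangianImmersion x) (p : L) :
    ∃ ψ : E3 → L, Continuous ψ ∧ IsOpenMap ψ ∧ ψ 0 = p ∧ LagOn (x ∘ ψ) Set.univ ∧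
      ∀ y, ∃ τ : E3 ≃ₗ[ℝ] E3,
        (∀ u, fderiv ℝ (x ∘ ψ) y u = dx x (ψ y) (τ u)) ∧
        (∀ u v, metric x (ψ y) (τ u) (τ v) = met (x ∘ ψ) y u v) ∧
        ∀ u v w, fundamentalCubic x (ψ y) (τ u) (τ v) (τ w) = cub (x ∘ ψ) y u v w := by
  obtain ⟨r, hr, hball⟩ := Metric.isOpen_iff.mp (isOpen_extChartAt_target (I := 𝓘(ℝ, E3)) p) _
    (mem_extChartAt_target (I := 𝓘(ℝ, E3)) p)
  set c := extChartAt 𝓘(ℝ, E3) p p with hc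
  -- A ball in the chart is stretched diffeomorphically to all of ℝ³, so that the parameter domain
  -- is connected, carries a global frame and needs no boundary bookkeeping.
  set b := OpenPartialHomeomorph.univBall (P := E3) c r with hb
  have hbs : ContDiff ℝ ∞ b := OpenPartialHomeomorph.contDiff_univBall
  have hbmem (y : E3) : b y ∈ Metric.ball c r := by
    rw [← OpenPartialHomeomorph.univBall_target c hr]
    exact b.map_source (by simp [hb])
  have hbinj (y : E3) : Function.Injective (fderiv ℝ b y) :=
    injective_fderiv_of_leftInverse (κ' := b.symm) (hbs.contDiffAt.differentiableAt (by simp))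
      ((OpenPartialHomeomorph.contDiffOn_univBall_symm (n := ⊤)).contDiffAt
        (Metric.isOpen_ball.mem_nhds (hbmem y)) |>.differentiableAt (by simp))
      (Eventually.of_forall fun z => b.left_inv (by simp [hb]))
  have hlag : LagOn (localRep x p ∘ b) Set.univ :=
    (hx.lagOn_localRep p).comp isOpen_univ hbs.contDiffOn (fun y _ => hball (hbmem y))
      (fun y _ => hbinj y)
  refine ⟨(extChartAt 𝓘(ℝ, E3) p).symm ∘ b, ?_, ?_, ?_, hlag, fun y => ?_⟩
  · exact (continuousOn_extChartAt_symm p).comp_continuous hbs.continuous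
      (fun y => hball (hbmem y))
  · have h1 : IsOpenMap b := fun s hs => b.isOpen_image_of_subset_source hs (by simp [hb])
    intro s hs
    rw [Set.image_comp]
    have h2 : b '' s ⊆ (extChartAt 𝓘(ℝ, E3) p).target := by
      rintro _ ⟨z, -, rfl⟩; exact hball (hbmem z)
    rw [(extChartAt 𝓘(ℝ, E3) p).symm_image_eq_source_inter_preimage h2]
    exact (continuousOn_extChartAt p).isOpen_inter_preimage (isOpen_extChartAt_source p) (h1 s hs)
  · simp [hb, hc]
  · set q := (extChartAt 𝓘(ℝ, E3) p).symm (b y) with hq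
    have hyt := hball (hbmem y)
    have hqs : (extChartAt 𝓘(ℝ, E3) p).symm (b y) ∈ (extChartAt 𝓘(ℝ, E3) q).source :=
      mem_extChartAt_source q
    set θ : E3 → E3 := extChartAt 𝓘(ℝ, E3) q ∘ (extChartAt 𝓘(ℝ, E3) p).symm with hθ
    have hθs : ContDiffAt ℝ ∞ θ (b y) := contDiffAt_chartChange p q hyt hqs
    have hθbs : ContDiffAt ℝ ∞ (θ ∘ b) y := hθs.comp y hbs.contDiffAt
    have hd : DifferentiableAt ℝ (θ ∘ b) y := hθbs.differentiableAt (by simp)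
    have hinj : Function.Injective (fderiv ℝ (θ ∘ b) y) := by
      rw [fderiv_comp y (hθs.differentiableAt (by simp))
        (hbs.contDiffAt.differentiableAt (by simp))]
      exact (injective_fderiv_chartChange p q hyt hqs).comp (hbinj y)
    have heq : x ∘ ((extChartAt 𝓘(ℝ, E3) p).symm ∘ b) =ᶠ[𝓝 y] localRep x q ∘ (θ ∘ b) :=
      hbs.continuous.continuousAt.eventually (localRep_eventuallyEq x p q hyt hqs)
    have hval : (θ ∘ b) y = extChartAt 𝓘(ℝ, E3) q q := rfl
    have hLq := hx.lagOn_localRep q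
    have hmem : (θ ∘ b) y ∈ (extChartAt 𝓘(ℝ, E3) q).target := mem_extChartAt_target q
    refine ⟨LinearEquiv.ofInjectiveEndo (fderiv ℝ (θ ∘ b) y).toLinearMap hinj, fun u => ?_,
      fun u v => ?_, fun u v w => ?_⟩
    · rw [heq.fderiv_eq, fderiv_comp_apply' (hLq.differentiableAt hmem) hd, hx.dx_eq]
      rfl
    · rw [heq.met_eq, met_comp (hLq.differentiableAt hmem) hd, hx.metric_eq]
      rfl
    · rw [heq.cub_eq, hLq.cub_comp hmem (hθbs.of_le (WithTop.coe_le_coe.mpr le_top)),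
        hx.fundamentalCubic_eq]
      rfl

end Chart

/-! ### The Gauss equation -/

/-- The standard basis vector of `ℝ³`. -/
abbrev stdVec (i : Fin 3) : E3 := EuclideanSpace.single i 1

theorem eq_sum_stdVec (u : E3) : u = ∑ i, u i • stdVec i := by
  ext j
  simp [Finset.sum_apply, Pi.single_apply]

/-- The matrix of the induced metric. -/
def metMat (f : E3 → ImO) (y : E3) : Matrix (Fin 3) (Fin 3) ℝ :=
  fun i j => met f y (stdVec i) (stdVec j)

theorem met_comm (f : E3 → ImO) (y u v : E3) : met f y u v = met f y v u := real_inner_comm _ _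

theorem met_eq_sum (f : E3 → ImO) (y u v : E3) :
    met f y u v = ∑ i, ∑ j, u i * v j * metMat f y i j := by
  simp only [met, metMat]
  conv_lhs => rw [eq_sum_stdVec u, eq_sum_stdVec v]
  simp only [map_sum, map_smul, sum_inner, inner_sum, inner_smul_left, inner_smul_right,
    Finset.mul_sum, conj_trivial]
  rw [Finset.sum_comm]
  exact Finset.sum_congr rfl fun i _ => Finset.sum_congr rfl fun j _ => by ring

theorem cub_eq_sum₁₂ (f : E3 → ImO) (y u v w : E3) :
    cub f y u v w = ∑ i, ∑ j, u i * v j * cub f y (stdVec i) (stdVec j) w := by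
  simp only [cub]
  conv_lhs => rw [eq_sum_stdVec u, eq_sum_stdVec v]
  simp only [map_sum, map_smul, _root_.sum_apply, sum_inner, _root_.smul_apply,
    inner_smul_left, Finset.mul_sum, conj_trivial]
  rw [Finset.sum_comm]
  exact Finset.sum_congr rfl fun i _ => Finset.sum_congr rfl fun j _ => by ring

namespace LagOn

variable {f : E3 → ImO} {Ω : Set E3} (h : LagOn f Ω) {y : E3} (hy : y ∈ Ω)

include h hy

theorem partialD_metMat (i j l : Fin 3) : partialD i (fun z => metMat f z j l) y =
    inner ℝ (fderiv ℝ (fderiv ℝ f) y (stdVec i) (stdVec j)) (fderiv ℝ f y (stdVec l)) +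
    inner ℝ (fderiv ℝ (fderiv ℝ f) y (stdVec i) (stdVec l)) (fderiv ℝ f y (stdVec j)) := by
  simp only [partialD, metMat, met]
  rw [fderiv_inner_apply ℝ (h.differentiableAt_fderiv_apply hy _)
    (h.differentiableAt_fderiv_apply hy _), h.fderiv_fderiv_apply hy, h.fderiv_fderiv_apply hy,
    real_inner_comm, add_comm]

theorem det_metMat_ne_zero : (metMat f y).det ≠ 0 := by
  intro h0
  obtain ⟨c, hc, hc0⟩ := Matrix.exists_mulVec_eq_zero_iff.mpr h0
  apply hc
  have h1 : met f y (WithLp.toLp 2 c) (WithLp.toLp 2 c) = 0 := by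
    rw [met_eq_sum]
    have h2 (i : Fin 3) : ∑ j, c i * c j * metMat f y i j = c i * (metMat f y).mulVec c i := by
      rw [Matrix.mulVec, dotProduct, Finset.mul_sum]
      exact Finset.sum_congr rfl fun j _ => by ring
    simp [h2, hc0]
  rw [met, inner_self_eq_zero] at h1
  have := h.inj y hy (h1.trans (map_zero _).symm)
  exact (WithLp.toLp_injective 2) this

/-- For an induced metric the three derivatives in the Koszul formula collapse to ⟨∂ᵢ∂ⱼf, ∂ₗf⟩. -/
theorem christoffel_eq (k i j : Fin 3) : christoffel (metMat f) k i j y =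
    ∑ l, (metMat f y)⁻¹ k l *
      inner ℝ (fderiv ℝ (fderiv ℝ f) y (stdVec i) (stdVec j)) (fderiv ℝ f y (stdVec l)) := by
  rw [christoffel, Finset.mul_sum]
  refine Finset.sum_congr rfl fun l _ => ?_
  rw [h.partialD_metMat hy, h.partialD_metMat hy, h.partialD_metMat hy,
    h.hess_symm hy (stdVec j) (stdVec i), h.hess_symm hy (stdVec l) (stdVec i),
    h.hess_symm hy (stdVec l) (stdVec j)]
  ring

theorem sum_christoffel_mul (i j m : Fin 3) :
    ∑ k, christoffel (metMat f) k i j y * metMat f y k m =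
      inner ℝ (fderiv ℝ (fderiv ℝ f) y (stdVec i) (stdVec j)) (fderiv ℝ f y (stdVec m)) := by
  have hsymm (k : Fin 3) : metMat f y k m = metMat f y m k := met_comm _ _ _ _
  simp only [h.christoffel_eq hy, Finset.sum_mul, hsymm]
  rw [Finset.sum_comm]
  have hinv := Matrix.mul_nonsing_inv (metMat f y) (Ne.isUnit (h.det_metMat_ne_zero hy))
  have h1 (l : Fin 3) : ∑ k, (metMat f y) m k * (metMat f y)⁻¹ k l = if m = l then 1 else 0 := by
    rw [← Matrix.mul_apply, hinv, Matrix.one_apply]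
  have h2 (l : Fin 3) : ∑ k, (metMat f y)⁻¹ k l *
      inner ℝ (fderiv ℝ (fderiv ℝ f) y (stdVec i) (stdVec j)) (fderiv ℝ f y (stdVec l)) *
        metMat f y m k = (if m = l then 1 else 0) *
      inner ℝ (fderiv ℝ (fderiv ℝ f) y (stdVec i) (stdVec j)) (fderiv ℝ f y (stdVec l)) := by
    rw [← h1, Finset.sum_mul]
    exact Finset.sum_congr rfl fun k _ => by ring
  simp [h2]

theorem differentiableAt_metMat (i j : Fin 3) :
    DifferentiableAt ℝ (fun z => metMat f z i j) y :=
  (h.differentiableAt_fderiv_apply hy _).inner ℝ (h.differentiableAt_fderiv_apply hy _)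

theorem differentiableAt_hess_apply (i j : Fin 3) :
    DifferentiableAt ℝ (fun z => fderiv ℝ (fderiv ℝ f) z (stdVec i) (stdVec j)) y :=
  ((((h.contDiffAt_fderiv hy).fderiv_right (m := ∞) (by simp)).differentiableAt
    (by simp)).clm_apply (differentiableAt_const _)).clm_apply (differentiableAt_const _)

theorem differentiableAt_christoffel (k i j : Fin 3) :
    DifferentiableAt ℝ (christoffel (metMat f) k i j) y := by
  have e : christoffel (metMat f) k i j =ᶠ[𝓝 y] fun z => ∑ l, (metMat f z)⁻¹ k l *
      inner ℝ (fderiv ℝ (fderiv ℝ f) z (stdVec i) (stdVec j)) (fderiv ℝ f z (stdVec l)) := by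
    filter_upwards [h.isOpen.mem_nhds hy] with z hz using h.christoffel_eq hz k i j
  refine DifferentiableAt.congr_of_eventuallyEq ?_ e
  have hg := h.differentiableAt_metMat hy
  have hinv (k l : Fin 3) : DifferentiableAt ℝ (fun z => (metMat f z)⁻¹ k l) y := by
    have hdet : DifferentiableAt ℝ (fun z => (metMat f z).det) y := by
      simp only [Matrix.det_fin_three]
      fun_prop
    have hadj : DifferentiableAt ℝ (fun z => (metMat f z).adjugate k l) y := by
      simp only [Matrix.adjugate_fin_three]
      fin_cases k <;> fin_cases l <;> simp <;> fun_prop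
    simp only [Matrix.inv_def, Ring.inverse_eq_inv', Matrix.smul_apply, smul_eq_mul]
    exact (hdet.inv (h.det_metMat_ne_zero hy)).mul hadj
  refine DifferentiableAt.fun_sum fun l _ => (hinv k l).mul ?_
  exact (h.differentiableAt_hess_apply hy i j).inner ℝ (h.differentiableAt_fderiv_apply hy _)

/-- The part of the second derivative orthogonal to the tangent space, in coordinates. -/
theorem inner_normalHess (j k m : Fin 3) :
    inner ℝ (fderiv ℝ (fderiv ℝ f) y (stdVec j) (stdVec k) -
      ∑ l, christoffel (metMat f) l j k y • fderiv ℝ f y (stdVec l)) (fderiv ℝ f y (stdVec m))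
      = (0 : ℝ) := by
  rw [inner_sub_left, ← h.sum_christoffel_mul hy, sum_inner]
  simp [inner_smul_left, metMat, met]

/-- Obtained by differentiating `sum_christoffel_mul`. Skew-symmetrizing in i and j will turn the
left-hand side into the curvature tensor with a lowered index. -/
theorem sum_partialD_christoffel (i j k m : Fin 3) :
    ∑ l, metMat f y l m * (partialD i (christoffel (metMat f) l j k) y +
      ∑ n, christoffel (metMat f) l i n y * christoffel (metMat f) n j k y) =
    inner ℝ (fderiv ℝ (fun z => fderiv ℝ (fderiv ℝ f) z (stdVec j) (stdVec k)) y (stdVec i))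
      (fderiv ℝ f y (stdVec m)) +
    inner ℝ (fderiv ℝ (fderiv ℝ f) y (stdVec j) (stdVec k) -
      ∑ l, christoffel (metMat f) l j k y • fderiv ℝ f y (stdVec l))
      (fderiv ℝ (fderiv ℝ f) y (stdVec i) (stdVec m)) := by
  have e : (fun z => ∑ l, christoffel (metMat f) l j k z * metMat f z l m) =ᶠ[𝓝 y] fun z =>
      (inner ℝ (fderiv ℝ (fderiv ℝ f) z (stdVec j) (stdVec k)) (fderiv ℝ f z (stdVec m)) : ℝ) := by
    filter_upwards [h.isOpen.mem_nhds hy] with z hz using h.sum_christoffel_mul hz j k m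
  have e2 := congrArg (fun T => T (stdVec i)) (e.fderiv_eq (𝕜 := ℝ))
  have hΓ (l : Fin 3) := h.differentiableAt_christoffel hy l j k
  have hg (l : Fin 3) := h.differentiableAt_metMat hy l m
  rw [fderiv_fun_sum (fun l _ => (hΓ l).fun_mul (hg l)), fderiv_inner_apply ℝ
    (h.differentiableAt_hess_apply hy j k) (h.differentiableAt_fderiv_apply hy _),
    h.fderiv_fderiv_apply hy] at e2
  have e3 (l : Fin 3) : fderiv ℝ (fun z => christoffel (metMat f) l j k z * metMat f z l m) y
      (stdVec i) = christoffel (metMat f) l j k y * partialD i (fun z => metMat f z l m) y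
        + metMat f y l m * partialD i (christoffel (metMat f) l j k) y := by
    rw [fderiv_fun_mul (hΓ l) (hg l)]
    simp [partialD]
  simp only [_root_.sum_apply, e3, h.partialD_metMat hy] at e2
  have e4 : ∑ l, metMat f y l m *
      ∑ n, christoffel (metMat f) l i n y * christoffel (metMat f) n j k y =
      ∑ n, christoffel (metMat f) n j k y *
        inner ℝ (fderiv ℝ (fderiv ℝ f) y (stdVec i) (stdVec n)) (fderiv ℝ f y (stdVec m)) := by
    simp only [← h.sum_christoffel_mul hy, Finset.mul_sum]
    rw [Finset.sum_comm]
    exact Finset.sum_congr rfl fun _ _ => Finset.sum_congr rfl fun _ _ => by ring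
  simp only [mul_add, Finset.sum_add_distrib] at e2 ⊢
  rw [e4, inner_sub_left, sum_inner]
  simp only [inner_smul_left, conj_trivial]
  have e5 (l : Fin 3) : inner ℝ (fderiv ℝ (fderiv ℝ f) y (stdVec i) (stdVec m))
      (fderiv ℝ f y (stdVec l)) = (inner ℝ (fderiv ℝ f y (stdVec l))
        (fderiv ℝ (fderiv ℝ f) y (stdVec i) (stdVec m)) : ℝ) := real_inner_comm _ _
  simp only [e5] at e2
  linarith

theorem third_symm (i j k : Fin 3) :
    fderiv ℝ (fun z => fderiv ℝ (fderiv ℝ f) z (stdVec j) (stdVec k)) y (stdVec i) =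
    fderiv ℝ (fun z => fderiv ℝ (fderiv ℝ f) z (stdVec i) (stdVec k)) y (stdVec j) := by
  have hF : ContDiffAt ℝ ∞ (fun z => fderiv ℝ f z (stdVec k)) y :=
    (h.contDiffAt_fderiv hy).clm_apply contDiffAt_const
  have key (a b : Fin 3) :
      fderiv ℝ (fun z => fderiv ℝ (fderiv ℝ f) z (stdVec a) (stdVec k)) y (stdVec b) =
      fderiv ℝ (fderiv ℝ (fun z => fderiv ℝ f z (stdVec k))) y (stdVec b) (stdVec a) := by
    have e : (fun z => fderiv ℝ (fderiv ℝ f) z (stdVec a) (stdVec k)) =ᶠ[𝓝 y]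
        fun z => fderiv ℝ (fun z => fderiv ℝ f z (stdVec k)) z (stdVec a) := by
      filter_upwards [h.isOpen.mem_nhds hy] with z hz
      rw [h.fderiv_fderiv_apply hz]
    rw [e.fderiv_eq, fderiv_clm_apply
      ((hF.fderiv_right (m := ∞) (by simp)).differentiableAt (by simp)) (differentiableAt_const _)]
    simp
  rw [key, key]
  exact hF.isSymmSndFDerivAt
    (by simpa using (WithTop.coe_le_coe.mpr le_top : ((2 : ℕ∞) : WithTop ℕ∞) ≤ ∞)) _ _

/-- The Gauss equation in coordinates. -/
theorem gauss_coord {v : Fin 3 → E3} (hv : ∀ i j, met f y (v i) (v j) = if i = j then 1 else 0)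
    (i j k m : Fin 3) :
    ∑ l, metMat f y l m * curvature (metMat f) l k i j y =
      (metMat f y j k * metMat f y i m +
        ∑ a, cub f y (stdVec j) (stdVec k) (v a) * cub f y (stdVec i) (stdVec m) (v a)) -
      (metMat f y i k * metMat f y j m +
        ∑ a, cub f y (stdVec i) (stdVec k) (v a) * cub f y (stdVec j) (stdVec m) (v a)) := by
  have hF := h.isLagFrame hy hv
  -- The normal part n of the Hessian has component −g along the position vector, none along the
  -- tangent space, and C along the J-images of the frame. The first component yields the curvature
  -- 1 of the ambient sphere.
  have key (j k i m : Fin 3) : inner ℝ (fderiv ℝ (fderiv ℝ f) y (stdVec j) (stdVec k) -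
      ∑ l, christoffel (metMat f) l j k y • fderiv ℝ f y (stdVec l))
      (fderiv ℝ (fderiv ℝ f) y (stdVec i) (stdVec m)) = metMat f y j k * metMat f y i m +
        ∑ a, cub f y (stdVec j) (stdVec k) (v a) * cub f y (stdVec i) (stdVec m) (v a) := by
    set n := fderiv ℝ (fderiv ℝ f) y (stdVec j) (stdVec k) -
      ∑ l, christoffel (metMat f) l j k y • fderiv ℝ f y (stdVec l) with hn
    have h1 : inner ℝ (f y) n = -metMat f y j k := by
      rw [hn, inner_sub_right, inner_sum, h.inner_hess hy]
      simp [inner_smul_right, h.inner_fderiv hy, metMat]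
    have h2 (w : E3) : inner ℝ (fderiv ℝ f y w) n = (0 : ℝ) := by
      rw [eq_sum_stdVec w]
      simp only [map_sum, map_smul, sum_inner, inner_smul_left]
      refine Finset.sum_eq_zero fun l _ => ?_
      rw [real_inner_comm, h.inner_normalHess hy, mul_zero]
    have h3 (a : Fin 3) : inner ℝ (cross (f y) (fderiv ℝ f y (v a))) n =
        cub f y (stdVec j) (stdVec k) (v a) := by
      rw [hn, inner_sub_right, inner_sum, cub, real_inner_comm]
      simp [inner_smul_right, h.isotropic y hy]
    rw [hF.inner_eq, h1, h.inner_hess hy]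
    simp only [h2, h3, zero_mul, Finset.sum_const_zero, add_zero]
    congr 1
    · simp [metMat]
    · exact Finset.sum_congr rfl fun a _ => by
        rw [cub, cub, real_inner_comm (cross _ _), real_inner_comm (cross _ _)
          (fderiv ℝ (fderiv ℝ f) y (stdVec i) (stdVec m))]
  have e1 := h.sum_partialD_christoffel hy i j k m
  have e2 := h.sum_partialD_christoffel hy j i k m
  rw [key] at e1 e2
  -- The third derivatives of f now agree in `e1` and `e2` and cancel in the difference.
  rw [h.third_symm hy j i k] at e2
  simp only [curvature, Finset.sum_sub_distrib]
  simp only [mul_add, mul_sub, Finset.sum_add_distrib, Finset.sum_sub_distrib] at e1 e2 ⊢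
  linarith

/-- The Gauss equation. -/
theorem sum_curvature {v : Fin 3 → E3}
    (hv : ∀ i j, met f y (v i) (v j) = if i = j then 1 else 0) (u w : E3) :
    ∑ i, ∑ j, ∑ k, ∑ l, ∑ m, u i * w j * w k * u m * metMat f y l m *
      curvature (metMat f) l k i j y =
    met f y u u * met f y w w - met f y u w ^ 2 +
      ∑ a, (cub f y u u (v a) * cub f y w w (v a) - cub f y u w (v a) ^ 2) := by
  have e1 : ∀ i j k : Fin 3, ∑ l, ∑ m, u i * w j * w k * u m * metMat f y l m *
      curvature (metMat f) l k i j y = ∑ m, u i * w j * w k * u m *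
        ((metMat f y j k * metMat f y i m +
        ∑ a, cub f y (stdVec j) (stdVec k) (v a) * cub f y (stdVec i) (stdVec m) (v a)) -
      (metMat f y i k * metMat f y j m +
        ∑ a, cub f y (stdVec i) (stdVec k) (v a) * cub f y (stdVec j) (stdVec m) (v a))) := by
    intro i j k
    rw [Finset.sum_comm]
    refine Finset.sum_congr rfl fun m _ => ?_
    rw [← h.gauss_coord hy hv, Finset.mul_sum]
    exact Finset.sum_congr rfl fun _ _ => by ring
  simp only [e1]
  -- The metric term and each C(·,·,vₐ) term have the same shape in a symmetric form p, so a single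
  -- expansion serves for both.
  have gen (p : Fin 3 → Fin 3 → ℝ) (hp : ∀ i j, p i j = p j i) :
      ∑ i, ∑ j, ∑ k, ∑ m, u i * w j * w k * u m * (p j k * p i m - p i k * p j m) =
      (∑ i, ∑ j, u i * u j * p i j) * (∑ i, ∑ j, w i * w j * p i j) -
        (∑ i, ∑ j, u i * w j * p i j) ^ 2 := by
    simp only [Fin.sum_univ_three, hp 1 0, hp 2 0, hp 2 1]
    ring
  have g1 := gen (metMat f y) (fun i j => met_comm _ _ _ _)
  have g2 (a : Fin 3) := gen (fun i j => cub f y (stdVec i) (stdVec j) (v a))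
    (fun i j => h.cub_symm₁₂ hy _ _ _)
  rw [met_eq_sum f y u u, met_eq_sum f y w w, met_eq_sum f y u w, ← g1]
  simp only [cub_eq_sum₁₂ f y u u, cub_eq_sum₁₂ f y w w, cub_eq_sum₁₂ f y u w, ← g2]
  simp only [Fin.sum_univ_three (f := fun a => ∑ i, ∑ j, ∑ k, ∑ m, u i * w j * w k * u m * _)]
  simp only [← Finset.sum_add_distrib]
  refine Finset.sum_congr rfl fun i _ => Finset.sum_congr rfl fun j _ =>
    Finset.sum_congr rfl fun k _ => Finset.sum_congr rfl fun m _ => ?_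
  simp only [Fin.sum_univ_three]
  ring

end LagOn

/-! ### Harmonic cubics and the infimum of the sectional curvature -/

/-- Symmetric trace-free cubic forms on `ℝ³`, given by their components. -/
structure IsHarmonicCubic (c : Fin 3 → Fin 3 → Fin 3 → ℝ) : Prop where
  symm₁₂ : ∀ i j k, c i j k = c j i k
  symm₂₃ : ∀ i j k, c i j k = c i k j
  trace : ∀ k, ∑ i, c i i k = 0

/-- The cubic form `c` has a null direction. -/
def HasNullVector (c : Fin 3 → Fin 3 → Fin 3 → ℝ) : Prop :=
  ∃ n : Fin 3 → ℝ, n ≠ 0 ∧ ∀ j k, ∑ i, n i * c i j k = 0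

/-- The squared norm of a cubic form. -/
def normSqCubic (c : Fin 3 → Fin 3 → Fin 3 → ℝ) : ℝ := ∑ i, ∑ j, ∑ k, c i j k ^ 2

theorem IsHarmonicCubic.gauss_identity {c : Fin 3 → Fin 3 → Fin 3 → ℝ} (h : IsHarmonicCubic c)
    (a b n : Fin 3 → ℝ) (h0 : n 0 = a 1 * b 2 - a 2 * b 1) (h1 : n 1 = a 2 * b 0 - a 0 * b 2)
    (h2 : n 2 = a 0 * b 1 - a 1 * b 0) :
    ∑ k, ((∑ i, ∑ j, a i * a j * c i j k) * (∑ i, ∑ j, b i * b j * c i j k) -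
      (∑ i, ∑ j, a i * b j * c i j k) ^ 2) =
    ∑ j, ∑ k, (∑ i, n i * c i j k) ^ 2 - 1 / 2 * normSqCubic c * ∑ i, n i ^ 2 := by
  have t0 := h.trace 0
  have t1 := h.trace 1
  have t2 := h.trace 2
  simp only [Fin.sum_univ_three] at t0 t1 t2
  -- Symmetry and the trace condition leave seven independent components; in these, both sides agree
  -- as polynomials.
  have e000 : c 0 0 0 = -c 0 1 1 - c 0 2 2 := by
    rw [h.symm₁₂ 1 1 0, h.symm₂₃ 1 1 0, h.symm₁₂ 1 0 1, h.symm₂₃ 2 2 0, h.symm₁₂ 2 0 2] at t0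
    linarith
  have e111 : c 1 1 1 = -c 0 0 1 - c 1 2 2 := by
    rw [h.symm₂₃ 2 2 1, h.symm₁₂ 2 1 2] at t1; linarith
  have e222 : c 2 2 2 = -c 0 0 2 - c 1 1 2 := by linarith
  simp only [Fin.sum_univ_three, normSqCubic, h0, h1, h2]
  rw [h.symm₂₃ 0 1 0, h.symm₂₃ 0 2 0, h.symm₂₃ 0 2 1, h.symm₂₃ 1 1 0, h.symm₂₃ 1 2 0,
    h.symm₂₃ 1 2 1, h.symm₂₃ 2 1 0, h.symm₂₃ 2 2 0, h.symm₂₃ 2 2 1,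
    h.symm₁₂ 1 0 0, h.symm₁₂ 1 0 1, h.symm₁₂ 1 0 2, h.symm₁₂ 2 0 0, h.symm₁₂ 2 0 1, h.symm₁₂ 2 0 2,
    h.symm₁₂ 2 1 1, h.symm₁₂ 2 1 2, h.symm₂₃ 0 1 0, h.symm₂₃ 0 2 0, h.symm₂₃ 0 2 1, h.symm₂₃ 1 2 1,
    e000, e111, e222]
  ring

/-- The infimum of the sectional curvatures in terms of the cubic form. -/
theorem sInf_eq_iff_hasNullVector (c : Fin 3 → Fin 3 → Fin 3 → ℝ) (r : ℝ) :
    sInf {s : ℝ | ∃ n : Fin 3 → ℝ, n ≠ 0 ∧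
      s = r + (∑ j, ∑ k, (∑ i, n i * c i j k) ^ 2) / ∑ i, n i ^ 2} = r ↔ HasNullVector c := by
  set S := {s : ℝ | ∃ n : Fin 3 → ℝ, n ≠ 0 ∧
      s = r + (∑ j, ∑ k, (∑ i, n i * c i j k) ^ 2) / ∑ i, n i ^ 2} with hS
  have hnn (n : Fin 3 → ℝ) : 0 ≤ ∑ j, ∑ k, (∑ i, n i * c i j k) ^ 2 :=
    Finset.sum_nonneg fun j _ => Finset.sum_nonneg fun k _ => sq_nonneg _
  have hsq (n : Fin 3 → ℝ) : 0 ≤ ∑ i, n i ^ 2 := Finset.sum_nonneg fun i _ => sq_nonneg _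
  have hpos {n : Fin 3 → ℝ} (hn : n ≠ 0) : 0 < ∑ i, n i ^ 2 := by
    obtain ⟨i, hi⟩ := Function.ne_iff.mp hn
    exact Finset.sum_pos' (fun i _ => sq_nonneg _) ⟨i, Finset.mem_univ _, sq_pos_of_ne_zero hi⟩
  have hlb : ∀ s ∈ S, r ≤ s := by
    rintro s ⟨n, hn, rfl⟩
    have := div_nonneg (hnn n) (hsq n)
    linarith
  have hzero {n : Fin 3 → ℝ} (h : ∑ j, ∑ k, (∑ i, n i * c i j k) ^ 2 = 0) (j k : Fin 3) :
      ∑ i, n i * c i j k = 0 := by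
    have h2 := (Finset.sum_eq_zero_iff_of_nonneg (fun j _ =>
      Finset.sum_nonneg fun k _ => sq_nonneg (∑ i, n i * c i j k))).mp h j (Finset.mem_univ _)
    have h3 := (Finset.sum_eq_zero_iff_of_nonneg
      (fun k _ => sq_nonneg (∑ i, n i * c i j k))).mp h2 k (Finset.mem_univ _)
    exact pow_eq_zero_iff (two_ne_zero) |>.mp h3
  constructor
  · intro h
    -- The quotient is homogeneous of degree zero, so its values are those on the compact unit
    -- sphere and the infimum is attained.
    have himg : S = (fun n : E3 => r + ∑ j, ∑ k, (∑ i, n i * c i j k) ^ 2) ''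
        Metric.sphere 0 1 := by
      ext s
      constructor
      · rintro ⟨n, hn, rfl⟩
        set t := Real.sqrt (∑ i, n i ^ 2) with ht
        have ht0 : 0 < t := Real.sqrt_pos.mpr (hpos hn)
        have ht2 : t ^ 2 = ∑ i, n i ^ 2 := Real.sq_sqrt (hsq n)
        refine ⟨WithLp.toLp 2 (fun i => t⁻¹ * n i), ?_, ?_⟩
        · rw [mem_sphere_zero_iff_norm, EuclideanSpace.norm_eq, Real.sqrt_eq_one]
          simp only [Real.norm_eq_abs, sq_abs, mul_pow, ← Finset.mul_sum, ← ht2]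
          field_simp
        · simp only [mul_assoc, ← Finset.mul_sum, mul_pow, ← ht2]
          field_simp
      · rintro ⟨n, hn, rfl⟩
        rw [mem_sphere_zero_iff_norm, EuclideanSpace.norm_eq, Real.sqrt_eq_one] at hn
        simp only [Real.norm_eq_abs, sq_abs] at hn
        refine ⟨n, ?_, ?_⟩
        · intro h0
          simp [h0] at hn
        · simp only [hn, div_one]
    have hcomp : IsCompact S := by
      rw [himg]
      exact (isCompact_sphere 0 1).image (by fun_prop)
    have hne : S.Nonempty := ⟨_, fun _ => 1, by simp [funext_iff], rfl⟩
    obtain ⟨n, hn, hn2⟩ := hcomp.sInf_mem hne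
    rw [h] at hn2
    refine ⟨n, hn, hzero ?_⟩
    have : (∑ j, ∑ k, (∑ i, n i * c i j k) ^ 2) / ∑ i, n i ^ 2 = 0 := by linarith
    exact (div_eq_zero_iff.mp this).resolve_right (hpos hn).ne'
  · rintro ⟨n, hn, hn2⟩
    refine IsLeast.csInf_eq ⟨⟨n, hn, ?_⟩, hlb⟩
    simp [hn2]

theorem cub_sum (f : E3 → ImO) (y : E3) (v : Fin 3 → E3) (a b d : Fin 3 → ℝ) :
    cub f y (∑ i, a i • v i) (∑ j, b j • v j) (∑ k, d k • v k) =
      ∑ i, ∑ j, ∑ k, a i * b j * d k * cub f y (v i) (v j) (v k) := by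
  simp only [cub, map_sum, map_smul, _root_.sum_apply, sum_inner, _root_.smul_apply,
    inner_smul_left, Finset.mul_sum, conj_trivial, cross_sum_right, cross_smul_right, inner_sum,
    inner_smul_right]
  simp only [Fin.sum_univ_three]
  ring

theorem cub_sum₁₂ (f : E3 → ImO) (y : E3) (v : Fin 3 → E3) (a b : Fin 3 → ℝ) (w : E3) :
    cub f y (∑ i, a i • v i) (∑ j, b j • v j) w =
      ∑ i, ∑ j, a i * b j * cub f y (v i) (v j) w := by
  simp only [cub, map_sum, map_smul, _root_.sum_apply, sum_inner, _root_.smul_apply,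
    inner_smul_left, Finset.mul_sum, conj_trivial]
  rw [Finset.sum_comm]
  exact Finset.sum_congr rfl fun i _ => Finset.sum_congr rfl fun j _ => by ring

section Orthonormal

variable {f : E3 → ImO} {y : E3} {v : Fin 3 → E3}

theorem met_sum (hv : ∀ i j, met f y (v i) (v j) = if i = j then 1 else 0) (a b : Fin 3 → ℝ) :
    met f y (∑ i, a i • v i) (∑ j, b j • v j) = ∑ i, a i * b i := by
  have : met f y (∑ i, a i • v i) (∑ j, b j • v j) =
      ∑ j, ∑ i, b j * a i * met f y (v i) (v j) := by
    simp only [met, map_sum, map_smul, sum_inner, inner_sum, inner_smul_left, inner_smul_right,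
      Finset.mul_sum, conj_trivial]
    exact Finset.sum_congr rfl fun i _ => Finset.sum_congr rfl fun j _ => by ring
  rw [this]
  simp [hv, mul_comm]

theorem met_sum_right (hv : ∀ i j, met f y (v i) (v j) = if i = j then 1 else 0) (a : Fin 3 → ℝ)
    (i : Fin 3) : met f y (v i) (∑ j, a j • v j) = a i := by
  simp only [met, map_sum, map_smul, inner_sum, inner_smul_right]
  change ∑ x, a x * met f y (v i) (v x) = a i
  simp [hv]

theorem linearIndependent_of_met (hv : ∀ i j, met f y (v i) (v j) = if i = j then 1 else 0) :
    LinearIndependent ℝ v := by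
  rw [Fintype.linearIndependent_iff]
  intro a ha i
  rw [← met_sum_right hv a i, ha]
  simp [met]

/-- The basis of `ℝ³` given by vectors that are orthonormal for the induced metric. -/
def basisOfMet (hv : ∀ i j, met f y (v i) (v j) = if i = j then 1 else 0) :
    Module.Basis (Fin 3) ℝ E3 :=
  basisOfLinearIndependentOfCardEqFinrank (linearIndependent_of_met hv) (by simp)

theorem coe_basisOfMet (hv : ∀ i j, met f y (v i) (v j) = if i = j then 1 else 0) :
    ⇑(basisOfMet hv) = v :=
  coe_basisOfLinearIndependentOfCardEqFinrank _ _

theorem exists_eq_sum (hv : ∀ i j, met f y (v i) (v j) = if i = j then 1 else 0) (u : E3) :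
    ∃ a : Fin 3 → ℝ, u = ∑ i, a i • v i :=
  ⟨(basisOfMet hv).repr u, by
    conv_lhs => rw [← (basisOfMet hv).sum_repr u, coe_basisOfMet]⟩

theorem LagOn.exists_orthonormal {Ω : Set E3} (h : LagOn f Ω) (hy : y ∈ Ω) :
    ∃ v : Fin 3 → E3, ∀ i j, met f y (v i) (v j) = if i = j then 1 else 0 := by
  set T := LinearMap.range (fderiv ℝ f y).toLinearMap
  let e : E3 ≃ₗ[ℝ] T := LinearEquiv.ofInjective _ (h.inj y hy)
  have hT : Module.finrank ℝ T = 3 := by rw [← e.finrank_eq]; simp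
  let b := (stdOrthonormalBasis ℝ T).reindex (finCongr hT)
  have hb (i : Fin 3) : fderiv ℝ f y (e.symm (b i)) = b i := by
    have := e.apply_symm_apply (b i)
    exact congrArg Subtype.val this
  refine ⟨fun i => e.symm (b i), fun i j => ?_⟩
  rw [met, hb, hb]
  exact orthonormal_iff_ite.mp b.orthonormal i j

theorem LagOn.isHarmonicCubic {Ω : Set E3} (h : LagOn f Ω) (hy : y ∈ Ω)
    (hv : ∀ i j, met f y (v i) (v j) = if i = j then 1 else 0) :
    IsHarmonicCubic (fun i j k => cub f y (v i) (v j) (v k)) where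
  symm₁₂ _ _ _ := h.cub_symm₁₂ hy _ _ _
  symm₂₃ _ _ _ := h.cub_symm₂₃ hy _ _ _
  trace _ := h.cub_trace hy hv _

/-- Sectional curvatures in terms of the fundamental cubic. -/
theorem LagOn.sum_curvature_eq {Ω : Set E3} (h : LagOn f Ω) (hy : y ∈ Ω)
    (hv : ∀ i j, met f y (v i) (v j) = if i = j then 1 else 0) (a b n : Fin 3 → ℝ)
    (h0 : n 0 = a 1 * b 2 - a 2 * b 1) (h1 : n 1 = a 2 * b 0 - a 0 * b 2)
    (h2 : n 2 = a 0 * b 1 - a 1 * b 0) (hn : n ≠ 0) {u w : E3} (hu : u = ∑ i, a i • v i)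
    (hw : w = ∑ i, b i • v i) :
    (∑ i, ∑ j, ∑ k, ∑ l, ∑ m, u i * w j * w k * u m * metMat f y l m *
      curvature (metMat f) l k i j y) / (met f y u u * met f y w w - met f y u w ^ 2) =
    1 - 1 / 2 * normSqCubic (fun i j k => cub f y (v i) (v j) (v k)) +
      (∑ j, ∑ k, (∑ i, n i * cub f y (v i) (v j) (v k)) ^ 2) / ∑ i, n i ^ 2 := by
  rw [h.sum_curvature hy hv]
  have hg : met f y u u * met f y w w - met f y u w ^ 2 = ∑ i, n i ^ 2 := by
    rw [hu, hw, met_sum hv, met_sum hv, met_sum hv]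
    simp only [Fin.sum_univ_three, h0, h1, h2]
    ring
  have hc := (h.isHarmonicCubic hy hv).gauss_identity a b n h0 h1 h2
  have hne : ∑ i, n i ^ 2 ≠ 0 := by
    obtain ⟨i, hi⟩ := Function.ne_iff.mp hn
    exact (Finset.sum_pos' (fun i _ => sq_nonneg (n i))
      ⟨i, Finset.mem_univ _, sq_pos_of_ne_zero hi⟩).ne'
  rw [hg]
  have e : ∑ k, (cub f y u u (v k) * cub f y w w (v k) - cub f y u w (v k) ^ 2) =
      ∑ k, ((∑ i, ∑ j, a i * a j * cub f y (v i) (v j) (v k)) *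
        (∑ i, ∑ j, b i * b j * cub f y (v i) (v j) (v k)) -
      (∑ i, ∑ j, a i * b j * cub f y (v i) (v j) (v k)) ^ 2) := by
    simp only [hu, hw, cub_sum₁₂]
  rw [e, hc]
  field_simp
  ring

/-- Every nonzero vector is thus the normal of a plane, so the infimum over planes can be taken over
normals. The witnesses divide by a nonzero coordinate of n. -/
theorem exists_crossProduct_eq {n : Fin 3 → ℝ} (hn : n ≠ 0) : ∃ a b : Fin 3 → ℝ,
    n 0 = a 1 * b 2 - a 2 * b 1 ∧ n 1 = a 2 * b 0 - a 0 * b 2 ∧ n 2 = a 0 * b 1 - a 1 * b 0 := by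
  obtain ⟨i, hi⟩ := Function.ne_iff.mp hn
  simp only [Pi.zero_apply] at hi
  fin_cases i
  · simp only [Fin.zero_eta] at hi
    exact ⟨![-n 1, n 0, 0], ![-n 2 / n 0, 0, 1], by simp, by simp, by simp; field_simp⟩
  · simp only [Fin.mk_one] at hi
    exact ⟨![n 1, -n 0, 0], ![0, n 2 / n 1, -1], by simp, by simp, by simp; field_simp⟩
  · simp only [Fin.reduceFinMk] at hi
    exact ⟨![n 2, 0, -n 0], ![0, 1, -n 1 / n 2], by simp, by simp; field_simp, by simp⟩

end Orthonormal

/-! ### Chen's equality as the existence of a null vector -/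

section Chen

variable {L : Type*} [TopologicalSpace L] [ChartedSpace E3 L] [IsManifold 𝓘(ℝ, E3) ∞ L]
  {x : L → ImO}

/-- The sum of the three curvatures exceeds 1 − |C|²/2 by exactly 2, so the equality says that the
infimum over normals is the absolute lower bound 1 − |C|²/2, which is attained only at null vectors.
-/
theorem IsLagrangianImmersion.chenInvariant_eq_two_iff (hx : IsLagrangianImmersion x) {p : L}
    {v : Fin 3 → E3} (hv : IsOrthonormalBasis x p v) :
    chenInvariant x p v = 2 ↔
      HasNullVector (fun i j k => fundamentalCubic x p (v i) (v j) (v k)) := by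
  have hL := hx.lagOn_localRep p
  have hy := mem_extChartAt_target (I := 𝓘(ℝ, E3)) p
  set f := localRep x p
  set y := extChartAt 𝓘(ℝ, E3) p p
  have hv' : ∀ i j, met f y (v i) (v j) = if i = j then 1 else 0 := by
    intro i j
    rw [← hv i j, hx.metric_eq]
  simp only [hx.fundamentalCubic_eq]
  set c := fun i j k => cub f y (v i) (v j) (v k) with hc
  have hcH : IsHarmonicCubic c := hL.isHarmonicCubic hy hv'
  have sec (u w : E3) : sectionalCurvature x p u w =
      (∑ i, ∑ j, ∑ k, ∑ l, ∑ m, u i * w j * w k * u m * metMat f y l m *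
      curvature (metMat f) l k i j y) / (met f y u u * met f y w w - met f y u w ^ 2) := by
    rw [sectionalCurvature, hx.metric_eq, hx.metric_eq, hx.metric_eq]
    rfl
  have hset : {s | ∃ u w : E3, LinearIndependent ℝ ![u, w] ∧ s = sectionalCurvature x p u w} =
      {s : ℝ | ∃ n : Fin 3 → ℝ, n ≠ 0 ∧
        s = (1 - 1 / 2 * normSqCubic c) +
          (∑ j, ∑ k, (∑ i, n i * c i j k) ^ 2) / ∑ i, n i ^ 2} := by
    ext s
    constructor
    · rintro ⟨u, w, hli, rfl⟩
      obtain ⟨a, ha⟩ := exists_eq_sum hv' u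
      obtain ⟨b, hb⟩ := exists_eq_sum hv' w
      have hn : ![a 1 * b 2 - a 2 * b 1, a 2 * b 0 - a 0 * b 2, a 0 * b 1 - a 1 * b 0] ≠ 0 := by
        intro h0
        have e0 := congrFun h0 0
        have e1 := congrFun h0 1
        have e2 := congrFun h0 2
        simp at e0 e1 e2
        have hb0 (i : Fin 3) : b i • u + (-a i) • w = 0 := by
          have h3 : b i • u + (-a i) • w = ∑ k, (b i * a k - a i * b k) • v k := by
            rw [ha, hb]
            simp only [Finset.smul_sum, smul_smul, ← Finset.sum_add_distrib, ← add_smul]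
            exact Finset.sum_congr rfl fun k _ => by ring_nf
          rw [h3]
          refine Finset.sum_eq_zero fun k _ => ?_
          have : b i * a k - a i * b k = 0 := by
            fin_cases i <;> fin_cases k <;> simp only [Fin.zero_eta, Fin.mk_one, Fin.reduceFinMk] <;>
              linarith
          rw [this, zero_smul]
        have ha0 (i : Fin 3) : a i = 0 := by
          have := (LinearIndependent.pair_iff.mp hli _ _ (hb0 i)).2
          linarith
        exact hli.ne_zero 0 (by simp [ha, ha0])
      exact ⟨_, hn, (sec u w).trans (hL.sum_curvature_eq hy hv' a b _ rfl rfl rfl hn ha hb)⟩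
    · rintro ⟨n, hn, rfl⟩
      obtain ⟨a, b, h0, h1, h2⟩ := exists_crossProduct_eq hn
      refine ⟨∑ i, a i • v i, ∑ i, b i • v i, ?_,
        (((sec _ _).trans (hL.sum_curvature_eq hy hv' a b n h0 h1 h2 hn rfl rfl))).symm⟩
      rw [LinearIndependent.pair_iff]
      intro s t hst
      have e (i : Fin 3) : s * a i + t * b i = 0 := by
        have := congrArg (met f y (v i)) hst
        have h3 : s • ∑ i, a i • v i + t • ∑ i, b i • v i = ∑ i, (s * a i + t * b i) • v i := by
          simp only [Finset.smul_sum, smul_smul, ← Finset.sum_add_distrib, add_smul]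
        rw [h3, met_sum_right hv'] at this
        simpa [met] using this
      have e0 := e 0
      have e1 := e 1
      have e2 := e 2
      have hs (i : Fin 3) : s * n i = 0 ∧ t * n i = 0 := by
        fin_cases i
        · simp only [Fin.zero_eta, h0]
          exact ⟨by linear_combination b 2 * e1 - b 1 * e2, by linear_combination a 1 * e2 - a 2 * e1⟩
        · simp only [Fin.mk_one, h1]
          exact ⟨by linear_combination b 0 * e2 - b 2 * e0, by linear_combination a 2 * e0 - a 0 * e2⟩
        · simp only [Fin.reduceFinMk, h2]
          exact ⟨by linear_combination b 1 * e0 - b 0 * e1, by linear_combination a 0 * e1 - a 1 * e0⟩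
      obtain ⟨i, hi⟩ := Function.ne_iff.mp hn
      exact ⟨(mul_eq_zero.mp (hs i).1).resolve_right hi, (mul_eq_zero.mp (hs i).2).resolve_right hi⟩
  have single (i : Fin 3) : v i = ∑ k, (Pi.single i 1 : Fin 3 → ℝ) k • v k := by
    simp [Pi.single_apply]
  -- The coordinate planes have the normals e₂, −e₁, e₀, whose contractions with C add up to |C|²:
  -- the total is 3(1 − |C|²/2) + |C|².
  have hsum : ∑ i, ∑ j ∈ Finset.Ioi i, sectionalCurvature x p (v i) (v j) =
      2 + (1 - 1 / 2 * normSqCubic c) := by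
    have s01 := (sec (v 0) (v 1)).trans (hL.sum_curvature_eq hy hv' (Pi.single 0 1) (Pi.single 1 1)
      (Pi.single 2 1) (by simp) (by simp) (by simp) (by simp) (single 0) (single 1))
    have s02 := (sec (v 0) (v 2)).trans (hL.sum_curvature_eq hy hv' (Pi.single 0 1) (Pi.single 2 1)
      (-Pi.single 1 1) (by simp) (by simp) (by simp) (by simp) (single 0) (single 2))
    have s12 := (sec (v 1) (v 2)).trans (hL.sum_curvature_eq hy hv' (Pi.single 1 1) (Pi.single 2 1)
      (Pi.single 0 1) (by simp) (by simp) (by simp) (by simp) (single 1) (single 2))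
    have i0 : Finset.Ioi (0 : Fin 3) = {1, 2} := by decide
    have i1 : Finset.Ioi (1 : Fin 3) = {2} := by decide
    have i2 : Finset.Ioi (2 : Fin 3) = ∅ := by decide
    rw [Fin.sum_univ_three, i0, i1, i2]
    simp only [Finset.sum_pair (show (1 : Fin 3) ≠ 2 by decide), Finset.sum_singleton,
      Finset.sum_empty, s01, s02, s12]
    simp [normSqCubic, Fin.sum_univ_three, hc, Pi.single_apply]
    ring
  rw [chenInvariant, hset, hsum, ← sInf_eq_iff_hasNullVector c (1 - 1 / 2 * normSqCubic c)]
  constructor <;> intro h <;> linarith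

end Chen

/-! ### Stabilizers of harmonic cubics on Euclidean ℝ³: from S₃ to a null vector -/

section Euclidean

/-- A harmonic (symmetric, trace-free) trilinear form on Euclidean `ℝ³`. -/
structure IsHarmonicForm (C : E3 → E3 → E3 → ℝ) : Prop where
  add₁ : ∀ u u' v w, C (u + u') v w = C u v w + C u' v w
  smul₁ : ∀ (r : ℝ) u v w, C (r • u) v w = r * C u v w
  symm₁₂ : ∀ u v w, C u v w = C v u w
  symm₂₃ : ∀ u v w, C u v w = C u w v
  trace : ∀ (b : OrthonormalBasis (Fin 3) ℝ E3) w, ∑ i, C (b i) (b i) w = 0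

namespace IsHarmonicForm

variable {C : E3 → E3 → E3 → ℝ} (hC : IsHarmonicForm C)

include hC

theorem add₂ (u v v' w : E3) : C u (v + v') w = C u v w + C u v' w := by
  rw [hC.symm₁₂, hC.add₁, hC.symm₁₂ v, hC.symm₁₂ v']

theorem smul₂ (r : ℝ) (u v w : E3) : C u (r • v) w = r * C u v w := by
  rw [hC.symm₁₂, hC.smul₁, hC.symm₁₂ v]

theorem add₃ (u v w w' : E3) : C u v (w + w') = C u v w + C u v w' := by
  rw [hC.symm₂₃, hC.add₂, hC.symm₂₃ u w, hC.symm₂₃ u w']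

theorem smul₃ (r : ℝ) (u v w : E3) : C u v (r • w) = r * C u v w := by
  rw [hC.symm₂₃, hC.smul₂, hC.symm₂₃ u w]

theorem neg₁ (u v w : E3) : C (-u) v w = -C u v w := by
  rw [← neg_one_smul ℝ, hC.smul₁]; ring

theorem neg₂ (u v w : E3) : C u (-v) w = -C u v w := by
  rw [← neg_one_smul ℝ, hC.smul₂]; ring

theorem neg₃ (u v w : E3) : C u v (-w) = -C u v w := by
  rw [← neg_one_smul ℝ, hC.smul₃]; ring

theorem sum_basis₁ (b : OrthonormalBasis (Fin 3) ℝ E3) (u v w : E3) :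
    C u v w = ∑ i, inner ℝ (b i) u * C (b i) v w := by
  conv_lhs => rw [← b.sum_repr' u]
  simp only [Fin.sum_univ_three, hC.add₁, hC.smul₁]

theorem sum_basis₂ (b : OrthonormalBasis (Fin 3) ℝ E3) (u v w : E3) :
    C u v w = ∑ i, inner ℝ (b i) v * C u (b i) w := by
  rw [hC.symm₁₂, hC.sum_basis₁ b]
  exact Finset.sum_congr rfl fun i _ => by rw [hC.symm₁₂]

theorem sum_basis₃ (b : OrthonormalBasis (Fin 3) ℝ E3) (u v w : E3) :
    C u v w = ∑ i, inner ℝ (b i) w * C u v (b i) := by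
  rw [hC.symm₂₃, hC.sum_basis₂ b]
  exact Finset.sum_congr rfl fun i _ => by rw [hC.symm₂₃]

end IsHarmonicForm

/-- The stabilizer in `SO(3)` of a trilinear form. -/
def formStabilizer (C : E3 → E3 → E3 → ℝ) : Subgroup (E3 ≃ₗ[ℝ] E3) where
  carrier := {A | (∀ u v, inner ℝ (A u) (A v) = (inner ℝ u v : ℝ)) ∧ LinearEquiv.det A = 1 ∧
    ∀ u v w, C (A u) (A v) (A w) = C u v w}
  one_mem' := by simp
  mul_mem' := by
    rintro A B ⟨hA1, hA2, hA3⟩ ⟨hB1, hB2, hB3⟩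
    refine ⟨fun u v => ?_, ?_, fun u v w => ?_⟩
    · simp only [LinearEquiv.mul_apply, hA1, hB1]
    · rw [map_mul, hA2, hB2, one_mul]
    · simp only [LinearEquiv.mul_apply, hA3, hB3]
  inv_mem' := by
    rintro A ⟨hA1, hA2, hA3⟩
    have hA : ∀ u, A (A⁻¹ u) = u := fun u => A.apply_symm_apply u
    refine ⟨fun u v => ?_, ?_, fun u v w => ?_⟩
    · rw [← hA1, hA, hA]
    · rw [map_inv, hA2, inv_one]
    · rw [← hA3, hA, hA, hA]

theorem exists_onb_pair {m u : E3} (hm : inner ℝ m m = (1 : ℝ)) (hu : inner ℝ u u = (1 : ℝ))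
    (hmu : inner ℝ m u = (0 : ℝ)) :
    ∃ b : OrthonormalBasis (Fin 3) ℝ E3, b 2 = m ∧ b 0 = u := by
  have hum : inner ℝ u m = (0 : ℝ) := by rw [real_inner_comm]; exact hmu
  have hs : Orthonormal ℝ (({0, 2} : Set (Fin 3)).domRestrict ![u, 0, m]) := by
    rw [orthonormal_iff_ite]
    rintro ⟨i, hi⟩ ⟨j, hj⟩
    change inner ℝ (![u, 0, m] i) (![u, 0, m] j) = _
    simp only [Subtype.mk.injEq]
    simp only [Set.mem_insert_iff, Set.mem_singleton_iff] at hi hj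
    rcases hi with rfl | rfl <;> rcases hj with rfl | rfl
    · simpa using hu
    · simpa using hum
    · simpa using hmu
    · simpa using hm
  obtain ⟨b, hb⟩ := hs.exists_orthonormalBasis_extension_of_card_eq (by simp)
  exact ⟨b, by simpa using hb 2 (by simp), by simpa using hb 0 (by simp)⟩

theorem exists_onb_single {m : E3} (hm : inner ℝ m m = (1 : ℝ)) :
    ∃ b : OrthonormalBasis (Fin 3) ℝ E3, b 2 = m := by
  have hs : Orthonormal ℝ (({2} : Set (Fin 3)).domRestrict ![0, 0, m]) := by
    rw [orthonormal_iff_ite]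
    rintro ⟨i, hi⟩ ⟨j, hj⟩
    change inner ℝ (![0, 0, m] i) (![0, 0, m] j) = _
    simp only [Subtype.mk.injEq]
    simp only [Set.mem_singleton_iff] at hi hj
    subst hi hj
    simpa using hm
  obtain ⟨b, hb⟩ := hs.exists_orthonormalBasis_extension_of_card_eq (by simp)
  exact ⟨b, by simpa using hb 2 (by simp)⟩

theorem exists_unit_smul {m : E3} (hm : m ≠ 0) :
    ∃ r : ℝ, r ≠ 0 ∧ inner ℝ (r • m) (r • m) = (1 : ℝ) := by
  have h : ‖m‖ ≠ 0 := norm_ne_zero_iff.mpr hm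
  refine ⟨‖m‖⁻¹, inv_ne_zero h, ?_⟩
  rw [inner_smul_left, inner_smul_right, real_inner_self_eq_norm_sq, conj_trivial]
  field_simp

/-- A rotation of `ℝ³` fixing two nonzero orthogonal vectors is the identity. -/
theorem eq_one_of_fix_two {A : E3 ≃ₗ[ℝ] E3} (hA : ∀ u v, inner ℝ (A u) (A v) = (inner ℝ u v : ℝ))
    (hdet : LinearEquiv.det A = 1) {m u : E3} (hm : m ≠ 0) (hu : u ≠ 0)
    (hmu : inner ℝ m u = (0 : ℝ)) (hAm : A m = m) (hAu : A u = u) (w : E3) : A w = w := by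
  obtain ⟨r, hr, hr1⟩ := exists_unit_smul hm
  obtain ⟨s, hs, hs1⟩ := exists_unit_smul hu
  obtain ⟨b, hb2, hb0⟩ := exists_onb_pair hr1 hs1
    (by rw [inner_smul_left, inner_smul_right, hmu]; simp)
  have hA2 : A (b 2) = b 2 := by rw [hb2, map_smul, hAm]
  have hA0 : A (b 0) = b 0 := by rw [hb0, map_smul, hAu]
  have ho := orthonormal_iff_ite.mp b.orthonormal
  have h20 : inner ℝ (b 2) (A (b 1)) = (0 : ℝ) := by
    rw [← hA2, hA, ho]; simp
  have h00 : inner ℝ (b 0) (A (b 1)) = (0 : ℝ) := by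
    rw [← hA0, hA, ho]; simp
  set t : ℝ := inner ℝ (b 1) (A (b 1)) with ht
  have hA1 : A (b 1) = t • b 1 := by
    rw [← b.sum_repr' (A (b 1))]
    simp [Fin.sum_univ_three, h20, h00, ht]
  have hmat : LinearMap.toMatrix b.toBasis b.toBasis (A : E3 →ₗ[ℝ] E3) =
      Matrix.diagonal ![1, t, 1] := by
    ext i j
    rw [LinearMap.toMatrix_apply, OrthonormalBasis.coe_toBasis,
      OrthonormalBasis.coe_toBasis_repr_apply, OrthonormalBasis.repr_apply_apply]
    fin_cases j
    · simp only [Fin.zero_eta, LinearEquiv.coe_coe, hA0, ho]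
      fin_cases i <;> simp [Matrix.diagonal]
    · simp only [Fin.mk_one, LinearEquiv.coe_coe, hA1, inner_smul_right, ho]
      fin_cases i <;> simp [Matrix.diagonal]
    · simp only [Fin.reduceFinMk, LinearEquiv.coe_coe, hA2, ho]
      fin_cases i <;> simp [Matrix.diagonal]
  have hd : LinearMap.det (A : E3 →ₗ[ℝ] E3) = 1 := by
    rw [← LinearEquiv.coe_det, hdet]; rfl
  rw [← LinearMap.det_toMatrix b.toBasis, hmat, Matrix.det_diagonal] at hd
  simp [Fin.prod_univ_three] at hd
  -- The third axis can only be scaled, and the determinant makes the factor t equal to 1.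
  rw [hd, one_smul] at hA1
  conv_lhs => rw [← b.sum_repr' w]
  conv_rhs => rw [← b.sum_repr' w]
  simp [Fin.sum_univ_three, hA0, hA1, hA2]

/-- A rotation of `ℝ³` fixes a nonzero vector. -/
theorem exists_fixed_vector {A : E3 ≃ₗ[ℝ] E3}
    (hA : ∀ u v, inner ℝ (A u) (A v) = (inner ℝ u v : ℝ)) (hdet : LinearEquiv.det A = 1) :
    ∃ m : E3, m ≠ 0 ∧ A m = m := by
  set b := EuclideanSpace.basisFun (Fin 3) ℝ
  set M := LinearMap.toMatrix b.toBasis b.toBasis (A : E3 →ₗ[ℝ] E3) with hM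
  have hM1 : M.det = 1 := by
    rw [hM, LinearMap.det_toMatrix, ← LinearEquiv.coe_det, hdet]; rfl
  have hM2 : M.transpose * M = 1 := by
    ext i j
    rw [Matrix.mul_apply, Matrix.one_apply, ← orthonormal_iff_ite.mp b.orthonormal i j, ← hA,
      ← b.sum_inner_mul_inner]
    refine Finset.sum_congr rfl fun k _ => ?_
    simp only [Matrix.transpose_apply, hM, LinearMap.toMatrix_apply, OrthonormalBasis.coe_toBasis,
      OrthonormalBasis.coe_toBasis_repr_apply, OrthonormalBasis.repr_apply_apply,
      LinearEquiv.coe_coe]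
    rw [real_inner_comm (b k)]
  -- Taking determinants gives det (M − 1) = −det (M − 1), because the dimension is odd.
  have h1 : M.transpose * (M - 1) = -(M - 1).transpose := by
    rw [Matrix.mul_sub, hM2]; simp
  have h2 : (M - 1).det = 0 := by
    have := congrArg Matrix.det h1
    rw [Matrix.det_mul, Matrix.det_transpose, hM1, Matrix.det_neg, Matrix.det_transpose] at this
    simp at this
    linarith
  have h3 : LinearMap.det ((A : E3 →ₗ[ℝ] E3) - LinearMap.id) = 0 := by
    rw [← LinearMap.det_toMatrix b.toBasis, map_sub, LinearMap.toMatrix_id]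
    exact h2
  obtain ⟨m, hm, hm0⟩ := (Submodule.ne_bot_iff _).mp (LinearMap.bot_lt_ker_of_det_eq_zero h3).ne'
  refine ⟨m, hm0, ?_⟩
  rw [LinearMap.mem_ker] at hm
  simpa [sub_eq_zero] using hm

/-- An `S₃`-symmetric harmonic cubic has a null vector. -/
theorem IsHarmonicForm.exists_null_of_S3 {C : E3 → E3 → E3 → ℝ} (hC : IsHarmonicForm C)
    (e : formStabilizer C ≃* Equiv.Perm (Fin 3)) :
    ∃ m : E3, m ≠ 0 ∧ ∀ v w, C m v w = 0 := by
  -- Only the nontriviality of s and r and the relations s³ = r² = 1, sr = rs² of a 3-cycle and a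
  -- transposition are used below.
  obtain ⟨⟨s, hs1, hs2, hs3⟩, hse⟩ := e.surjective (finRotate 3)
  obtain ⟨⟨r, hr1, hr2, hr3⟩, hre⟩ := e.surjective (Equiv.swap 0 1)
  have hsss (u : E3) : s (s (s u)) = u := by
    have h : (⟨s, hs1, hs2, hs3⟩ : formStabilizer C) * ⟨s, hs1, hs2, hs3⟩ * ⟨s, hs1, hs2, hs3⟩
        = 1 := e.injective (by rw [map_mul, map_mul, hse, map_one]; decide)
    exact congrArg (fun T => T.1 u) h
  have hrr (u : E3) : r (r u) = u := by
    have h : (⟨r, hr1, hr2, hr3⟩ : formStabilizer C) * ⟨r, hr1, hr2, hr3⟩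
        = 1 := e.injective (by rw [map_mul, hre, map_one]; decide)
    exact congrArg (fun T => T.1 u) h
  have hsr (u : E3) : s (r u) = r (s (s u)) := by
    have h : (⟨s, hs1, hs2, hs3⟩ : formStabilizer C) * ⟨r, hr1, hr2, hr3⟩
        = ⟨r, hr1, hr2, hr3⟩ * ⟨s, hs1, hs2, hs3⟩ * ⟨s, hs1, hs2, hs3⟩ :=
      e.injective (by rw [map_mul, map_mul, map_mul, hse, hre]; decide)
    exact congrArg (fun T => T.1 u) h
  have hs_ne : ¬ ∀ u, s u = u := by
    intro h
    have h2 : (⟨s, hs1, hs2, hs3⟩ : formStabilizer C) = 1 :=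
      Subtype.ext (LinearEquiv.ext h)
    rw [h2, map_one] at hse
    exact absurd hse (by decide)
  have hr_ne : ¬ ∀ u, r u = u := by
    intro h
    have h2 : (⟨r, hr1, hr2, hr3⟩ : formStabilizer C) = 1 :=
      Subtype.ext (LinearEquiv.ext h)
    rw [h2, map_one] at hre
    exact absurd hre (by decide)
  obtain ⟨n, hn, hsn⟩ := exists_fixed_vector hs1 hs2
  have hfix {u : E3} (hu : s u = u) : s (r u) = r u := by rw [hsr, hu, hu]
  -- the axis of the rotation of order 3 is reversed by the involution
  obtain ⟨m, hm1, hsm, hrm⟩ : ∃ m : E3, inner ℝ m m = (1 : ℝ) ∧ s m = m ∧ r m = -m := by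
    suffices h : ∃ m : E3, m ≠ 0 ∧ s m = m ∧ r m = -m by
      obtain ⟨m, hm, hsm, hrm⟩ := h
      obtain ⟨t, ht, ht1⟩ := exists_unit_smul hm
      exact ⟨t • m, ht1, by rw [map_smul, hsm], by rw [map_smul, hrm, smul_neg]⟩
    -- If r fixed the axis n of s, it would be −1 on the plane orthogonal to n and so commute with s
    -- there; then sr = rs² would make s trivial.
    by_cases hrn : r n = n
    · exfalso
      have hperp (u : E3) (hu : inner ℝ n u = (0 : ℝ)) : r u = -u := by
        by_contra hne
        have h0 : u + r u ≠ 0 := fun h => hne (eq_neg_of_add_eq_zero_right h)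
        refine hr_ne (eq_one_of_fix_two hr1 hr2 hn h0 ?_ hrn ?_)
        · rw [inner_add_right, hu, zero_add, ← hrn, hr1, hu]
        · rw [map_add, hrr, add_comm]
      have hsperp (u : E3) (hu : inner ℝ n u = (0 : ℝ)) : s u = u := by
        have hu2 : inner ℝ n (s u) = (0 : ℝ) := by rw [← hsn, hs1, hu]
        have hu3 : inner ℝ n (s (s u)) = (0 : ℝ) := by rw [← hsn, hs1, hu2]
        have h1 := hsr u
        rw [hperp u hu, hperp _ hu3, map_neg, neg_inj] at h1
        exact (s.injective h1).symm
      obtain ⟨t, ht, ht1⟩ := exists_unit_smul hn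
      obtain ⟨b, hb⟩ := exists_onb_single ht1
      have ho := orthonormal_iff_ite.mp b.orthonormal
      have h0 : inner ℝ n (b 0) = (0 : ℝ) := by
        have := ho 2 0
        rw [hb, inner_smul_left] at this
        simpa [ht] using this
      exact hs_ne (eq_one_of_fix_two hs1 hs2 hn (b.orthonormal.ne_zero 0) h0 hsn (hsperp _ h0))
    -- The relation sr = rs² shows that r preserves the vectors fixed by s, so the part of n that is
    -- odd under r is still fixed by s.
    · refine ⟨n - r n, fun h => hrn (sub_eq_zero.mp h).symm, ?_, ?_⟩
      · rw [map_sub, hsn, hfix hsn]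
      · rw [map_sub, hrr]; abel
  have hm : m ≠ 0 := by rintro rfl; simp at hm1
  have hmmm : C m m m = 0 := by
    have := hr3 m m m
    rw [hrm, hC.neg₁, hC.neg₂, hC.neg₃] at this
    linarith
  obtain ⟨b, hb⟩ := exists_onb_single hm1
  have ho := orthonormal_iff_ite.mp b.orthonormal
  -- The sum u + su + s²u is fixed by s and orthogonal to its axis, so it vanishes; otherwise s
  -- would fix two orthogonal directions.
  have horb (u : E3) (hu : inner ℝ m u = (0 : ℝ)) : s (s u) = -u + -s u := by
    by_contra hne
    have h0 : u + s u + s (s u) ≠ 0 := by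
      intro h
      apply hne
      rw [← neg_add]
      exact eq_neg_of_add_eq_zero_right h
    refine hs_ne (eq_one_of_fix_two hs1 hs2 hm h0 ?_ hsm ?_)
    · have hu2 : inner ℝ m (s u) = (0 : ℝ) := by rw [← hsm, hs1, hu]
      have hu3 : inner ℝ m (s (s u)) = (0 : ℝ) := by rw [← hsm, hs1, hu2]
      rw [inner_add_right, inner_add_right, hu, hu2, hu3]; simp
    · rw [map_add, map_add, hsss]; abel
  -- The linear form C(m,m,·) is constant on an s-orbit in the plane, and such an orbit has sum
  -- zero.
  have hmmu (u : E3) (hu : inner ℝ m u = (0 : ℝ)) : C m m u = 0 := by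
    have h1 := hs3 m m u
    have h2 := hs3 m m (s u)
    rw [hsm] at h1 h2
    rw [horb u hu, hC.add₃, hC.neg₃, hC.neg₃] at h2
    linarith
  set u := b 0 with hu
  set w := b 1 with hw
  have hb0 : inner ℝ m u = (0 : ℝ) := by rw [← hb, ho]; simp
  have hb1 : inner ℝ m w = (0 : ℝ) := by rw [← hb, ho]; simp
  have huu : inner ℝ u u = (1 : ℝ) := by rw [ho]; simp
  set α : ℝ := inner ℝ u (s u) with hα
  set β : ℝ := inner ℝ w (s u) with hβ
  have hsu : s u = α • u + β • w := by
    rw [← b.sum_repr' (s u)]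
    have : inner ℝ (b 2) (s u) = (0 : ℝ) := by rw [hb, ← hsm, hs1, hb0]
    rw [Fin.sum_univ_three, this, zero_smul, add_zero]
  have hαv : α = -1 / 2 := by
    have h1 := hs1 (s u) (s u)
    rw [horb u hb0, inner_add_left, inner_add_right, inner_add_right, hs1, huu] at h1
    simp only [inner_neg_left, inner_neg_right, neg_neg, hs1, huu, real_inner_comm u (s u)] at h1
    linarith
  have hβv : β ^ 2 = 3 / 4 := by
    have h1 := hs1 u u
    have hww : inner ℝ w w = (1 : ℝ) := by rw [ho]; simp
    have huw : inner ℝ u w = (0 : ℝ) := by rw [ho]; simp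
    have hwu : inner ℝ w u = (0 : ℝ) := by rw [ho]; simp
    rw [hsu, huu, inner_add_left, inner_add_right, inner_add_right] at h1
    simp only [inner_smul_left, inner_smul_right, huu, hww, huw, hwu, conj_trivial, hαv] at h1
    linarith
  have hβ0 : β ≠ 0 := by rintro h; rw [h] at hβv; norm_num at hβv
  -- The quadratic form C(m,·,·) on the plane is invariant under a rotation by 2π/3, hence a
  -- multiple of the inner product. As C(m,m,m) = 0, the trace condition makes that multiple zero.
  have q1 := hs3 m u u
  have q2 := hs3 m (s u) (s u)
  rw [horb u hb0, hsm] at q2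
  rw [hsm] at q1
  simp only [hsu, hC.add₂, hC.add₃, hC.neg₂, hC.neg₃, hC.smul₂, hC.smul₃, hC.symm₂₃ m w u] at q1 q2
  have huw0 : C m u w = 0 := by
    have : β * C m u w = 0 := by rw [hαv] at q1 q2; linarith
    exact (mul_eq_zero.mp this).resolve_left hβ0
  have hww : C m w w = C m u u := by
    rw [huw0, hαv] at q1
    have : β * (β * C m w w) = 3 / 4 * C m w w := by rw [← hβv]; ring
    linarith
  have htr' : C m u u + C m w w = 0 := by
    rw [hC.symm₁₂ m u, hC.symm₁₂ m w]
    rw [hC.symm₂₃ u m u, hC.symm₂₃ w m w]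
    have := hC.trace b m
    rw [Fin.sum_univ_three, hb, hmmm] at this
    linarith
  have huu0 : C m u u = 0 := by linarith
  have hww0 : C m w w = 0 := by linarith
  refine ⟨m, hm, fun x y => ?_⟩
  have hmu : C m m u = 0 := hmmu u hb0
  have hmw : C m m w = 0 := hmmu w hb1
  rw [hC.sum_basis₂ b]
  simp only [hC.sum_basis₃ b m _ y, Fin.sum_univ_three, hb, ← hu, ← hw, huu0, hww0, huw0, hmmm, hmu,
    hmw, hC.symm₂₃ m w u, hC.symm₂₃ m u m, hC.symm₂₃ m w m]
  simp

end Euclidean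

/-! ### Null vectors give the stabilizer S₃ -/

section Triangle

/-- Three unit vectors of a plane, pairwise at an angle `2π/3`. -/
structure IsTriangle (t : Fin 3 → E3) : Prop where
  inner_eq : ∀ i j, inner ℝ (t i) (t j) = if i = j then (1 : ℝ) else -1 / 2
  sum_eq_zero : t 0 + t 1 + t 2 = 0

namespace IsTriangle

variable {t : Fin 3 → E3} (ht : IsTriangle t)

include ht

theorem injective : Function.Injective t := by
  intro i j hij
  by_contra hne
  have h1 := ht.inner_eq i j
  have h2 := ht.inner_eq j j
  rw [hij, h2] at h1
  simp [hne] at h1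
  norm_num at h1

theorem ne_zero (i : Fin 3) : t i ≠ 0 := by
  intro h
  have := ht.inner_eq i i
  simp [h] at this

/-- The half-turn about the axis of `t k`. -/
theorem exists_halfTurn (i j k : Fin 3) (hij : i ≠ j) (hik : i ≠ k) (hjk : j ≠ k) :
    ∃ A : E3 ≃ₗ[ℝ] E3, (∀ u v, inner ℝ (A u) (A v) = (inner ℝ u v : ℝ)) ∧
      LinearEquiv.det A = 1 ∧ ∀ l, A (t l) = t (Equiv.swap i j l) := by
  let ρ := (ℝ ∙ t k).reflection
  have hk1 : ‖t k‖ = 1 := by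
    have := ht.inner_eq k k
    rw [real_inner_self_eq_norm_sq, if_pos rfl] at this
    exact (pow_eq_one_iff_of_nonneg (norm_nonneg _) two_ne_zero).mp this
  have hρ (u : E3) : ρ u = (2 * inner ℝ (t k) u) • t k - u := by
    rw [Submodule.reflection_singleton_apply, hk1]
    simp [two_smul, ← add_smul, ← two_mul]
  have hsum : t i + t j + t k = 0 := by
    have := ht.sum_eq_zero
    fin_cases i <;> fin_cases j <;> fin_cases k <;> simp at hij hik hjk ⊢ <;> rw [← this] <;> abel
  refine ⟨ρ.toLinearEquiv, fun u v => ρ.inner_map_map u v, ?_, fun l => ?_⟩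
  -- Reflection in a line of ℝ³ is −1 on a plane, so its determinant is (−1)² = 1.
  · rw [Submodule.linearEquiv_det_reflection]
    have h1 := Submodule.finrank_add_finrank_orthogonal (ℝ ∙ t k)
    rw [finrank_span_singleton (ht.ne_zero k)] at h1
    simp at h1
    have h2 : Module.finrank ℝ (ℝ ∙ t k)ᗮ = 2 := by omega
    rw [h2]
    simp
  · change ρ (t l) = _
    rw [hρ, ht.inner_eq]
    have hl : l = i ∨ l = j ∨ l = k := by
      fin_cases i <;> fin_cases j <;> fin_cases k <;> fin_cases l <;> simp at hij hik hjk ⊢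
    rcases hl with rfl | rfl | rfl
    · rw [if_neg hik.symm, Equiv.swap_apply_left, eq_comm, ← sub_eq_zero]
      rw [← hsum]
      module
    · rw [if_neg hjk.symm, Equiv.swap_apply_right, eq_comm, ← sub_eq_zero]
      rw [← hsum]
      module
    · rw [if_pos rfl, Equiv.swap_apply_of_ne_of_ne hik.symm hjk.symm]
      module

theorem eq_one_of_fix {A : E3 ≃ₗ[ℝ] E3} (hA : ∀ u v, inner ℝ (A u) (A v) = (inner ℝ u v : ℝ))
    (hdet : LinearEquiv.det A = 1) (hfix : ∀ i, A (t i) = t i) (w : E3) : A w = w := by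
  refine eq_one_of_fix_two hA hdet (ht.ne_zero 0) (u := t 1 - t 2) ?_ ?_ (hfix 0)
    (by rw [map_sub, hfix, hfix]) w
  · exact sub_ne_zero.mpr (ht.injective.ne (by decide))
  · rw [inner_sub_right, ht.inner_eq, ht.inner_eq]
    simp

/-- The stabilizer of the cubic `∑ i, ⟨t i, ·⟩³` is the symmetric group. -/
theorem nonempty_mulEquiv {C : E3 → E3 → E3 → ℝ} {a : ℝ}
    (hC : ∀ u v w, C u v w = a * ∑ i, inner ℝ (t i) u * inner ℝ (t i) v * inner ℝ (t i) w)
    (hchar : ∀ u : E3, inner ℝ u u = (1 : ℝ) → C u u u = C (t 0) (t 0) (t 0) → ∃ i, u = t i) :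
    Nonempty (formStabilizer C ≃* Equiv.Perm (Fin 3)) := by
  have hCt (i : Fin 3) : C (t i) (t i) (t i) = C (t 0) (t 0) (t 0) := by
    simp only [hC, Fin.sum_univ_three, ht.inner_eq]
    fin_cases i <;> simp only [Fin.zero_eta, Fin.mk_one, Fin.reduceFinMk, Fin.isValue,
      Fin.reduceEq, if_true, if_false] <;> ring
  -- By `hchar` the tᵢ are the only unit vectors with this value of the cubic, so an element of the
  -- stabilizer permutes them.
  have hmem (A : formStabilizer C) (i : Fin 3) : ∃ j, A.1 (t i) = t j := by
    refine hchar _ ?_ ?_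
    · rw [A.2.1, ht.inner_eq]; simp
    · rw [A.2.2.2, hCt]
  choose σ hσ using hmem
  have hσmul (A B : formStabilizer C) (i : Fin 3) : σ (A * B) i = σ A (σ B i) := by
    apply ht.injective
    rw [← hσ, ← hσ, ← hσ]
    rfl
  have hσone (i : Fin 3) : σ 1 i = i := by
    apply ht.injective
    rw [← hσ]
    rfl
  let Θ : formStabilizer C →* Equiv.Perm (Fin 3) :=
    { toFun := fun A => ⟨σ A, σ A⁻¹, fun i => by rw [← hσmul, inv_mul_cancel, hσone],
        fun i => by rw [← hσmul, mul_inv_cancel, hσone]⟩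
      map_one' := Equiv.ext hσone
      map_mul' := fun A B => Equiv.ext (hσmul A B) }
  have hΘ (A : formStabilizer C) (i : Fin 3) : A.1 (t i) = t (Θ A i) := hσ A i
  refine ⟨MulEquiv.ofBijective Θ ⟨?_, ?_⟩⟩
  · rw [injective_iff_map_eq_one]
    intro A hA
    refine Subtype.ext (LinearEquiv.ext fun w => ht.eq_one_of_fix A.2.1 A.2.2.1 (fun i => ?_) w)
    rw [hΘ, hA]
    rfl
  -- Transpositions generate the symmetric group, and each is realized by a half-turn about the
  -- remaining vector of the triangle.
  · rw [← MonoidHom.range_eq_top, eq_top_iff, ← Equiv.Perm.closure_isSwap, Subgroup.closure_le]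
    rintro τ ⟨i, j, hij, rfl⟩
    obtain ⟨k, hik, hjk⟩ : ∃ k : Fin 3, i ≠ k ∧ j ≠ k := by
      revert i j; decide
    obtain ⟨A, hA1, hA2, hA3⟩ := ht.exists_halfTurn i j k hij hik hjk
    have hAs (l : Fin 3) (u : E3) : inner ℝ (t l) (A u) = inner ℝ (t (Equiv.swap i j l)) u := by
      rw [← hA1 (t _) u, hA3, Equiv.swap_apply_self]
    have hmem : A ∈ formStabilizer C := by
      refine ⟨hA1, hA2, fun u v w => ?_⟩
      simp only [hC, hAs]
      congr 1
      exact Equiv.sum_comp (Equiv.swap i j)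
        (fun l => inner ℝ (t l) u * inner ℝ (t l) v * inner ℝ (t l) w)
    refine ⟨⟨A, hmem⟩, Equiv.ext fun l => ht.injective ?_⟩
    rw [← hΘ, ← hA3]

end IsTriangle

end Triangle

theorem exists_onb_of_inner {w : Fin 3 → E3}
    (hw : ∀ i j, inner ℝ (w i) (w j) = if i = j then (1 : ℝ) else 0) :
    ∃ b : OrthonormalBasis (Fin 3) ℝ E3, ⇑b = w := by
  have h : Orthonormal ℝ w := orthonormal_iff_ite.mpr hw
  exact ⟨OrthonormalBasis.mk h (h.linearIndependent.span_eq_top_of_card_eq_finrank' (by simp)).ge,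
    OrthonormalBasis.coe_mk _ _⟩

/-- A cubic form with a null vector is `a * Re ((x + i y)³)` in a suitable frame. -/
theorem IsHarmonicForm.exists_normal_form {C : E3 → E3 → E3 → ℝ} (hC : IsHarmonicForm C)
    (hne : C ≠ 0) {m : E3} (hm : m ≠ 0) (hnull : ∀ v w, C m v w = 0) :
    ∃ (e : OrthonormalBasis (Fin 3) ℝ E3) (a : ℝ), a ≠ 0 ∧ ∀ u v w, C u v w =
      a * (inner ℝ (e 0) u * inner ℝ (e 0) v * inner ℝ (e 0) w
        - inner ℝ (e 0) u * inner ℝ (e 1) v * inner ℝ (e 1) w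
        - inner ℝ (e 1) u * inner ℝ (e 0) v * inner ℝ (e 1) w
        - inner ℝ (e 1) u * inner ℝ (e 1) v * inner ℝ (e 0) w) := by
  obtain ⟨r, hr, hr1⟩ := exists_unit_smul hm
  obtain ⟨b, hb⟩ := exists_onb_single hr1
  have n1 (v w : E3) : C (b 2) v w = 0 := by rw [hb, hC.smul₁, hnull, mul_zero]
  have n2 (v w : E3) : C v (b 2) w = 0 := by rw [hC.symm₁₂, n1]
  have n3 (v w : E3) : C v w (b 2) = 0 := by rw [hC.symm₂₃, n2]
  set p := C (b 0) (b 0) (b 0) with hp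
  set q := C (b 0) (b 0) (b 1) with hq
  have htr0 := hC.trace b (b 0)
  have htr1 := hC.trace b (b 1)
  rw [Fin.sum_univ_three, n1, add_zero] at htr0 htr1
  have e011 : C (b 0) (b 1) (b 1) = -p := by rw [hC.symm₁₂, hC.symm₂₃]; linarith
  have e111 : C (b 1) (b 1) (b 1) = -q := by linarith
  have e010 : C (b 0) (b 1) (b 0) = q := by rw [hC.symm₂₃]
  have e100 : C (b 1) (b 0) (b 0) = q := by rw [hC.symm₁₂, e010]
  have e101 : C (b 1) (b 0) (b 1) = -p := by rw [hC.symm₁₂, e011]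
  have e110 : C (b 1) (b 1) (b 0) = -p := by rw [hC.symm₂₃, e101]
  have hform (u v w : E3) : C u v w =
      p * (inner ℝ (b 0) u * inner ℝ (b 0) v * inner ℝ (b 0) w
        - inner ℝ (b 0) u * inner ℝ (b 1) v * inner ℝ (b 1) w
        - inner ℝ (b 1) u * inner ℝ (b 0) v * inner ℝ (b 1) w
        - inner ℝ (b 1) u * inner ℝ (b 1) v * inner ℝ (b 0) w)
      + q * (inner ℝ (b 0) u * inner ℝ (b 0) v * inner ℝ (b 1) w
        + inner ℝ (b 0) u * inner ℝ (b 1) v * inner ℝ (b 0) w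
        + inner ℝ (b 1) u * inner ℝ (b 0) v * inner ℝ (b 0) w
        - inner ℝ (b 1) u * inner ℝ (b 1) v * inner ℝ (b 1) w) := by
    rw [hC.sum_basis₁ b]
    simp only [hC.sum_basis₂ b _ v, hC.sum_basis₃ b _ _ w, Fin.sum_univ_three, n1, n2, n3, e011,
      e111, e010, e100, e101, e110, ← hp, ← hq]
    ring
  -- The cubic is the real part of (p − iq)(x + iy)³; its amplitude a is the modulus of the
  -- coefficient.
  set a := Real.sqrt (p ^ 2 + q ^ 2) with ha
  have ha2 : a ^ 2 = p ^ 2 + q ^ 2 := Real.sq_sqrt (by positivity)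
  have ha0 : a ≠ 0 := by
    intro h0
    rw [h0] at ha2
    have hp0 : p = 0 := by nlinarith [sq_nonneg p, sq_nonneg q]
    have hq0 : q = 0 := by nlinarith [sq_nonneg p, sq_nonneg q]
    apply hne
    funext u v w
    rw [hform, hp0, hq0]
    simp
  -- a cube root rotates the frame so that `q` vanishes
  obtain ⟨α, β, hαβ, hre, him⟩ : ∃ α β : ℝ, α ^ 2 + β ^ 2 = 1 ∧
      p = a * (α ^ 3 - 3 * α * β ^ 2) ∧ q = a * (3 * α ^ 2 * β - β ^ 3) := by
    obtain ⟨z, hz⟩ := IsAlgClosed.exists_pow_nat_eq (⟨p / a, q / a⟩ : ℂ) (n := 3) (by norm_num)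
    have h1 := congrArg Complex.re hz
    have h2 := congrArg Complex.im hz
    simp only [pow_succ, pow_zero, one_mul, Complex.mul_re, Complex.mul_im] at h1 h2
    have h3 : (z.re ^ 2 + z.im ^ 2) ^ 3 = 1 := by
      have : (z.re ^ 2 + z.im ^ 2) ^ 3 = (p / a) ^ 2 + (q / a) ^ 2 := by
        rw [← h1, ← h2]; ring
      rw [this, div_pow, div_pow, ← add_div, ha2, div_self (by rw [← ha2]; positivity)]
    refine ⟨z.re, z.im, ?_, ?_, ?_⟩
    · exact (pow_eq_one_iff_of_nonneg (by positivity) (by norm_num)).mp h3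
    · have : a * (p / a) = p := by field_simp
      rw [← this, ← h1]; ring
    · have : a * (q / a) = q := by field_simp
      rw [← this, ← h2]; ring
  have ho := orthonormal_iff_ite.mp b.orthonormal
  have ho2 : ∀ i j, inner ℝ (![α • b 0 + β • b 1, (-β) • b 0 + α • b 1, b 2] i)
      (![α • b 0 + β • b 1, (-β) • b 0 + α • b 1, b 2] j) = if i = j then (1 : ℝ) else 0 := by
    intro i j
    fin_cases i <;> fin_cases j <;>
      simp only [Fin.zero_eta, Fin.mk_one, Fin.reduceFinMk, Matrix.cons_val_zero,
        Matrix.cons_val_one, Matrix.cons_val, inner_add_left, inner_add_right, inner_smul_left,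
        inner_smul_right, ho, conj_trivial, Fin.isValue, Fin.reduceEq, if_true, if_false, mul_one,
        mul_zero, add_zero, zero_add] <;> linarith
  obtain ⟨e, he⟩ := exists_onb_of_inner ho2
  refine ⟨e, a, ha0, fun u v w => ?_⟩
  have hpx (u : E3) : inner ℝ (e 0) u = α * inner ℝ (b 0) u + β * inner ℝ (b 1) u := by
    simp only [he, Matrix.cons_val_zero, inner_add_left, inner_smul_left, conj_trivial]
  have hpz (u : E3) : inner ℝ (e 1) u = -β * inner ℝ (b 0) u + α * inner ℝ (b 1) u := by
    simp only [he, Matrix.cons_val_one, Matrix.cons_val_zero, inner_add_left, inner_smul_left,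
      conj_trivial]
  have hb0 (u : E3) : inner ℝ (b 0) u = α * inner ℝ (e 0) u - β * inner ℝ (e 1) u := by
    rw [hpx, hpz]; linear_combination (-(inner ℝ (b 0) u : ℝ)) * hαβ
  have hb1 (u : E3) : inner ℝ (b 1) u = β * inner ℝ (e 0) u + α * inner ℝ (e 1) u := by
    rw [hpx, hpz]; linear_combination (-(inner ℝ (b 1) u : ℝ)) * hαβ
  rw [hform, hre, him]
  simp only [hb0, hb1]
  generalize inner ℝ (e 0) u = x1
  generalize inner ℝ (e 0) v = x2
  generalize inner ℝ (e 0) w = x3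
  generalize inner ℝ (e 1) u = z1
  generalize inner ℝ (e 1) v = z2
  generalize inner ℝ (e 1) w = z3
  have h6 : (α ^ 2 + β ^ 2) ^ 3 = 1 := by rw [hαβ, one_pow]
  linear_combination (a * (x1 * x2 * x3 - x1 * z2 * z3 - z1 * x2 * z3 - z1 * z2 * x3)) * h6

/-- A nonzero harmonic cubic with a null vector has stabilizer `S₃`. -/
theorem IsHarmonicForm.nonempty_mulEquiv_of_null {C : E3 → E3 → E3 → ℝ} (hC : IsHarmonicForm C)
    (hne : C ≠ 0) {m : E3} (hm : m ≠ 0) (hnull : ∀ v w, C m v w = 0) :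
    Nonempty (formStabilizer C ≃* Equiv.Perm (Fin 3)) := by
  obtain ⟨e, a, ha0, hform2⟩ := hC.exists_normal_form hne hm hnull
  have ho := orthonormal_iff_ite.mp e.orthonormal
  set x := e 0 with hx
  set z := e 1 with hz
  have hxx : inner ℝ x x = (1 : ℝ) := by rw [ho, if_pos rfl]
  have hzz : inner ℝ z z = (1 : ℝ) := by rw [ho, if_pos rfl]
  have hxz : inner ℝ x z = (0 : ℝ) := by rw [ho, if_neg (by decide)]
  have hzx : inner ℝ z x = (0 : ℝ) := by rw [ho, if_neg (by decide)]
  set s := Real.sqrt 3 with hs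
  have hs2 : s ^ 2 = 3 := Real.sq_sqrt (by norm_num)
  let t : Fin 3 → E3 := ![x, (-1 / 2 : ℝ) • x + (s / 2) • z, (-1 / 2 : ℝ) • x + (-(s / 2)) • z]
  have ht : IsTriangle t := by
    refine ⟨fun i j => ?_, ?_⟩
    · fin_cases i <;> fin_cases j <;>
        simp only [t, Fin.zero_eta, Fin.mk_one, Fin.reduceFinMk, Matrix.cons_val_zero,
          Matrix.cons_val_one, Matrix.cons_val, inner_add_left, inner_add_right, inner_smul_left,
          inner_smul_right, hxx, hzz, hxz, hzx, conj_trivial, Fin.isValue, Fin.reduceEq, if_true,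
          if_false, mul_one, mul_zero, add_zero, zero_add] <;> linarith
    · simp only [t, Matrix.cons_val_zero, Matrix.cons_val_one, Matrix.cons_val]
      module
  -- The cubes of the three projections satisfy ∑ ⟨tᵢ,u⟩³ = (3/4)(X³ − 3XZ²), which explains the
  -- factor 4/3.
  refine ht.nonempty_mulEquiv (a := 4 / 3 * a) (fun u v w => ?_) (fun u hu1 hu2 => ?_)
  · rw [hform2]
    simp only [Fin.sum_univ_three, t, Matrix.cons_val_zero, Matrix.cons_val_one, Matrix.cons_val,
      inner_add_left, inner_smul_left, conj_trivial]
    generalize inner ℝ x u = x1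
    generalize inner ℝ x v = x2
    generalize inner ℝ x w = x3
    generalize inner ℝ z u = z1
    generalize inner ℝ z v = z2
    generalize inner ℝ z w = z3
    linear_combination (a / 3 * (x1 * z2 * z3 + z1 * x2 * z3 + z1 * z2 * x3)) * hs2
  · have hsq : inner ℝ x u ^ 2 + inner ℝ z u ^ 2 + inner ℝ (e 2) u ^ 2 = (1 : ℝ) := by
      have := e.sum_inner_mul_inner u u
      rw [hu1, Fin.sum_univ_three] at this
      simp only [real_inner_comm _ u] at this
      rw [← this]
      ring
    have hu : u = inner ℝ x u • x + inner ℝ z u • z + inner ℝ (e 2) u • e 2 := by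
      conv_lhs => rw [← e.sum_repr' u]
      rw [Fin.sum_univ_three]
    have h0 : t 0 = x := rfl
    rw [h0, hform2, hform2, hxx, hzx] at hu2
    set X : ℝ := inner ℝ x u
    set Z : ℝ := inner ℝ z u
    set Y : ℝ := inner ℝ (e 2) u
    have hcub : X ^ 3 - 3 * X * Z ^ 2 = 1 := by
      have : a * (X ^ 3 - 3 * X * Z ^ 2) = a * 1 := by linarith
      exact mul_left_cancel₀ ha0 this
    rcases le_or_gt X 0 with hX | hX
    -- For X ≤ 0 the left side is nonpositive and the right side nonnegative, so both vanish; this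
    -- leaves X = −1/2 and Y = 0. For X > 0 the cubic equation itself forces X ≥ 1.
    · have h1 : (X - 1) * (2 * X + 1) ^ 2 = -3 * X * Y ^ 2 := by
        have : Z ^ 2 = 1 - X ^ 2 - Y ^ 2 := by linarith
        rw [this] at hcub
        linear_combination hcub
      have h2 : 0 ≤ -3 * X * Y ^ 2 := by nlinarith [sq_nonneg Y]
      have h3 : (2 * X + 1) ^ 2 = 0 := by nlinarith [sq_nonneg (2 * X + 1)]
      have hX2 : X = -1 / 2 := by
        have := pow_eq_zero_iff (two_ne_zero) |>.mp h3
        linarith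
      have hY : Y = 0 := by
        rw [hX2] at h1
        have : Y ^ 2 = 0 := by linarith
        exact pow_eq_zero_iff (two_ne_zero) |>.mp this
      have hZ : (Z - s / 2) * (Z + s / 2) = 0 := by
        rw [hX2, hY] at hsq
        linear_combination hsq - hs2 / 4
      rcases mul_eq_zero.mp hZ with h | h
      · refine ⟨1, ?_⟩
        rw [hu, hX2, hY, show Z = s / 2 by linarith, zero_smul, add_zero]
        rfl
      · refine ⟨2, ?_⟩
        rw [hu, hX2, hY, show Z = -(s / 2) by linarith, zero_smul, add_zero]
        rfl
    · have h1 : 1 ≤ X ^ 3 := by nlinarith [mul_nonneg hX.le (sq_nonneg Z)]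
      have h2 : X ≤ 1 := by nlinarith [sq_nonneg Z, sq_nonneg Y]
      have h3 : 1 ≤ X := by
        by_contra hlt
        have hlt := not_le.mp hlt
        have : X ^ 3 < 1 := pow_lt_one₀ hX.le hlt (by norm_num)
        linarith
      have hX1 : X = 1 := le_antisymm h2 h3
      have hZ : Z = 0 := by
        rw [hX1] at hsq
        nlinarith [sq_nonneg Z, sq_nonneg Y]
      have hY : Y = 0 := by
        rw [hX1] at hsq
        nlinarith [sq_nonneg Z, sq_nonneg Y]
      refine ⟨0, ?_⟩
      rw [hu, hX1, hZ, hY, h0]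
      simp

/-! ### Transport of the stabilizer from the tangent space to ℝ³ -/

section Transport

variable {L : Type*} [TopologicalSpace L] [ChartedSpace E3 L] [IsManifold 𝓘(ℝ, E3) ∞ L]
  {x : L → ImO}

/-- The stabilizer of the fundamental cubic at `p`, in terms of a harmonic form on `ℝ³`. -/
theorem IsLagrangianImmersion.exists_form (hx : IsLagrangianImmersion x) (p : L)
    {v : Fin 3 → E3} (hv : IsOrthonormalBasis x p v) :
    ∃ C : E3 → E3 → E3 → ℝ, IsHarmonicForm C ∧
      Nonempty (formStabilizer C ≃* cubicStabilizer x p) ∧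
      (HasNullVector (fun i j k => fundamentalCubic x p (v i) (v j) (v k)) ↔
        ∃ m : E3, m ≠ 0 ∧ ∀ v w, C m v w = 0) ∧
      (fundamentalCubic x p ≠ 0 ↔ C ≠ 0) := by
  have hL := hx.lagOn_localRep p
  have hy := mem_extChartAt_target (I := 𝓘(ℝ, E3)) p
  set f := localRep x p
  set y := extChartAt 𝓘(ℝ, E3) p p
  have hv' : ∀ i j, met f y (v i) (v j) = if i = j then 1 else 0 := by
    intro i j
    rw [← hv i j, hx.metric_eq]
  -- Φ is the isometry from Euclidean ℝ³ to the tangent space that sends the standard basis to v;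
  -- conjugation by Φ identifies the two stabilizers.
  let Φ : E3 ≃ₗ[ℝ] E3 := (EuclideanSpace.basisFun (Fin 3) ℝ).toBasis.equiv (basisOfMet hv')
    (Equiv.refl _)
  have hΦ (a : E3) : Φ a = ∑ i, a i • v i := by
    have h1 := (EuclideanSpace.basisFun (Fin 3) ℝ).toBasis.sum_repr a
    conv_lhs => rw [← h1]
    rw [map_sum]
    refine Finset.sum_congr rfl fun i _ => ?_
    rw [map_smul, Module.Basis.equiv_apply, coe_basisOfMet]
    simp
  have hg (a b : E3) : metric x p (Φ a) (Φ b) = inner ℝ a b := by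
    rw [hx.metric_eq, hΦ, hΦ, met_sum hv']
    simp [PiLp.inner_apply, mul_comm]
  set C : E3 → E3 → E3 → ℝ := fun a b d => fundamentalCubic x p (Φ a) (Φ b) (Φ d) with hCdef
  have hcub (u w z : E3) : fundamentalCubic x p u w z = cub f y u w z := hx.fundamentalCubic_eq p u w z
  have hC : IsHarmonicForm C := by
    refine ⟨fun u u' v w => ?_, fun r u v w => ?_, fun u v w => ?_, fun u v w => ?_, fun b w => ?_⟩
    · simp only [hCdef, hcub, cub, map_add, _root_.add_apply, inner_add_left]
    · simp only [hCdef, hcub, cub, map_smul, _root_.smul_apply, inner_smul_left, conj_trivial]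
    · simp only [hCdef, hcub]; exact hL.cub_symm₁₂ hy _ _ _
    · simp only [hCdef, hcub]; exact hL.cub_symm₂₃ hy _ _ _
    · simp only [hCdef, hcub]
      refine hL.cub_trace hy (v := fun i => Φ (b i)) (fun i j => ?_) _
      rw [← hx.metric_eq, hg]
      exact orthonormal_iff_ite.mp b.orthonormal i j
  have hΦs (u : E3) : Φ (Φ.symm u) = u := Φ.apply_symm_apply u
  let e : formStabilizer C ≃* cubicStabilizer x p :=
    { toFun := fun A => ⟨(Φ.symm.trans A.1).trans Φ, by
        refine ⟨fun u w => ?_, ?_, fun u w z => ?_⟩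
        · simp only [LinearEquiv.trans_apply]
          rw [hg, A.2.1, ← hg, hΦs, hΦs]
        · rw [LinearEquiv.det_conj, A.2.2.1]
        · have := A.2.2.2 (Φ.symm u) (Φ.symm w) (Φ.symm z)
          simpa only [hCdef, LinearEquiv.trans_apply, hΦs] using this⟩
      invFun := fun B => ⟨(Φ.trans B.1).trans Φ.symm, by
        refine ⟨fun u w => ?_, ?_, fun u w z => ?_⟩
        · simp only [LinearEquiv.trans_apply]
          rw [← hg, hΦs, hΦs, B.2.1, hg]
        · have := LinearEquiv.det_conj B.1 Φ.symm
          rw [LinearEquiv.symm_symm] at this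
          rw [this, B.2.2.1]
        · have := B.2.2.2 (Φ u) (Φ w) (Φ z)
          simpa only [hCdef, LinearEquiv.trans_apply, hΦs] using this⟩
      left_inv := fun A => by ext u; simp
      right_inv := fun B => by ext u; simp
      map_mul' := fun A B => by
        apply Subtype.ext
        ext u
        simp [LinearEquiv.mul_apply] }
  have hnull : HasNullVector (fun i j k => fundamentalCubic x p (v i) (v j) (v k)) ↔
      ∃ m : E3, m ≠ 0 ∧ ∀ v w, C m v w = 0 := by
    have hst (i : Fin 3) : Φ (stdVec i) = v i := by
      rw [hΦ]; simp
    have key (m : E3) (j k : Fin 3) : C m (stdVec j) (stdVec k) =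
        ∑ i, m i * fundamentalCubic x p (v i) (v j) (v k) := by
      rw [eq_sum_stdVec m]
      simp only [Fin.sum_univ_three, hC.add₁, hC.smul₁]
      simp [hCdef, hst]
    constructor
    · rintro ⟨n, hn, h⟩
      refine ⟨WithLp.toLp 2 n, fun h0 => hn ?_, fun u w => ?_⟩
      · exact (WithLp.toLp_injective 2) h0
      · rw [eq_sum_stdVec u, eq_sum_stdVec w]
        simp only [Fin.sum_univ_three, hC.add₂, hC.add₃, hC.smul₂, hC.smul₃, key, h]
        simp
    · rintro ⟨m, hm, h⟩
      refine ⟨m, fun h0 => hm ?_, fun j k => ?_⟩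
      · ext i; exact congrFun h0 i
      · rw [← key, h]
  have hzero : fundamentalCubic x p ≠ 0 ↔ C ≠ 0 := by
    refine not_congr ⟨fun h => ?_, fun h => ?_⟩
    · funext u w z; simp only [hCdef, h]; rfl
    · funext u w z
      have := congrFun (congrFun (congrFun h (Φ.symm u)) (Φ.symm w)) (Φ.symm z)
      simp only [hCdef, hΦs] at this
      exact this
  exact ⟨C, hC, ⟨e⟩, hnull, hzero⟩

theorem IsLagrangianImmersion.hasNullVector_of_hasS3 (hx : IsLagrangianImmersion x) {p : L}
    {v : Fin 3 → E3} (hv : IsOrthonormalBasis x p v) (h : HasS3StabilizerAt x p) :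
    HasNullVector (fun i j k => fundamentalCubic x p (v i) (v j) (v k)) := by
  obtain ⟨C, hC, ⟨e⟩, hnull, -⟩ := hx.exists_form p hv
  obtain ⟨E⟩ := h
  exact hnull.mpr (hC.exists_null_of_S3 (e.trans E))

theorem IsLagrangianImmersion.hasS3_of_hasNullVector (hx : IsLagrangianImmersion x) {p : L}
    {v : Fin 3 → E3} (hv : IsOrthonormalBasis x p v)
    (h : HasNullVector (fun i j k => fundamentalCubic x p (v i) (v j) (v k)))
    (h0 : fundamentalCubic x p ≠ 0) : HasS3StabilizerAt x p := by
  obtain ⟨C, hC, ⟨e⟩, hnull, hzero⟩ := hx.exists_form p hv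
  obtain ⟨m, hm, hm2⟩ := hnull.mp h
  obtain ⟨E⟩ := hC.nonempty_mulEquiv_of_null (hzero.mp h0) hm hm2
  exact ⟨e.symm.trans E⟩

end Transport

/-! ### Covariant calculus for derivations of a commutative ring, and the Bochner formula -/

section Bochner

variable {R : Type*} [CommRing R]

/-- The derivation action of a matrix on cubic tensors. -/
def act (γ : Fin 3 → Fin 3 → R) (c : Fin 3 → Fin 3 → Fin 3 → R) (i j k : Fin 3) : R :=
  ∑ m, (γ i m * c m j k + γ j m * c i m k + γ k m * c i j m)

theorem act_sub_right (γ : Fin 3 → Fin 3 → R) (c d : Fin 3 → Fin 3 → Fin 3 → R) (i j k : Fin 3) :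
    act γ (fun i j k => c i j k - d i j k) i j k = act γ c i j k - act γ d i j k := by
  simp only [act, ← Finset.sum_sub_distrib]
  exact Finset.sum_congr rfl fun m _ => by ring

theorem act_sub_left (γ δ : Fin 3 → Fin 3 → R) (c : Fin 3 → Fin 3 → Fin 3 → R) (i j k : Fin 3) :
    act (fun i j => γ i j - δ i j) c i j k = act γ c i j k - act δ c i j k := by
  simp only [act, ← Finset.sum_sub_distrib]
  exact Finset.sum_congr rfl fun m _ => by ring

/-- The pairing of cubic tensors. -/
def pair (a b : Fin 3 → Fin 3 → Fin 3 → R) : R := ∑ i, ∑ j, ∑ k, a i j k * b i j k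

/-- Skew matrices act by skew-adjoint operators; this is what makes a connection with skew
coefficients compatible with the pairing. -/
theorem pair_act {γ : Fin 3 → Fin 3 → R} (hγ : ∀ i j, γ i j = -γ j i) (h0 : ∀ i, γ i i = 0)
    (a b : Fin 3 → Fin 3 → Fin 3 → R) : pair a (act γ b) = -pair (act γ a) b := by
  simp only [pair, act, Fin.sum_univ_three, h0, hγ 1 0, hγ 2 0, hγ 2 1]
  ring

variable [Algebra ℝ R]

/-- The covariant derivative of a cubic tensor along the `l`-th frame vector. -/
def covD (D : Fin 3 → Derivation ℝ R R) (Γ : Fin 3 → Fin 3 → Fin 3 → R)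
    (c : Fin 3 → Fin 3 → Fin 3 → R) (l i j k : Fin 3) : R :=
  D l (c i j k) - act (Γ l) c i j k

/-- The zeroth order operator in the commutator of two covariant derivatives. -/
def commOp (τ : Fin 3 → Fin 3 → Fin 3 → R) (Γ : Fin 3 → Fin 3 → Fin 3 → R)
    (dΓ : Fin 3 → Fin 3 → Fin 3 → Fin 3 → R)
    (c : Fin 3 → Fin 3 → Fin 3 → R) (l k i j n : Fin 3) : R :=
  ∑ m, τ l k m * act (Γ m) c i j n - act (fun a b => dΓ l k a b - dΓ k l a b) c i j n
    + act (Γ l) (act (Γ k) c) i j n - act (Γ k) (act (Γ l) c) i j n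

variable {D : Fin 3 → Derivation ℝ R R} {Γ τ t : Fin 3 → Fin 3 → Fin 3 → R}
  {c : Fin 3 → Fin 3 → Fin 3 → R}

theorem deriv_act (δ : Derivation ℝ R R) (γ : Fin 3 → Fin 3 → R) (i j k : Fin 3) :
    δ (act γ c i j k) =
      act (fun a b => δ (γ a b)) c i j k + act γ (fun a b d => δ (c a b d)) i j k := by
  simp only [act, map_sum, map_add, Derivation.leibniz, smul_eq_mul, ← Finset.sum_add_distrib]
  exact Finset.sum_congr rfl fun m _ => by ring

/-- Second derivatives of c enter only through brackets of the derivations, which `hbr` reduces to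
first order. What is left is of order zero in c apart from the term with τ. The explicit form of the
curvature operator is irrelevant later: it will only be bounded. -/
theorem covD_comm
    (hbr : ∀ l k g, D l (D k g) - D k (D l g) = ∑ m, τ l k m * D m g) (l k i j n : Fin 3) :
    (D l (covD D Γ c k i j n) - act (Γ l) (covD D Γ c k) i j n) -
      (D k (covD D Γ c l i j n) - act (Γ k) (covD D Γ c l) i j n) =
      commOp τ Γ (fun l k a b => D l (Γ k a b)) c l k i j n + ∑ m, τ l k m * covD D Γ c m i j n := by
  have e1 (l k : Fin 3) : act (Γ l) (covD D Γ c k) i j n =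
      act (Γ l) (fun a b d => D k (c a b d)) i j n - act (Γ l) (act (Γ k) c) i j n := by
    rw [← act_sub_right]; rfl
  have e2 (l k : Fin 3) : D l (covD D Γ c k i j n) = D l (D k (c i j n)) -
      (act (fun a b => D l (Γ k a b)) c i j n + act (Γ k) (fun a b d => D l (c a b d)) i j n) := by
    rw [covD, map_sub, deriv_act]
  have e3 : ∑ m, τ l k m * covD D Γ c m i j n =
      (D l (D k (c i j n)) - D k (D l (c i j n))) - ∑ m, τ l k m * act (Γ m) c i j n := by
    rw [hbr, ← Finset.sum_sub_distrib]
    exact Finset.sum_congr rfl fun m _ => by rw [covD]; ring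
  rw [e1, e1, e2, e2, e3, commOp, act_sub_left]
  ring

theorem pair_self_deriv (hΓ : ∀ l i j, Γ l i j = -Γ l j i) (hΓ0 : ∀ l i, Γ l i i = 0)
    (l : Fin 3) (a b : Fin 3 → Fin 3 → Fin 3 → R) :
    D l (pair a b) = pair (covD D Γ a l) b + pair a (covD D Γ b l) := by
  have h1 := pair_act (hΓ l) (hΓ0 l) a b
  have e1 : pair (covD D Γ a l) b =
      pair (fun i j k => D l (a i j k)) b - pair (act (Γ l) a) b := by
    simp only [pair, covD, sub_mul, Finset.sum_sub_distrib]
  have e2 : pair a (covD D Γ b l) =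
      pair a (fun i j k => D l (b i j k)) - pair a (act (Γ l) b) := by
    simp only [pair, covD, mul_sub, Finset.sum_sub_distrib]
  rw [e1, e2, h1]
  have e3 : D l (pair a b) = pair (fun i j k => D l (a i j k)) b
      + pair a (fun i j k => D l (b i j k)) := by
    simp only [pair, map_sum, Derivation.leibniz, smul_eq_mul, ← Finset.sum_add_distrib]
    exact Finset.sum_congr rfl fun _ _ => Finset.sum_congr rfl fun _ _ =>
      Finset.sum_congr rfl fun _ _ => by ring
  rw [e3]
  ring

theorem covD_symm₁₂ (hc₁₂ : ∀ i j k, c i j k = c j i k) (l i j k : Fin 3) :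
    covD D Γ c l i j k = covD D Γ c l j i k := by
  simp only [covD, act]
  rw [hc₁₂ i j k]
  congr 1
  exact Finset.sum_congr rfl fun m _ => by rw [hc₁₂ m j k, hc₁₂ i m k, hc₁₂ i j m]; ring

theorem covD_symm₂₃ (hc₂₃ : ∀ i j k, c i j k = c i k j) (l i j k : Fin 3) :
    covD D Γ c l i j k = covD D Γ c l i k j := by
  simp only [covD, act]
  rw [hc₂₃ i j k]
  congr 1
  exact Finset.sum_congr rfl fun m _ => by rw [hc₂₃ m j k, hc₂₃ i m k, hc₂₃ i j m]; ring

theorem covD_trace (hΓ : ∀ l i j, Γ l i j = -Γ l j i) (hΓ0 : ∀ l i, Γ l i i = 0)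
    (hc₁₂ : ∀ i j k, c i j k = c j i k) (htr : ∀ k, ∑ i, c i i k = 0) (l k : Fin 3) :
    ∑ i, covD D Γ c l i i k = 0 := by
  have h1 : ∑ i, act (Γ l) c i i k = 0 := by
    have h2 := htr 0
    have h3 := htr 1
    have h4 := htr 2
    simp only [act, Fin.sum_univ_three, hΓ0, hΓ l 1 0, hΓ l 2 0, hΓ l 2 1] at h2 h3 h4 ⊢
    rw [hc₁₂ 1 0, hc₁₂ 2 0, hc₁₂ 2 1]
    linear_combination Γ l k 0 * h2 + Γ l k 1 * h3 + Γ l k 2 * h4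
  simp only [covD, Finset.sum_sub_distrib, h1, ← map_sum, htr, map_zero, sub_zero]

/-- The Bochner formula for a trace-free Codazzi tensor of degree three. -/
theorem bochner (hΓ : ∀ l i j, Γ l i j = -Γ l j i) (hΓ0 : ∀ l i, Γ l i i = 0)
    (hbr : ∀ l k g, D l (D k g) - D k (D l g) = ∑ m, τ l k m * D m g)
    (hτ : ∀ l k m, τ l k m = Γ l k m - Γ k l m - t l k m)
    (ht : ∀ l k m, t l k m = -t m k l) (ht0 : ∀ l k, t l k l = 0)
    (hc₁₂ : ∀ i j k, c i j k = c j i k) (hc₂₃ : ∀ i j k, c i j k = c i k j)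
    (htr : ∀ k, ∑ i, c i i k = 0)
    (hT : ∀ l i j k, covD D Γ c l i j k = covD D Γ c i l j k) :
    ∑ l, (D l (D l (pair c c)) - ∑ m, Γ l l m * D m (pair c c)) =
      2 * ∑ l, pair (covD D Γ c l) (covD D Γ c l) +
      2 * ∑ i, ∑ j, ∑ k, c i j k *
        ∑ l, commOp τ Γ (fun l k a b => D l (Γ k a b)) c l k i j l := by
  set T := covD D Γ c with hTdef
  have hT₁₂ (l i j k) : T l i j k = T l j i k := covD_symm₁₂ hc₁₂ l i j k
  have hT₂₃ (l i j k) : T l i j k = T l i k j := covD_symm₂₃ hc₂₃ l i j k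
  -- With the Codazzi condition, T is symmetric in all four indices.
  have hTsw (l i j k) : T l i j k = T k i j l := by
    rw [hT₁₂, hT₂₃, hT₁₂, hT l k j i, hT₁₂, hT₂₃, hT₁₂]
  have hTtr (l k) : ∑ i, T l i i k = 0 := covD_trace hΓ hΓ0 hc₁₂ htr l k
  -- the second covariant derivative
  let N : Fin 3 → Fin 3 → Fin 3 → Fin 3 → Fin 3 → R := fun l k i j n =>
    D l (T k i j n) - act (Γ l) (T k) i j n - ∑ m, Γ l k m * T m i j n
  have hNsymm (l k i j n) : N l k i j n = N l n i j k := by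
    simp only [N, act]
    rw [hTsw k i j n, sub_sub, sub_sub, ← Finset.sum_add_distrib, ← Finset.sum_add_distrib]
    congr 1
    exact Finset.sum_congr rfl fun m _ => by
      rw [hTsw k m j n, hTsw k i m n, hTsw k i j m, hTsw m i j n]; ring
  have hNtr (k i j) : ∑ l, N k l i j l = 0 := by
    have hz : ∑ l, T l i j l = 0 := by
      have : ∀ l, T l i j l = T i l l j := fun l => by rw [hT l i j l, hT₂₃]
      simp only [this, hTtr]
    have hz2 (a b) : ∑ l, T l a b l = 0 := by
      have : ∀ l, T l a b l = T a l l b := fun l => by rw [hT l a b l, hT₂₃]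
      simp only [this, hTtr]
    have e1 : ∑ l, D k (T l i j l) = 0 := by rw [← map_sum, hz, map_zero]
    simp only [N, Finset.sum_sub_distrib, e1, act]
    have h0 := hz2 0 j
    have h1 := hz2 1 j
    have h2 := hz2 2 j
    have g0 := hz2 i 0
    have g1 := hz2 i 1
    have g2 := hz2 i 2
    simp only [Fin.sum_univ_three, hΓ0, hΓ k 1 0, hΓ k 2 0, hΓ k 2 1] at h0 h1 h2 g0 g1 g2 ⊢
    linear_combination -(Γ k i 0 * h0 + Γ k i 1 * h1 + Γ k i 2 * h2) -
      (Γ k j 0 * g0 + Γ k j 1 * g1 + Γ k j 2 * g2)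
  have hNcomm (l k i j n) : N l k i j n = N k l i j n +
      commOp τ Γ (fun l k a b => D l (Γ k a b)) c l k i j n - ∑ m, t l k m * T m i j n := by
    have h1 := covD_comm (c := c) (Γ := Γ) hbr l k i j n
    rw [← hTdef] at h1
    have h2 : ∑ m, τ l k m * T m i j n = ∑ m, Γ l k m * T m i j n - ∑ m, Γ k l m * T m i j n
        - ∑ m, t l k m * T m i j n := by
      rw [← Finset.sum_sub_distrib, ← Finset.sum_sub_distrib]
      exact Finset.sum_congr rfl fun m _ => by rw [hτ]; ring
    simp only [N]
    linear_combination h1 + h2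
  -- The torsion t is skew in the indices l and m in which T is symmetric, so it does not contribute
  -- to the Laplacian.
  have htT (k i j) : ∑ l, ∑ m, t l k m * T m i j l = 0 := by
    simp only [Fin.sum_univ_three, ht0, ht 1 k 0, ht 2 k 0, ht 2 k 1, hTsw 1 i j 0, hTsw 2 i j 0,
      hTsw 2 i j 1]
    ring
  -- By symmetry of T the Laplacian is ∑ₗ N l k i j l. After commuting the two derivatives it
  -- becomes the derivative of a divergence, which vanishes because T is trace free.
  have hLap (i j k) : ∑ l, N l l i j k =
      ∑ l, commOp τ Γ (fun l k a b => D l (Γ k a b)) c l k i j l := by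
    have : ∑ l, N l l i j k = ∑ l, N l k i j l := Finset.sum_congr rfl fun l _ => hNsymm l l i j k
    rw [this]
    simp only [hNcomm _ k i j _, Finset.sum_sub_distrib, Finset.sum_add_distrib, hNtr, htT]
    ring
  have hDA (l) : D l (pair c c) = 2 * pair c (T l) := by
    rw [pair_self_deriv hΓ hΓ0]
    have : pair (covD D Γ c l) c = pair c (T l) := by
      simp only [pair, mul_comm]; rfl
    rw [this, ← hTdef]
    ring
  have hDDA (l) : D l (D l (pair c c)) = 2 * pair (T l) (T l) +
      2 * pair c (covD D Γ (T l) l) := by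
    rw [hDA, Derivation.leibniz, pair_self_deriv hΓ hΓ0]
    have : D l 2 = 0 := by simpa using (D l).map_natCast 2
    rw [this]
    simp only [smul_eq_mul, hTdef]
    ring
  have hfin (l) : D l (D l (pair c c)) - ∑ m, Γ l l m * D m (pair c c) =
      2 * pair (T l) (T l) + 2 * ∑ i, ∑ j, ∑ k, c i j k * N l l i j k := by
    have e1 : ∑ m, Γ l l m * D m (pair c c) =
        2 * ∑ i, ∑ j, ∑ k, c i j k * ∑ m, Γ l l m * T m i j k := by
      simp only [hDA]
      simp only [pair, Fin.sum_univ_three]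
      ring
    have e2 : ∑ i, ∑ j, ∑ k, c i j k * N l l i j k = pair c (covD D Γ (T l) l) -
        ∑ i, ∑ j, ∑ k, c i j k * ∑ m, Γ l l m * T m i j k := by
      simp only [pair, N, covD, mul_sub, Finset.sum_sub_distrib]
    rw [hDDA, e1, e2]
    ring
  simp only [hfin, Finset.sum_add_distrib, ← Finset.mul_sum, ← hLap]
  congr 2
  rw [Finset.sum_comm]
  refine Finset.sum_congr rfl fun i _ => ?_
  rw [Finset.sum_comm]
  refine Finset.sum_congr rfl fun j _ => ?_
  rw [Finset.sum_comm]
  exact Finset.sum_congr rfl fun k _ => by rw [Finset.mul_sum]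

end Bochner

/-! ### Crude bounds for the zeroth order term -/

section Bounds

theorem abs_act_le {γ : Fin 3 → Fin 3 → ℝ} {c : Fin 3 → Fin 3 → Fin 3 → ℝ} {B s : ℝ}
    (hγ : ∀ i j, |γ i j| ≤ B) (hc : ∀ i j k, |c i j k| ≤ s) (i j k : Fin 3) :
    |act γ c i j k| ≤ 9 * B * s := by
  have hB : 0 ≤ B := (abs_nonneg _).trans (hγ 0 0)
  have h (a b i j k) : |γ a b * c i j k| ≤ B * s := by
    rw [abs_mul]
    exact mul_le_mul (hγ a b) (hc i j k) (abs_nonneg _) hB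
  calc |act γ c i j k| ≤ ∑ m : Fin 3, 3 * (B * s) := by
        refine (Finset.abs_sum_le_sum_abs _ _).trans (Finset.sum_le_sum fun m _ => ?_)
        refine (abs_add_three _ _ _).trans ?_
        linarith [h i m m j k, h j m i m k, h k m i j m]
    _ = 9 * B * s := by simp; ring

/-- The constant collects 27B² from the τ term, 18B from the derivatives of Γ and 2·81B² from the
double actions. Only linearity in s matters, which makes the final error a continuous multiple of
|C|². -/
theorem abs_commOp_le {τ Γ : Fin 3 → Fin 3 → Fin 3 → ℝ} {dΓ : Fin 3 → Fin 3 → Fin 3 → Fin 3 → ℝ}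
    {c : Fin 3 → Fin 3 → Fin 3 → ℝ} {B s : ℝ} (hτ : ∀ i j k, |τ i j k| ≤ B)
    (hΓ : ∀ i j k, |Γ i j k| ≤ B) (hdΓ : ∀ l i j k, |dΓ l i j k| ≤ B)
    (hc : ∀ i j k, |c i j k| ≤ s) (l k i j n : Fin 3) :
    |commOp τ Γ dΓ c l k i j n| ≤ (189 * B ^ 2 + 18 * B) * s := by
  have hB : 0 ≤ B := (abs_nonneg _).trans (hτ 0 0 0)
  have h1 : |∑ m, τ l k m * act (Γ m) c i j n| ≤ 27 * B ^ 2 * s := by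
    calc _ ≤ ∑ m : Fin 3, B * (9 * B * s) := by
          refine (Finset.abs_sum_le_sum_abs _ _).trans (Finset.sum_le_sum fun m _ => ?_)
          rw [abs_mul]
          exact mul_le_mul (hτ l k m) (abs_act_le (hΓ m) hc i j n) (abs_nonneg _) hB
      _ = _ := by simp; ring
  have h2 : |act (fun a b => dΓ l k a b - dΓ k l a b) c i j n| ≤ 9 * (2 * B) * s :=
    abs_act_le (fun a b => (abs_sub _ _).trans (by linarith [hdΓ l k a b, hdΓ k l a b])) hc i j n
  have h3 (l k) : |act (Γ l) (act (Γ k) c) i j n| ≤ 9 * B * (9 * B * s) :=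
    abs_act_le (hΓ l) (abs_act_le (hΓ k) hc) i j n
  rw [commOp]
  have h31 := abs_le.1 (h3 l k)
  have h32 := abs_le.1 (h3 k l)
  rw [abs_le] at h1 h2 ⊢
  constructor <;> linarith [h1.1, h1.2, h2.1, h2.2, h31.1, h31.2, h32.1, h32.2]

theorem sq_le_pair (c : Fin 3 → Fin 3 → Fin 3 → ℝ) (i j k : Fin 3) : c i j k ^ 2 ≤ pair c c := by
  have h0 (a b d) : 0 ≤ c a b d * c a b d := mul_self_nonneg _
  calc c i j k ^ 2 = c i j k * c i j k := sq _
    _ ≤ ∑ d, c i j d * c i j d :=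
      Finset.single_le_sum (f := fun d => c i j d * c i j d) (fun d _ => h0 i j d)
        (Finset.mem_univ k)
    _ ≤ ∑ b, ∑ d, c i b d * c i b d :=
      Finset.single_le_sum (f := fun b => ∑ d, c i b d * c i b d)
        (fun b _ => Finset.sum_nonneg fun d _ => h0 i b d) (Finset.mem_univ j)
    _ ≤ pair c c :=
      Finset.single_le_sum (f := fun a => ∑ b, ∑ d, c a b d * c a b d)
        (fun a _ => Finset.sum_nonneg fun b _ => Finset.sum_nonneg fun d _ => h0 a b d)
        (Finset.mem_univ i)

theorem pair_self_nonneg (c : Fin 3 → Fin 3 → Fin 3 → ℝ) : 0 ≤ pair c c :=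
  (sq_nonneg _).trans (sq_le_pair c 0 0 0)

theorem abs_pair_commOp_le {τ Γ : Fin 3 → Fin 3 → Fin 3 → ℝ}
    {dΓ : Fin 3 → Fin 3 → Fin 3 → Fin 3 → ℝ} (c : Fin 3 → Fin 3 → Fin 3 → ℝ) {B : ℝ}
    (hτ : ∀ i j k, |τ i j k| ≤ B) (hΓ : ∀ i j k, |Γ i j k| ≤ B)
    (hdΓ : ∀ l i j k, |dΓ l i j k| ≤ B) :
    |∑ i, ∑ j, ∑ k, c i j k * ∑ l, commOp τ Γ dΓ c l k i j l| ≤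
      81 * (189 * B ^ 2 + 18 * B) * pair c c := by
  set s := √(pair c c)
  have hs : s * s = pair c c := Real.mul_self_sqrt (pair_self_nonneg c)
  have hc (i j k) : |c i j k| ≤ s := Real.abs_le_sqrt (sq_le_pair c i j k)
  have hs0 : 0 ≤ s := Real.sqrt_nonneg _
  have hterm (i j k) : |c i j k * ∑ l, commOp τ Γ dΓ c l k i j l| ≤
      s * (3 * ((189 * B ^ 2 + 18 * B) * s)) := by
    rw [abs_mul]
    refine mul_le_mul (hc i j k) ?_ (abs_nonneg _) hs0
    calc _ ≤ ∑ l : Fin 3, (189 * B ^ 2 + 18 * B) * s :=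
          (Finset.abs_sum_le_sum_abs _ _).trans (Finset.sum_le_sum fun l _ =>
            abs_commOp_le hτ hΓ hdΓ hc l k i j l)
      _ = _ := by simp
  calc _ ≤ ∑ i : Fin 3, ∑ j : Fin 3, ∑ k : Fin 3, s * (3 * ((189 * B ^ 2 + 18 * B) * s)) := by
        refine (Finset.abs_sum_le_sum_abs _ _).trans (Finset.sum_le_sum fun i _ => ?_)
        refine (Finset.abs_sum_le_sum_abs _ _).trans (Finset.sum_le_sum fun j _ => ?_)
        exact (Finset.abs_sum_le_sum_abs _ _).trans (Finset.sum_le_sum fun k _ => hterm i j k)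
    _ = _ := by rw [← hs]; simp; ring

end Bounds

/-! ### The refined Kato inequality -/

section Kato

/-- The change of basis of a cubic tensor. -/
def rot (R : Fin 3 → Fin 3 → ℝ) (c : Fin 3 → Fin 3 → Fin 3 → ℝ) (a b d : Fin 3) : ℝ :=
  ∑ i, R a i * ∑ j, R b j * ∑ k, R d k * c i j k

variable {R : Fin 3 → Fin 3 → ℝ}
  (hR : ∀ x y : Fin 3 → ℝ, ∑ a, (∑ i, R a i * x i) * (∑ i, R a i * y i) = ∑ i, x i * y i)

-- Changing basis is an isometry in each of the three slots separately.
include hR in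
theorem pair_rot (c d : Fin 3 → Fin 3 → Fin 3 → ℝ) : pair (rot R c) (rot R d) = pair c d := by
  have key (f g : Fin 3 → Fin 3 → Fin 3 → ℝ) :
      ∑ a, ∑ b, ∑ e, (∑ i, R a i * f i b e) * (∑ i, R a i * g i b e) =
        ∑ i, ∑ b, ∑ e, f i b e * g i b e := by
    rw [Finset.sum_comm, Finset.sum_comm (γ := Fin 3) (s := Finset.univ) (t := Finset.univ)
      (f := fun i b => ∑ e, f i b e * g i b e)]
    refine Finset.sum_congr rfl fun b _ => ?_
    rw [Finset.sum_comm, Finset.sum_comm (γ := Fin 3) (s := Finset.univ) (t := Finset.univ)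
      (f := fun i e => f i b e * g i b e)]
    exact Finset.sum_congr rfl fun e _ => hR _ _
  simp only [pair, rot]
  rw [key (fun i b e => ∑ j, R b j * ∑ k, R e k * c i j k)
    (fun i b e => ∑ j, R b j * ∑ k, R e k * d i j k)]
  refine Finset.sum_congr rfl fun i _ => ?_
  have h2 : ∑ b, ∑ e, (∑ j, R b j * ∑ k, R e k * c i j k) * (∑ j, R b j * ∑ k, R e k * d i j k) =
      ∑ j, ∑ e, (∑ k, R e k * c i j k) * (∑ k, R e k * d i j k) := by
    rw [Finset.sum_comm, Finset.sum_comm (γ := Fin 3) (s := Finset.univ) (t := Finset.univ)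
      (f := fun j e => (∑ k, R e k * c i j k) * (∑ k, R e k * d i j k))]
    exact Finset.sum_congr rfl fun e _ => hR _ _
  rw [h2]
  exact Finset.sum_congr rfl fun j _ => hR _ _

theorem rot_symm₁₂ {c : Fin 3 → Fin 3 → Fin 3 → ℝ} (h : ∀ i j k, c i j k = c j i k)
    (a b d : Fin 3) : rot R c a b d = rot R c b a d := by
  simp only [rot, Finset.mul_sum]
  rw [Finset.sum_comm]
  exact Finset.sum_congr rfl fun i _ => Finset.sum_congr rfl fun j _ =>
    Finset.sum_congr rfl fun k _ => by rw [h]; ring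

theorem rot_symm₂₃ {c : Fin 3 → Fin 3 → Fin 3 → ℝ} (h : ∀ i j k, c i j k = c i k j)
    (a b d : Fin 3) : rot R c a b d = rot R c a d b := by
  simp only [rot, Finset.mul_sum]
  refine Finset.sum_congr rfl fun i _ => ?_
  rw [Finset.sum_comm]
  exact Finset.sum_congr rfl fun j _ => Finset.sum_congr rfl fun k _ => by rw [h]; ring

include hR in
theorem rot_trace {c : Fin 3 → Fin 3 → Fin 3 → ℝ} (h : ∀ k, ∑ i, c i i k = 0) (d : Fin 3) :
    ∑ a, rot R c a a d = 0 := by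
  have h1 (i j : Fin 3) : ∑ a, R a i * R a j = if i = j then 1 else 0 := by
    simpa [Pi.single_apply, eq_comm] using hR (Pi.single i 1) (Pi.single j 1)
  calc ∑ a, rot R c a a d
      = ∑ i, ∑ j, (∑ a, R a i * R a j) * ∑ k, R d k * c i j k := by
        simp only [rot, Finset.mul_sum]
        rw [Finset.sum_comm]
        refine Finset.sum_congr rfl fun i _ => ?_
        rw [Finset.sum_comm]
        refine Finset.sum_congr rfl fun j _ => ?_
        rw [Finset.sum_comm]
        refine Finset.sum_congr rfl fun k _ => ?_
        rw [Finset.sum_mul]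
        exact Finset.sum_congr rfl fun a _ => by ring
    _ = ∑ k, R d k * ∑ i, c i i k := by
        simp only [h1, ite_mul, one_mul, zero_mul, Finset.sum_ite_eq, Finset.mem_univ, if_true]
        rw [Finset.sum_comm]
        exact Finset.sum_congr rfl fun k _ => by rw [Finset.mul_sum]
    _ = 0 := by simp [h]

/-- The refined Kato inequality in an adapted basis. -/
theorem kato_adapted {c : Fin 3 → Fin 3 → Fin 3 → ℝ} {T : Fin 3 → Fin 3 → Fin 3 → Fin 3 → ℝ}
    (hc : IsHarmonicCubic c) (hn : ∀ j k, c 2 j k = 0)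
    (hT : ∀ l, IsHarmonicCubic (T l)) (hs : ∀ l i j k, T l i j k = T i l j k)
    (hTn : ∀ j k, T 2 2 j k = 0) :
    ∑ l, pair c (T l) ^ 2 ≤ 1 / 2 * pair c c * ∑ l, pair (T l) (T l) := by
  have shape (d : Fin 3 → Fin 3 → Fin 3 → ℝ) (hd : IsHarmonicCubic d) (hn : ∀ j k, d 2 j k = 0) :
      d 0 1 1 = -d 0 0 0 ∧ d 1 1 1 = -d 0 0 1 := by
    have h0 := hd.trace 0
    have h1 := hd.trace 1
    simp only [Fin.sum_univ_three, hn] at h0 h1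
    rw [hd.symm₁₂ 0 1 1, hd.symm₂₃ 1 0 1]
    constructor <;> linarith
  have s1 (l) := (hT l).symm₁₂
  have s2 (l) := (hT l).symm₂₃
  have c1 := hc.symm₁₂
  have c2 := hc.symm₂₃
  have hTn' (i k) : T 2 i 2 k = 0 := by rw [s1, hTn]
  have hTn'' (i j) : T 2 i j 2 = 0 := by rw [s2, hTn']
  have n02 (j) : T 0 j 2 2 = 0 := by rw [s1, hs, hTn'']
  have n12 (j) : T 1 j 2 2 = 0 := by rw [s1, hs, hTn'']
  have n22 (j k) : c j 2 k = 0 := by rw [c1, hn]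
  have n23 (j k) : c j k 2 = 0 := by rw [c2, n22]
  obtain ⟨u0, u1⟩ := shape c hc hn
  obtain ⟨w0, w1⟩ := shape (T 2) (hT 2) hTn
  -- With T(n,n,·,·) = 0, the tensor T is determined by T₀₀₀₀, T₀₀₀₁ (its planar part) and T₂₀₀₀,
  -- T₂₀₀₁.
  have v0 : T 0 0 1 1 = -T 0 0 0 0 := by
    have := (hT 0).trace 0
    simp only [Fin.sum_univ_three] at this
    rw [s2 0 2 2 0, s1 0 2 0 2, n02] at this
    rw [s1 0 0 1 1, s2 0 1 0 1]; linarith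
  have v1 : T 0 1 1 1 = -T 0 0 0 1 := by
    have := (hT 0).trace 1
    simp only [Fin.sum_univ_three] at this
    rw [s2 0 2 2 1, s1 0 2 1 2, n02] at this
    linarith
  have v2 : T 1 1 1 1 = T 0 0 0 0 := by
    have := (hT 1).trace 1
    simp only [Fin.sum_univ_three] at this
    rw [s2 1 2 2 1, s1 1 2 1 2, n12, hs 1 0 0 1, s1 0 1 0 1, v0] at this
    linarith
  have v3 : T 0 0 1 2 = T 2 0 0 1 := by rw [s2 0 0 1 2, s1 0 0 2 1, hs 0 2 0 1]
  have v4 : T 0 0 0 2 = T 2 0 0 0 := by rw [s2 0 0 0 2, s1 0 0 2 0, hs 0 2 0 0]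
  have v5 : T 0 1 1 2 = -T 2 0 0 0 := by rw [s2 0 1 1 2, s1 0 1 2 1, hs 0 2 1 1, w0]
  have v6 : T 1 1 1 2 = -T 2 0 0 1 := by rw [s2 1 1 1 2, s1 1 1 2 1, hs 1 2 1 1, w1]
  simp only [pair, Fin.sum_univ_three, hn, n22, n23, hTn, hTn', hTn'', n02, n12, s1 _ 1 0, s1 _ 2 0,
    s1 _ 2 1, s2 _ _ 1 0, s2 _ _ 2 0, s2 _ _ 2 1, hs 1 0, v0, v1, v2, v3, v4, v5, v6, w0, w1,
    c1 1 0, c2 _ 1 0, u0, u1]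
  -- Write x, y for c₀₀₀, c₀₀₁, then a, b for the planar and p, q for the mixed components of T. The
  -- left side is 16(x²+y²)(a²+b²) + 16(xp+yq)², the right side 16(x²+y²)(a²+b²) + 32(x²+y²)(p²+q²).
  -- The planar parts agree, so 1/2 cannot be improved.
  nlinarith [sq_nonneg (c 0 0 0 * T 2 0 0 1 - c 0 0 1 * T 2 0 0 0),
    mul_nonneg (add_nonneg (sq_nonneg (c 0 0 0)) (sq_nonneg (c 0 0 1)))
      (add_nonneg (sq_nonneg (T 2 0 0 0)) (sq_nonneg (T 2 0 0 1)))]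

include hR in
theorem kato_rot {c : Fin 3 → Fin 3 → Fin 3 → ℝ} {T : Fin 3 → Fin 3 → Fin 3 → Fin 3 → ℝ}
    (hc : IsHarmonicCubic c) (hn : ∀ j k, ∑ i, R 2 i * c i j k = 0)
    (hT : ∀ l, IsHarmonicCubic (T l)) (hs : ∀ l i j k, T l i j k = T i l j k)
    (hTn : ∀ j k, ∑ l, ∑ i, R 2 l * R 2 i * T l i j k = 0) :
    ∑ l, pair c (T l) ^ 2 ≤ 1 / 2 * pair c c * ∑ l, pair (T l) (T l) := by
  have harm {d : Fin 3 → Fin 3 → Fin 3 → ℝ} (hd : IsHarmonicCubic d) : IsHarmonicCubic (rot R d) :=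
    ⟨rot_symm₁₂ hd.symm₁₂, rot_symm₂₃ hd.symm₂₃, rot_trace hR hd.trace⟩
  have rot_null {d : Fin 3 → Fin 3 → Fin 3 → ℝ} (hd : ∀ j k, ∑ i, R 2 i * d i j k = 0) (b e) :
      rot R d 2 b e = 0 := by
    have : rot R d 2 b e = ∑ j, R b j * ∑ k, R e k * ∑ i, R 2 i * d i j k := by
      simp only [rot, Finset.mul_sum]
      rw [Finset.sum_comm]
      refine Finset.sum_congr rfl fun j _ => ?_
      rw [Finset.sum_comm]
      exact Finset.sum_congr rfl fun k _ => Finset.sum_congr rfl fun i _ => by ring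
    simp [this, hd]
  let U (a : Fin 3) : Fin 3 → Fin 3 → Fin 3 → ℝ := fun i j k => ∑ l, R a l * T l i j k
  have hU (a) : IsHarmonicCubic (U a) := by
    refine ⟨fun i j k => ?_, fun i j k => ?_, fun k => ?_⟩
    · simp only [U, (hT _).symm₁₂ i j k]
    · simp only [U, (hT _).symm₂₃ i j k]
    · simp only [U]
      rw [Finset.sum_comm]
      simp only [← Finset.mul_sum, (hT _).trace, mul_zero, Finset.sum_const_zero]
  have key := kato_adapted (c := rot R c) (T := fun a => rot R (U a)) (harm hc) (rot_null hn)
    (fun a => harm (hU a)) (fun a b d e => ?_) (fun d e => ?_)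
  · rw [pair_rot hR] at key
    have e1 : ∑ a, pair (rot R c) (rot R (U a)) ^ 2 = ∑ l, pair c (T l) ^ 2 := by
      have hp (a) : pair c (U a) = ∑ l, R a l * pair c (T l) := by
        simp only [pair, U, Finset.mul_sum]
        symm
        rw [Finset.sum_comm]
        refine Finset.sum_congr rfl fun i _ => ?_
        rw [Finset.sum_comm]
        refine Finset.sum_congr rfl fun j _ => ?_
        rw [Finset.sum_comm]
        exact Finset.sum_congr rfl fun k _ => Finset.sum_congr rfl fun l _ => by ring
      simp only [pair_rot hR, hp, sq]
      exact hR _ _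
    have e2 : ∑ a, pair (rot R (U a)) (rot R (U a)) = ∑ l, pair (T l) (T l) := by
      simp only [pair_rot hR]
      simp only [pair, U]
      rw [Finset.sum_comm, Finset.sum_comm (f := fun l i => ∑ j, ∑ k, T l i j k * T l i j k)]
      refine Finset.sum_congr rfl fun i _ => ?_
      rw [Finset.sum_comm, Finset.sum_comm (f := fun l j => ∑ k, T l i j k * T l i j k)]
      refine Finset.sum_congr rfl fun j _ => ?_
      rw [Finset.sum_comm, Finset.sum_comm (f := fun l k => T l i j k * T l i j k)]
      exact Finset.sum_congr rfl fun k _ => hR _ _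
    rwa [e1, e2] at key
  · simp only [rot, U, Finset.mul_sum]
    have sw (F : Fin 3 → Fin 3 → Fin 3 → Fin 3 → ℝ) :
        ∑ i, ∑ j, ∑ k, ∑ l, F i j k l = ∑ i, ∑ l, ∑ j, ∑ k, F i j k l := by
      refine Finset.sum_congr rfl fun i _ => ?_
      symm
      rw [Finset.sum_comm]
      refine Finset.sum_congr rfl fun j _ => ?_
      rw [Finset.sum_comm]
    refine (sw _).trans (Eq.trans ?_ (sw _).symm)
    rw [Finset.sum_comm]
    exact Finset.sum_congr rfl fun i _ => Finset.sum_congr rfl fun l _ =>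
      Finset.sum_congr rfl fun j _ => Finset.sum_congr rfl fun k _ => by rw [hs]; ring
  · refine rot_null (fun j k => ?_) d e
    rw [← hTn j k, Finset.sum_comm]
    simp only [U, Finset.mul_sum]
    rw [Finset.sum_comm]
    refine Finset.sum_congr rfl fun l _ => Finset.sum_congr rfl fun i _ => ?_
    rw [hs]; ring

/-- The refined Kato inequality for a Codazzi tensor with a null direction. -/
theorem kato {c : Fin 3 → Fin 3 → Fin 3 → ℝ} {T : Fin 3 → Fin 3 → Fin 3 → Fin 3 → ℝ}
    (hc : IsHarmonicCubic c) {n : Fin 3 → ℝ} (hn0 : n ≠ 0) (hn : ∀ j k, ∑ i, n i * c i j k = 0)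
    (hT : ∀ l, IsHarmonicCubic (T l)) (hs : ∀ l i j k, T l i j k = T i l j k)
    (hTn : ∀ j k, ∑ l, ∑ i, n l * n i * T l i j k = 0) :
    ∑ l, pair c (T l) ^ 2 ≤ 1 / 2 * pair c c * ∑ l, pair (T l) (T l) := by
  obtain ⟨r, -, hr⟩ := exists_unit_smul (m := WithLp.toLp 2 n) (by simpa using hn0)
  obtain ⟨b, hb⟩ := exists_onb_single hr
  have hb2 (i) : b 2 i = r * n i := by rw [hb]; rfl
  refine kato_rot (R := fun a i => b a i) (fun x y => ?_) hc (fun j k => ?_) hT hs fun j k => ?_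
  · have := b.sum_inner_mul_inner (WithLp.toLp 2 x) (WithLp.toLp 2 y)
    simp only [PiLp.inner_apply, RCLike.inner_apply, conj_trivial] at this
    rw [Finset.sum_congr rfl fun i _ => mul_comm (x i) (y i), ← this]
    exact Finset.sum_congr rfl fun a _ => by
      rw [Finset.sum_congr rfl fun i _ => mul_comm (b a i) (y i)]
  · simp only [hb2, mul_assoc, ← Finset.mul_sum, hn, mul_zero]
  · have : ∑ l, ∑ i, b 2 l * b 2 i * T l i j k = r ^ 2 * ∑ l, ∑ i, n l * n i * T l i j k := by
      simp only [hb2, Finset.mul_sum]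
      exact Finset.sum_congr rfl fun l _ => Finset.sum_congr rfl fun i _ => by ring
    rw [this, hTn, mul_zero]

end Kato

/-! ### Smooth choice of null vectors -/

section NullVector

/-- Three vectors orthogonal to a nonzero n are dependent. Hence the cross product of two columns of
a cubic with a null vector is again null, and depends polynomially on the cubic. -/
theorem det_of_null {n u v w : Fin 3 → ℝ} (hn : n ≠ 0) (hu : ∑ i, n i * u i = 0)
    (hv : ∑ i, n i * v i = 0) (hw : ∑ i, n i * w i = 0) :
    ∑ i, (crossProduct u v) i * w i = 0 := by
  obtain ⟨j, hj⟩ := Function.ne_iff.1 hn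
  refine (mul_eq_zero.1 ?_).resolve_left hj
  rw [cross_apply]
  simp only [Fin.sum_univ_three] at *
  fin_cases j <;> simp only [Fin.mk_zero, Fin.mk_one, Fin.reduceFinMk, Matrix.cons_val]
  · linear_combination (v 1 * w 2 - v 2 * w 1) * hu + (w 1 * u 2 - w 2 * u 1) * hv +
      (u 1 * v 2 - u 2 * v 1) * hw
  · linear_combination (v 2 * w 0 - v 0 * w 2) * hu + (w 2 * u 0 - w 0 * u 2) * hv +
      (u 2 * v 0 - u 0 * v 2) * hw
  · linear_combination (v 0 * w 1 - v 1 * w 0) * hu + (w 0 * u 1 - w 1 * u 0) * hv +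
      (u 0 * v 1 - u 1 * v 0) * hw

/-- A nonzero harmonic cubic has two columns with nonzero cross product. -/
theorem IsHarmonicCubic.exists_crossProduct_ne_zero {c : Fin 3 → Fin 3 → Fin 3 → ℝ}
    (hc : IsHarmonicCubic c) (h0 : pair c c ≠ 0) :
    ∃ α β : Fin 3 × Fin 3,
      crossProduct (fun i => c i α.1 α.2) (fun i => c i β.1 β.2) ≠ 0 := by
  by_contra! h
  have key (i l j k m n) : c i j k * c l m n = c l j k * c i m n := by
    have := h (j, k) (m, n)
    rw [cross_apply] at this
    have e0 := congrFun this 0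
    have e1 := congrFun this 1
    have e2 := congrFun this 2
    simp only [Matrix.cons_val, Pi.zero_apply] at e0 e1 e2
    fin_cases i <;> fin_cases l <;> simp only [Fin.mk_zero, Fin.mk_one, Fin.reduceFinMk] <;> linarith
  refine h0 ?_
  -- If all columns are parallel, contracting the rank-one relation produces the trace of c; so c·c
  -- = 0 and |c|² = 0.
  have h1 (i k m n) : ∑ j, c i j k * c j m n = 0 := by
    have : ∑ j, c i j k * c j m n = (∑ j, c j j k) * c i m n := by
      rw [Finset.sum_mul]
      exact Finset.sum_congr rfl fun j _ => key i j j k m n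
    rw [this, hc.trace, zero_mul]
  have h2 : pair c c = ∑ i, ∑ k, ∑ j, c i j k * c j i k := by
    refine Finset.sum_congr rfl fun i _ => ?_
    rw [Finset.sum_comm]
    exact Finset.sum_congr rfl fun k _ => Finset.sum_congr rfl fun j _ => by rw [hc.symm₁₂ j i k]
  simp only [h2, h1, Finset.sum_const_zero]

variable {R : Type*} [CommRing R] [Algebra ℝ R] {D : Fin 3 → Derivation ℝ R R}
  {Γ c : Fin 3 → Fin 3 → Fin 3 → R}

/-- In the derivative of n⌟c = 0, the term with the derivative of n dies on a second contraction
with n. The result supplies T(n,n,·,·) = 0 for the Kato inequality. -/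
theorem covD_null {n : Fin 3 → R} (hc₁₂ : ∀ i j k, c i j k = c j i k)
    (hn : ∀ j k, ∑ i, n i * c i j k = 0) (l k : Fin 3) :
    ∑ i, ∑ j, n i * n j * covD D Γ c l i j k = 0 := by
  have hn2 (i k) : ∑ j, n j * c i j k = 0 := by
    rw [← hn i k]; exact Finset.sum_congr rfl fun j _ => by rw [hc₁₂]
  have h1 (j) : ∑ i, n i * D l (c i j k) = -∑ i, c i j k * D l (n i) := by
    have := congrArg (D l) (hn j k)
    simp only [map_sum, Derivation.leibniz, smul_eq_mul, map_zero, Finset.sum_add_distrib] at this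
    linear_combination this
  have e1 : ∑ i, ∑ j, n i * n j * D l (c i j k) = 0 := by
    calc _ = ∑ j, n j * ∑ i, n i * D l (c i j k) := by
          rw [Finset.sum_comm]
          exact Finset.sum_congr rfl fun j _ => by
            rw [Finset.mul_sum]; exact Finset.sum_congr rfl fun i _ => by ring
      _ = -∑ i, D l (n i) * ∑ j, n j * c i j k := by
          simp only [h1, Finset.mul_sum, mul_neg, Finset.sum_neg_distrib]
          rw [Finset.sum_comm]
          congr 1
          exact Finset.sum_congr rfl fun i _ => Finset.sum_congr rfl fun j _ => by ring
      _ = 0 := by simp [hn2]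
  have e2 : ∑ i, ∑ j, n i * n j * act (Γ l) c i j k = 0 := by
    have a0 := hn 0 k
    have a1 := hn 1 k
    have a2 := hn 2 k
    have b0 := hn2 0 k
    have b1 := hn2 1 k
    have b2 := hn2 2 k
    have d0 (m) := hn2 0 m
    have d1 (m) := hn2 1 m
    have d2 (m) := hn2 2 m
    simp only [act, Fin.sum_univ_three] at *
    linear_combination (n 0 * Γ l 0 0 + n 1 * Γ l 1 0 + n 2 * Γ l 2 0) * (a0 + b0) +
      (n 0 * Γ l 0 1 + n 1 * Γ l 1 1 + n 2 * Γ l 2 1) * (a1 + b1) +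
      (n 0 * Γ l 0 2 + n 1 * Γ l 1 2 + n 2 * Γ l 2 2) * (a2 + b2) +
      Γ l k 0 * (n 0 * d0 0 + n 1 * d1 0 + n 2 * d2 0) +
      Γ l k 1 * (n 0 * d0 1 + n 1 * d1 1 + n 2 * d2 1) +
      Γ l k 2 * (n 0 * d0 2 + n 1 * d1 2 + n 2 * d2 2)
  simp only [covD, mul_sub, Finset.sum_sub_distrib, e1, e2, sub_zero]

end NullVector

/-! ### A global orthonormal frame on ℝ³ -/

section Frame

theorem _root_.ContDiff.cross {a b : E3 → ImO} (ha : ContDiff ℝ ∞ a) (hb : ContDiff ℝ ∞ b) :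
    ContDiff ℝ ∞ fun y => S6.cross (a y) (b y) :=
  contDiff_iff_contDiffAt.2 fun _ => ha.contDiffAt.cross hb.contDiffAt

/-- A smooth frame of `ℝ³`, orthonormal for the metric induced by `f`. -/
structure IsSmoothFrame (f : E3 → ImO) (X : Fin 3 → E3 → E3) : Prop where
  smooth : ∀ i, ContDiff ℝ ∞ (X i)
  orth : ∀ y i j, met f y (X i y) (X j y) = if i = j then 1 else 0

variable {f : E3 → ImO} (h : LagOn f Set.univ)

include h

theorem LagOn.contDiff : ContDiff ℝ ∞ f := contDiffOn_univ.1 h.smooth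

theorem LagOn.contDiff_fderiv_apply {X : E3 → E3} (hX : ContDiff ℝ ∞ X) :
    ContDiff ℝ ∞ fun y => fderiv ℝ f y (X y) :=
  (h.contDiff.fderiv_right (m := ∞) (by simp)).clm_apply hX

theorem LagOn.contDiff_met {X Y : E3 → E3} (hX : ContDiff ℝ ∞ X) (hY : ContDiff ℝ ∞ Y) :
    ContDiff ℝ ∞ fun y => met f y (X y) (Y y) :=
  (h.contDiff_fderiv_apply hX).inner ℝ (h.contDiff_fderiv_apply hY)

theorem LagOn.met_self_pos (y : E3) {u : E3} (hu : u ≠ 0) : 0 < met f y u u := by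
  rw [met, real_inner_self_eq_norm_sq]
  have : fderiv ℝ f y u ≠ 0 := fun h0 => hu (h.inj y trivial (by simpa using h0))
  positivity

theorem LagOn.exists_unit {w : E3 → E3} (hw : ContDiff ℝ ∞ w) (h0 : ∀ y, w y ≠ 0) :
    ∃ r : E3 → ℝ, ContDiff ℝ ∞ r ∧ ∀ y, met f y (r y • w y) (r y • w y) = 1 := by
  have hpos (y) := h.met_self_pos y (h0 y)
  refine ⟨fun y => (√(met f y (w y) (w y)))⁻¹, ?_, fun y => ?_⟩
  · exact ((h.contDiff_met hw hw).sqrt fun y => (hpos y).ne').inv fun y =>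
      (Real.sqrt_pos.2 (hpos y)).ne'
  · have := Real.mul_self_sqrt (hpos y).le
    have h1 := (Real.sqrt_pos.2 (hpos y)).ne'
    have h2 (r : ℝ) : met f y (r • w y) (r • w y) = r * (r * met f y (w y) (w y)) := by
      simp only [met, map_smul, inner_smul_left, inner_smul_right, conj_trivial]
    rw [h2]
    field_simp
    linarith

theorem LagOn.exists_isSmoothFrame : ∃ X, IsSmoothFrame f X := by
  have msub (y u v w) : met f y (u - v) w = met f y u w - met f y v w := by
    simp only [met, map_sub, inner_sub_left]
  have msmul (y) (r : ℝ) (u v) : met f y (r • u) v = r * met f y u v := by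
    simp [met, inner_smul_left]
  obtain ⟨r0, hr0, h00⟩ := h.exists_unit (w := fun _ => stdVec 0) contDiff_const
    fun y h0 => by simpa using congrArg (fun v : E3 => v 0) h0
  set X0 : E3 → E3 := fun y => r0 y • stdVec 0
  have hX0 : ContDiff ℝ ∞ X0 := hr0.smul contDiff_const
  have h00' (y) : met f y (X0 y) (X0 y) = 1 := h00 y
  -- Gram–Schmidt applied to the standard basis. Each new vector is nonzero because its last
  -- coordinate remains 1.
  let w1 : E3 → E3 := fun y => stdVec 1 - met f y (stdVec 1) (X0 y) • X0 y
  have hw1 : ContDiff ℝ ∞ w1 :=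
    contDiff_const.sub ((h.contDiff_met contDiff_const hX0).smul hX0)
  have w11 (y) : w1 y 1 = 1 := by simp [w1, X0]
  have w12 (y) : w1 y 2 = 0 := by simp [w1, X0]
  have w10 (y) : met f y (w1 y) (X0 y) = 0 := by
    simp only [w1]
    rw [msub, msmul, h00', mul_one, sub_self]
  obtain ⟨r1, hr1, h11⟩ := h.exists_unit hw1
    fun y h0 => by simpa [w11] using congrArg (fun v : E3 => v 1) h0
  set X1 : E3 → E3 := fun y => r1 y • w1 y
  have hX1 : ContDiff ℝ ∞ X1 := hr1.smul hw1
  have h11' (y) : met f y (X1 y) (X1 y) = 1 := h11 y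
  have h10 (y) : met f y (X1 y) (X0 y) = 0 := by simp only [X1]; rw [msmul, w10, mul_zero]
  have h01 (y) : met f y (X0 y) (X1 y) = 0 := by rw [met_comm, h10]
  let w2 : E3 → E3 := fun y => stdVec 2 - met f y (stdVec 2) (X0 y) • X0 y
    - met f y (stdVec 2) (X1 y) • X1 y
  have hw2 : ContDiff ℝ ∞ w2 :=
    (contDiff_const.sub ((h.contDiff_met contDiff_const hX0).smul hX0)).sub
      ((h.contDiff_met contDiff_const hX1).smul hX1)
  have w22 (y) : w2 y 2 = 1 := by simp [w2, X0, X1, w12]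
  have w20 (y) : met f y (w2 y) (X0 y) = 0 := by
    simp only [w2]
    rw [msub, msub, msmul _ _ (X0 y), msmul _ _ (X1 y), h00', h10]; ring
  have w21 (y) : met f y (w2 y) (X1 y) = 0 := by
    simp only [w2]
    rw [msub, msub, msmul _ _ (X0 y), msmul _ _ (X1 y), h11', h01]; ring
  obtain ⟨r2, hr2, h22⟩ := h.exists_unit hw2
    fun y h0 => by simpa [w22] using congrArg (fun v : E3 => v 2) h0
  set X2 : E3 → E3 := fun y => r2 y • w2 y
  have hX2 : ContDiff ℝ ∞ X2 := hr2.smul hw2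
  have h22' (y) : met f y (X2 y) (X2 y) = 1 := h22 y
  have h20 (y) : met f y (X2 y) (X0 y) = 0 := by simp only [X2]; rw [msmul, w20, mul_zero]
  have h21 (y) : met f y (X2 y) (X1 y) = 0 := by simp only [X2]; rw [msmul, w21, mul_zero]
  have h02 (y) : met f y (X0 y) (X2 y) = 0 := by rw [met_comm, h20]
  have h12 (y) : met f y (X1 y) (X2 y) = 0 := by rw [met_comm, h21]
  refine ⟨![X0, X1, X2], ⟨fun i => ?_, fun y i j => ?_⟩⟩
  · fin_cases i
    exacts [hX0, hX1, hX2]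
  · fin_cases i <;> fin_cases j
    exacts [h00' y, h01 y, h02 y, h10 y, h11' y, h12 y, h20 y, h21 y, h22' y]

end Frame

/-! ### Structure equations in a frame and the Codazzi equation -/

section Structure

variable {f : E3 → ImO} {X : Fin 3 → E3 → E3}

/-- The derivative of `g` along the vector field `X`. -/
def along {G : Type*} [NormedAddCommGroup G] [NormedSpace ℝ G] (X : E3 → E3) (g : E3 → G)
    (y : E3) : G := fderiv ℝ g y (X y)

theorem _root_.ContDiff.along {G : Type*} [NormedAddCommGroup G] [NormedSpace ℝ G] {X : E3 → E3}
    {g : E3 → G} (hg : ContDiff ℝ ∞ g) (hX : ContDiff ℝ ∞ X) : ContDiff ℝ ∞ (S6.along X g) :=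
  (hg.fderiv_right (m := ∞) (by simp)).clm_apply hX

/-- The images in `ImO` of the vectors of a frame. -/
def frameVec (f : E3 → ImO) (X : Fin 3 → E3 → E3) (i : Fin 3) : E3 → ImO := along (X i) f

/-- The connection coefficients of a frame. -/
def conn (f : E3 → ImO) (X : Fin 3 → E3 → E3) (l i j : Fin 3) (y : E3) : ℝ :=
  inner ℝ (along (X l) (frameVec f X i) y) (frameVec f X j y)

/-- The components of the fundamental cubic in a frame. -/
def cubic (f : E3 → ImO) (X : Fin 3 → E3 → E3) (i j k : Fin 3) (y : E3) : ℝ :=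
  inner ℝ (along (X i) (frameVec f X j) y) (cross (f y) (frameVec f X k y))

/-- The components in a frame of the difference of the canonical and Levi-Civita connections. -/
def torsion (f : E3 → ImO) (X : Fin 3 → E3 → E3) (l k m : Fin 3) (y : E3) : ℝ :=
  inner ℝ (cross (frameVec f X l y) (frameVec f X k y)) (cross (f y) (frameVec f X m y))

variable (h : LagOn f Set.univ) (hX : IsSmoothFrame f X)

include h hX

theorem LagOn.isLagFrame_frameVec (y : E3) : IsLagFrame (f y) (fun i => frameVec f X i y) :=
  h.isLagFrame trivial (hX.orth y)

theorem LagOn.contDiff_frameVec (i : Fin 3) : ContDiff ℝ ∞ (frameVec f X i) :=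
  h.contDiff.along (hX.smooth i)

theorem LagOn.contDiff_conn (l i j : Fin 3) : ContDiff ℝ ∞ (conn f X l i j) :=
  ((h.contDiff_frameVec hX i).along (hX.smooth l)).inner ℝ (h.contDiff_frameVec hX j)

theorem LagOn.contDiff_cubic (i j k : Fin 3) : ContDiff ℝ ∞ (cubic f X i j k) :=
  ((h.contDiff_frameVec hX j).along (hX.smooth i)).inner ℝ
    (h.contDiff.cross (h.contDiff_frameVec hX k))

theorem LagOn.contDiff_torsion (l k m : Fin 3) : ContDiff ℝ ∞ (torsion f X l k m) :=
  ((h.contDiff_frameVec hX l).cross (h.contDiff_frameVec hX k)).inner ℝ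
    (h.contDiff.cross (h.contDiff_frameVec hX m))

theorem LagOn.along_frameVec (l i : Fin 3) (y : E3) : along (X l) (frameVec f X i) y =
    fderiv ℝ (fderiv ℝ f) y (X l y) (X i y) + fderiv ℝ f y (fderiv ℝ (X i) y (X l y)) := by
  have hd : DifferentiableAt ℝ (X i) y := (hX.smooth i).differentiable (by simp) y
  have : fderiv ℝ (frameVec f X i) y = fderiv ℝ (fun z => (fderiv ℝ f z) (X i z)) y := rfl
  rw [along, this, fderiv_clm_apply (h.differentiableAt_fderiv trivial) hd]
  simp [add_comm]

theorem LagOn.cubic_eq (i j k : Fin 3) (y : E3) :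
    cubic f X i j k y = cub f y (X i y) (X j y) (X k y) := by
  rw [cubic, h.along_frameVec hX, inner_add_left, real_inner_comm _ (fderiv ℝ f y _)]
  have := h.isotropic y trivial (X k y) (fderiv ℝ (X j) y (X i y))
  rw [frameVec, along, this, add_zero]
  rfl

theorem LagOn.isHarmonicCubic_cubic (y : E3) : IsHarmonicCubic (fun i j k => cubic f X i j k y) := by
  simp only [h.cubic_eq hX]
  exact h.isHarmonicCubic trivial (hX.orth y)

/-- The Lie bracket of two vectors of a frame. -/
theorem LagOn.along_along_sub {G : Type*} [NormedAddCommGroup G] [NormedSpace ℝ G] {g : E3 → G}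
    (hg : ContDiff ℝ ∞ g) (l k : Fin 3) (y : E3) :
    along (X l) (along (X k) g) y - along (X k) (along (X l) g) y =
      ∑ m, (conn f X l k m y - conn f X k l m y) • along (X m) g y := by
  have hd (i) : DifferentiableAt ℝ (X i) y := (hX.smooth i).differentiable (by simp) y
  have hg1 : DifferentiableAt ℝ (fderiv ℝ g) y :=
    (hg.fderiv_right (m := ∞) (by simp)).differentiable (by simp) y
  have e (l k) : along (X l) (along (X k) g) y =
      fderiv ℝ (fderiv ℝ g) y (X l y) (X k y) + fderiv ℝ g y (fderiv ℝ (X k) y (X l y)) := by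
    have : fderiv ℝ (along (X k) g) y = fderiv ℝ (fun z => (fderiv ℝ g z) (X k z)) y := rfl
    rw [along, this, fderiv_clm_apply hg1 (hd k)]
    simp [add_comm]
  have hs : fderiv ℝ (fderiv ℝ g) y (X l y) (X k y) = fderiv ℝ (fderiv ℝ g) y (X k y) (X l y) :=
    (hg.contDiffAt (x := y)).isSymmSndFDerivAt
      (by simpa using (WithTop.coe_le_coe.mpr le_top : ((2 : ℕ∞) : WithTop ℕ∞) ≤ ∞)) _ _
  set V := fderiv ℝ (X k) y (X l y) - fderiv ℝ (X l) y (X k y) with hV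
  obtain ⟨a, ha⟩ := exists_eq_sum (hX.orth y) V
  have hm (m) : conn f X l k m y - conn f X k l m y = a m := by
    rw [conn, conn, ← inner_sub_left, h.along_frameVec hX, h.along_frameVec hX,
      h.hess_symm trivial (X l y), add_sub_add_left_eq_sub, ← map_sub, ← hV, ha]
    exact (met_comm _ _ _ _).trans (met_sum_right (hX.orth y) a m)
  rw [e, e, hs, add_sub_add_left_eq_sub, ← map_sub, ← hV, ha, map_sum]
  exact Finset.sum_congr rfl fun m _ => by rw [hm, map_smul]; rfl

theorem LagOn.conn_antisymm (l i j : Fin 3) (y : E3) : conn f X l i j y = -conn f X l j i y := by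
  have h1 := fderiv_eq_zero_of_eq_on isOpen_univ
    (g := fun z => (inner ℝ (frameVec f X i z) (frameVec f X j z) : ℝ))
    (fun z _ => hX.orth z i j) (Set.mem_univ y)
  have h2 := congrArg (fun T => T (X l y)) h1
  have hd (i) : DifferentiableAt ℝ (frameVec f X i) y :=
    (h.contDiff_frameVec hX i).differentiable (by simp) y
  rw [fderiv_inner_apply ℝ (hd i) (hd j)] at h2
  rw [conn, conn, real_inner_comm (frameVec f X i y)]
  simp only [along] at *
  simp only [zero_apply] at h2
  linarith

/-- The Codazzi equation. -/
theorem LagOn.codazzi (l i j k : Fin 3) (y : E3) :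
    along (X l) (cubic f X i j k) y - along (X i) (cubic f X l j k) y =
      ∑ m, ((conn f X l i m y - conn f X i l m y) * cubic f X m j k y
        - conn f X i j m y * cubic f X l m k y + conn f X l j m y * cubic f X i m k y
        + cubic f X i j m y * (torsion f X l k m y + conn f X l k m y)
        - cubic f X l j m y * (torsion f X i k m y + conn f X i k m y)) := by
  have hF (i) := h.contDiff_frameVec hX i
  have hdF (i) : DifferentiableAt ℝ (frameVec f X i) y := (hF i).differentiable (by simp) y
  have hN (k) : ContDiff ℝ ∞ fun z => cross (f z) (frameVec f X k z) := h.contDiff.cross (hF k)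
  have e1 (l i) : along (X l) (cubic f X i j k) y =
      inner ℝ (along (X l) (along (X i) (frameVec f X j)) y) (cross (f y) (frameVec f X k y)) +
      inner ℝ (along (X i) (frameVec f X j) y)
        (along (X l) (fun z => cross (f z) (frameVec f X k z)) y) := by
    have : fderiv ℝ (cubic f X i j k) y = fderiv ℝ (fun z => (inner ℝ
      (along (X i) (frameVec f X j) z) (cross (f z) (frameVec f X k z)) : ℝ)) y := rfl
    rw [along, this, fderiv_inner_apply ℝ (((hF j).along (hX.smooth i)).differentiable (by simp) y)
      ((hN k).differentiable (by simp) y), add_comm]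
    rfl
  have fr := h.isLagFrame_frameVec hX y
  -- J depends on the base point, so its derivative contributes Fₗ × Fₖ; this is the origin of the
  -- `torsion` terms.
  have dN (l k) : along (X l) (fun z => cross (f z) (frameVec f X k z)) y =
      cross (f y) (along (X l) (frameVec f X k) y) + cross (frameVec f X l y) (frameVec f X k y) :=
    fderiv_cross_apply (h.differentiableAt trivial) (hdF k) _
  have n0 (l k) :
      inner ℝ (f y) (along (X l) (fun z => cross (f z) (frameVec f X k z)) y) = (0 : ℝ) := by
    rw [dN, inner_add_right, real_inner_comm (cross (f y) _), inner_cross_self_left,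
      ← inner_cross_cyclic, fr.isotropic, add_zero]
  have n1 (l k m) : inner ℝ (frameVec f X m y)
      (along (X l) (fun z => cross (f z) (frameVec f X k z)) y) = -cubic f X l m k y := by
    have h1 := fderiv_eq_zero_of_eq_on isOpen_univ
      (g := fun z => (inner ℝ (frameVec f X m z) (cross (f z) (frameVec f X k z)) : ℝ))
      (fun z _ => (real_inner_comm _ _).trans ((h.isLagFrame_frameVec hX z).isotropic k m))
      (Set.mem_univ y)
    have h2 := congrArg (fun T => T (X l y)) h1
    rw [fderiv_inner_apply ℝ (hdF m) ((hN k).differentiable (by simp) y)] at h2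
    simp only [zero_apply] at h2
    rw [cubic]
    simp only [along] at *
    linarith
  have n2 (l k m) : inner ℝ (cross (f y) (frameVec f X m y))
      (along (X l) (fun z => cross (f z) (frameVec f X k z)) y) =
      torsion f X l k m y + conn f X l k m y := by
    rw [dN, inner_add_right, inner_cross_cross, fr.base, fr.tangent, zero_mul, sub_zero, one_mul,
      add_comm, real_inner_comm, real_inner_comm _ (frameVec f X m y)]
    rfl
  have e2 (l i) : inner ℝ (along (X i) (frameVec f X j) y)
        (along (X l) (fun z => cross (f z) (frameVec f X k z)) y) =
      ∑ m, (-(conn f X i j m y * cubic f X l m k y)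
        + cubic f X i j m y * (torsion f X l k m y + conn f X l k m y)) := by
    rw [fr.inner_eq, n0, mul_zero, zero_add, ← Finset.sum_add_distrib]
    exact Finset.sum_congr rfl fun m _ => by
      rw [n1, n2, real_inner_comm, real_inner_comm _ (cross (f y) _)]; simp only [conn, cubic]; ring
  have e3 := congrArg (fun v => (inner ℝ v (cross (f y) (frameVec f X k y)) : ℝ))
    (h.along_along_sub hX (hF j) l i y)
  simp only [inner_sub_left, sum_inner, inner_smul_left, conj_trivial] at e3
  rw [e1, e1, e2, e2, add_sub_add_comm, e3, ← Finset.sum_sub_distrib, ← Finset.sum_add_distrib]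
  exact Finset.sum_congr rfl fun m _ => by simp only [cubic]; ring

end Structure

-- In dimension three E is a multiple of the volume form, and the identity can be checked on
-- components. It absorbs the torsion terms of `LagOn.codazzi` into the connection `conn + torsion /
-- 4`, for which C becomes a genuine Codazzi tensor.
set_option maxHeartbeats 1000000 in
theorem skew_contraction {c E : Fin 3 → Fin 3 → Fin 3 → ℝ} (hc : IsHarmonicCubic c)
    (h₁₂ : ∀ l k m, E l k m = -E k l m) (h₂₃ : ∀ l k m, E l k m = -E l m k) (l i j k : Fin 3) :
    ∑ m, (c i j m * E l k m - c l j m * E i k m) =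
      1 / 4 * (act (E l) c i j k - act (E i) c l j k) := by
  have z1 (l m) : E l l m = 0 := by linarith [h₁₂ l l m]
  have z2 (l m) : E l m m = 0 := by linarith [h₂₃ l m m]
  have z3 (l m) : E l m l = 0 := by rw [h₂₃, z1, neg_zero]
  have e1 : E 0 2 1 = -E 0 1 2 := h₂₃ _ _ _
  have e2 : E 1 0 2 = -E 0 1 2 := h₁₂ _ _ _
  have e3 : E 1 2 0 = E 0 1 2 := by rw [h₂₃, e2, neg_neg]
  have e4 : E 2 0 1 = E 0 1 2 := by rw [h₁₂, e1, neg_neg]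
  have e5 : E 2 1 0 = -E 0 1 2 := by rw [h₂₃, e4]
  have c1 := hc.symm₁₂
  have c2 := hc.symm₂₃
  have t0 := hc.trace 0
  have t1 := hc.trace 1
  have t2 := hc.trace 2
  simp only [Fin.sum_univ_three, c1 1 0, c1 2 0, c1 2 1, c2 _ 1 0, c2 _ 2 0, c2 _ 2 1] at t0 t1 t2
  have t0' : c 0 2 2 = -(c 0 0 0 + c 0 1 1) := by linarith
  have t1' : c 1 2 2 = -(c 0 0 1 + c 1 1 1) := by linarith
  have t2' : c 2 2 2 = -(c 0 0 2 + c 1 1 2) := by linarith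
  have key (l i) (hli : l < i) : ∑ m, (c i j m * E l k m - c l j m * E i k m) =
      1 / 4 * (act (E l) c i j k - act (E i) c l j k) := by
    fin_cases l <;> fin_cases i <;> first
    | exact absurd hli (by decide)
    | fin_cases j <;> fin_cases k <;>
      simp only [Fin.mk_zero, Fin.mk_one, Fin.reduceFinMk, act, Fin.sum_univ_three, z1, z2, z3, e1,
        e2, e3, e4, e5, c1 1 0, c1 2 0, c1 2 1, c2 _ 1 0, c2 _ 2 0, c2 _ 2 1, t0', t1', t2'] <;>
      ring
  rcases lt_trichotomy l i with hli | rfl | hli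
  · exact key l i hli
  · simp
  · have h1 := key i l hli
    rw [Finset.sum_sub_distrib] at h1 ⊢
    linarith

/-! ### Smooth functions and vector fields as a ring with derivations -/

/-- The algebra of smooth functions on `ℝ³`. -/
def smoothFun : Subalgebra ℝ (E3 → ℝ) where
  carrier := {g | ContDiff ℝ ∞ g}
  mul_mem' {a b} (ha : ContDiff ℝ ∞ a) (hb : ContDiff ℝ ∞ b) := (ha.mul hb : ContDiff ℝ ∞ (a * b))
  add_mem' {a b} (ha : ContDiff ℝ ∞ a) (hb : ContDiff ℝ ∞ b) := (ha.add hb : ContDiff ℝ ∞ (a + b))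
  algebraMap_mem' r := (contDiff_const : ContDiff ℝ ∞ fun _ : E3 => r)

theorem contDiff_smoothFun (a : smoothFun) : ContDiff ℝ ∞ a.1 := a.2

/-- The derivation of the algebra of smooth functions given by a smooth vector field. -/
def vecDeriv {X : E3 → E3} (hX : ContDiff ℝ ∞ X) : Derivation ℝ smoothFun smoothFun :=
  Derivation.mk'
    { toFun := fun g => ⟨along X g.1, (contDiff_smoothFun g).along hX⟩
      map_add' := fun a b => Subtype.ext <| funext fun y => by
        have ha := (contDiff_smoothFun a).differentiable (by simp) y
        have hb := (contDiff_smoothFun b).differentiable (by simp) y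
        change fderiv ℝ (a.1 + b.1) y (X y) = fderiv ℝ a.1 y (X y) + fderiv ℝ b.1 y (X y)
        rw [fderiv_add ha hb]; rfl
      map_smul' := fun r a => Subtype.ext <| funext fun y => by
        have ha := (contDiff_smoothFun a).differentiable (by simp) y
        change fderiv ℝ (r • a.1) y (X y) = r • fderiv ℝ a.1 y (X y)
        rw [fderiv_const_smul ha]; rfl }
    fun a b => Subtype.ext <| funext fun y => by
      have ha := (contDiff_smoothFun a).differentiable (by simp) y
      have hb := (contDiff_smoothFun b).differentiable (by simp) y
      change fderiv ℝ (a.1 * b.1) y (X y) =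
        a.1 y * fderiv ℝ b.1 y (X y) + b.1 y * fderiv ℝ a.1 y (X y)
      rw [fderiv_mul ha hb]; rfl

/-- The value of a smooth function at a point. -/
def evalAt (y : E3) : smoothFun →+* ℝ := (Pi.evalRingHom (fun _ : E3 => ℝ) y).comp
  smoothFun.val.toRingHom

theorem map_act {R S : Type*} [CommRing R] [CommRing S] (e : R →+* S) (γ : Fin 3 → Fin 3 → R)
    (c : Fin 3 → Fin 3 → Fin 3 → R) (i j k : Fin 3) :
    e (act γ c i j k) = act (fun a b => e (γ a b)) (fun a b d => e (c a b d)) i j k := by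
  simp only [act, map_sum, map_add, map_mul]

theorem map_pair {R S : Type*} [CommRing R] [CommRing S] (e : R →+* S)
    (a b : Fin 3 → Fin 3 → Fin 3 → R) :
    e (pair a b) = pair (fun i j k => e (a i j k)) (fun i j k => e (b i j k)) := by
  simp only [pair, map_sum, map_mul]

theorem map_commOp {R S : Type*} [CommRing R] [CommRing S] (e : R →+* S)
    (τ Γ : Fin 3 → Fin 3 → Fin 3 → R) (dΓ : Fin 3 → Fin 3 → Fin 3 → Fin 3 → R)
    (c : Fin 3 → Fin 3 → Fin 3 → R) (l k i j n : Fin 3) :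
    e (commOp τ Γ dΓ c l k i j n) =
      commOp (fun a b d => e (τ a b d)) (fun a b d => e (Γ a b d))
        (fun a b d m => e (dΓ a b d m)) (fun a b d => e (c a b d)) l k i j n := by
  simp only [commOp, map_act, map_sum, map_add, map_mul, map_sub]

/-! ### Differential inequalities for |C|² -/

section Inequality

variable {f : E3 → ImO} {X : Fin 3 → E3 → E3}

theorem torsion_swap₁₂ (l k m : Fin 3) (y : E3) : torsion f X l k m y = -torsion f X k l m y := by
  rw [torsion, cross_antisymm, inner_neg_left]; rfl

/-- The squared norm of the fundamental cubic in a frame. -/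
def cubicNormSq (f : E3 → ImO) (X : Fin 3 → E3 → E3) (y : E3) : ℝ :=
  pair (fun i j k => cubic f X i j k y) (fun i j k => cubic f X i j k y)

/-- The Laplace-type operator of a frame. -/
def frameLaplacian (f : E3 → ImO) (X : Fin 3 → E3 → E3) (g : E3 → ℝ) (y : E3) : ℝ :=
  ∑ l, (along (X l) (along (X l) g) y
    - ∑ m, (conn f X l l m y + 1 / 4 * torsion f X l l m y) * along (X m) g y)

theorem exists_continuous_bound {ι : Type*} [Fintype ι] (g : ι → smoothFun) :
    ∃ B : E3 → ℝ, Continuous B ∧ ∀ y i, |evalAt y (g i)| ≤ B y :=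
  ⟨fun y => ∑ i, |(g i).1 y|, continuous_finsetSum _ fun i _ =>
    (contDiff_smoothFun (g i)).continuous.abs, fun y i =>
    Finset.single_le_sum (f := fun i => |(g i).1 y|) (fun _ _ => abs_nonneg _) (Finset.mem_univ i)⟩

variable (h : LagOn f Set.univ) (hX : IsSmoothFrame f X)

include h hX

theorem LagOn.torsion_swap₂₃ (l k m : Fin 3) (y : E3) :
    torsion f X l k m y = -torsion f X l m k y :=
  (h.isLagFrame_frameVec hX y).inner_cross_cross_base_swap l k m

theorem LagOn.contDiff_cubicNormSq : ContDiff ℝ ∞ (cubicNormSq f X) := by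
  unfold cubicNormSq pair
  exact ContDiff.sum fun i _ => ContDiff.sum fun j _ => ContDiff.sum fun k _ =>
    (h.contDiff_cubic hX i j k).mul (h.contDiff_cubic hX i j k)

-- With A = |C|², the first bound is the Bochner formula with |∇C|² discarded. The second combines
-- it with the Kato inequality |∇A|² ≤ 2A|∇C|²; where A > 0 it is A² times a lower bound for the
-- operator applied to log A.
set_option maxHeartbeats 1000000 in
theorem LagOn.exists_laplacian_bound
    (hn : ∀ y, HasNullVector fun i j k => cubic f X i j k y) :
    ∃ K : E3 → ℝ, Continuous K ∧ ∀ y,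
      -(K y * cubicNormSq f X y) ≤ frameLaplacian f X (cubicNormSq f X) y ∧
      -(K y * cubicNormSq f X y ^ 2) ≤
        cubicNormSq f X y * frameLaplacian f X (cubicNormSq f X) y -
          ∑ l, along (X l) (cubicNormSq f X) y ^ 2 := by
  let D : Fin 3 → Derivation ℝ smoothFun smoothFun := fun l => vecDeriv (hX.smooth l)
  let c : Fin 3 → Fin 3 → Fin 3 → smoothFun := fun i j k => ⟨_, h.contDiff_cubic hX i j k⟩
  let Γ₀ : Fin 3 → Fin 3 → Fin 3 → smoothFun := fun i j k => ⟨_, h.contDiff_conn hX i j k⟩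
  let E : Fin 3 → Fin 3 → Fin 3 → smoothFun := fun i j k => ⟨_, h.contDiff_torsion hX i j k⟩
  -- The factor 1/4 is the one found in `skew_contraction`. The connection Γ₀ + E/4 has torsion E/2,
  -- which is again totally skew, as `bochner` requires.
  let q : smoothFun := algebraMap ℝ _ (1 / 4)
  let Γ : Fin 3 → Fin 3 → Fin 3 → smoothFun := fun i j k => Γ₀ i j k + q * E i j k
  let t : Fin 3 → Fin 3 → Fin 3 → smoothFun := fun i j k => 2 * q * E i j k
  let τ : Fin 3 → Fin 3 → Fin 3 → smoothFun := fun l k m => Γ₀ l k m - Γ₀ k l m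
  have ext' {a b : smoothFun} (hab : ∀ y, evalAt y a = evalAt y b) : a = b :=
    Subtype.ext (funext hab)
  have hE₁₂ (l k m) : E l k m = -E k l m := ext' fun y => torsion_swap₁₂ l k m y
  have hE₂₃ (l k m) : E l k m = -E l m k := ext' fun y => h.torsion_swap₂₃ hX l k m y
  have hE0 (l i) : E l i i = 0 := ext' fun y => by
    have : evalAt y (E l i i) = - evalAt y (E l i i) := h.torsion_swap₂₃ hX l i i y
    rw [map_zero]; linarith
  have hE0' (l i) : E l l i = 0 := ext' fun y => by
    have : evalAt y (E l l i) = - evalAt y (E l l i) := torsion_swap₁₂ l l i y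
    rw [map_zero]; linarith
  have hΓ₀ (l i j) : Γ₀ l i j = -Γ₀ l j i := ext' fun y => h.conn_antisymm hX l i j y
  have hΓ₀0 (l i) : Γ₀ l i i = 0 := ext' fun y => by
    have : evalAt y (Γ₀ l i i) = - evalAt y (Γ₀ l i i) := h.conn_antisymm hX l i i y
    rw [map_zero]; linarith
  have hΓ (l i j) : Γ l i j = -Γ l j i := by
    simp only [Γ]; rw [hE₂₃ l i j, hΓ₀ l i j]; ring
  have hΓ0 (l i) : Γ l i i = 0 := by simp only [Γ, hE0, hΓ₀0]; ring
  have hc (y) : IsHarmonicCubic (fun i j k => evalAt y (c i j k)) := h.isHarmonicCubic_cubic hX y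
  have hc₁₂ (i j k) : c i j k = c j i k := ext' fun y => (hc y).symm₁₂ i j k
  have hc₂₃ (i j k) : c i j k = c i k j := ext' fun y => (hc y).symm₂₃ i j k
  have htr (k) : ∑ i, c i i k = 0 := ext' fun y => by
    rw [map_sum, map_zero]; exact (hc y).trace k
  have hbr (l k g) : D l (D k g) - D k (D l g) = ∑ m, τ l k m * D m g := ext' fun y => by
    rw [map_sub, map_sum]
    simp only [map_mul]
    exact h.along_along_sub hX g.2 l k y
  have hτ (l k m) : τ l k m = Γ l k m - Γ k l m - t l k m := by
    simp only [τ, Γ, t]; rw [hE₁₂ k l m]; ring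
  have ht (l k m) : t l k m = -t m k l := by
    simp only [t]; rw [hE₁₂ l k m, hE₂₃ k l m, hE₁₂ k m l]; ring
  have ht0 (l k) : t l k l = 0 := by
    simp only [t]; rw [hE₂₃, hE0']; ring
  have hev (y l i j k) : evalAt y (covD D Γ c l i j k) = along (X l) (cubic f X i j k) y -
      act (fun a b => conn f X l a b y + 1 / 4 * torsion f X l a b y)
        (fun i j k => cubic f X i j k y) i j k := by
    rw [covD, map_sub, map_act]; rfl
  have hT (l i j k) : covD D Γ c l i j k = covD D Γ c i l j k := ext' fun y => by
    rw [hev, hev]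
    have h1 := h.codazzi hX l i j k y
    have h2 := skew_contraction (hc y) (fun l k m => torsion_swap₁₂ (f := f) (X := X) l k m y)
      (fun l k m => h.torsion_swap₂₃ hX l k m y) l i j k
    change ∑ m, (cubic f X i j m y * torsion f X l k m y - cubic f X l j m y * torsion f X i k m y) =
      1 / 4 * (act (fun a b => torsion f X l a b y) (fun i j k => cubic f X i j k y) i j k -
        act (fun a b => torsion f X i a b y) (fun i j k => cubic f X i j k y) l j k) at h2
    simp only [act, Fin.sum_univ_three] at h1 h2 ⊢
    linarith
  have hboch := bochner hΓ hΓ0 hbr hτ ht ht0 hc₁₂ hc₂₃ htr hT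
  obtain ⟨B₁, hB₁, hB₁'⟩ := exists_continuous_bound fun a : Fin 3 × Fin 3 × Fin 3 =>
    τ a.1 a.2.1 a.2.2
  obtain ⟨B₂, hB₂, hB₂'⟩ := exists_continuous_bound fun a : Fin 3 × Fin 3 × Fin 3 =>
    Γ a.1 a.2.1 a.2.2
  obtain ⟨B₃, hB₃, hB₃'⟩ := exists_continuous_bound fun a : Fin 3 × Fin 3 × Fin 3 × Fin 3 =>
    D a.1 (Γ a.2.1 a.2.2.1 a.2.2.2)
  let B : E3 → ℝ := fun y => B₁ y + B₂ y + B₃ y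
  have hB : Continuous B := (hB₁.add hB₂).add hB₃
  refine ⟨fun y => 2 * (81 * (189 * B y ^ 2 + 18 * B y)), by fun_prop, fun y => ?_⟩
  have p₁ := (abs_nonneg _).trans (hB₁' y (0, 0, 0))
  have p₂ := (abs_nonneg _).trans (hB₂' y (0, 0, 0))
  have p₃ := (abs_nonneg _).trans (hB₃' y (0, 0, 0, 0))
  have hA : pair c c = (⟨cubicNormSq f X, h.contDiff_cubicNormSq hX⟩ : smoothFun) := ext' fun y => by
    rw [map_pair]; rfl
  set cy : Fin 3 → Fin 3 → Fin 3 → ℝ := fun i j k => evalAt y (c i j k) with hcy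
  set Ty : Fin 3 → Fin 3 → Fin 3 → Fin 3 → ℝ := fun l i j k => evalAt y (covD D Γ c l i j k)
    with hTy
  have hAy : cubicNormSq f X y = pair cy cy := rfl
  have hZ := abs_pair_commOp_le (τ := fun a b d => evalAt y (τ a b d))
    (Γ := fun a b d => evalAt y (Γ a b d))
    (dΓ := fun a b d e => evalAt y (D a (Γ b d e))) cy (B := B y)
    (fun i j k => (hB₁' y (i, j, k)).trans (by simp only [B]; linarith))
    (fun i j k => (hB₂' y (i, j, k)).trans (by simp only [B]; linarith))
    (fun l i j k => (hB₃' y (l, i, j, k)).trans (by simp only [B]; linarith))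
  have hL := congrArg (evalAt y) hboch
  simp only [map_add, map_mul, map_sum, map_sub, map_commOp, map_pair, map_ofNat] at hL
  rw [hA] at hL
  change frameLaplacian f X (cubicNormSq f X) y = 2 * ∑ l, pair (Ty l) (Ty l) + 2 * ∑ i, ∑ j, ∑ k,
    cy i j k * ∑ l, commOp (fun a b d => evalAt y (τ a b d)) (fun a b d => evalAt y (Γ a b d))
        (fun a b d e => evalAt y (D a (Γ b d e))) cy l k i j l at hL
  have hTh (l) : IsHarmonicCubic (Ty l) :=
    ⟨fun i j k => congrArg (evalAt y) (covD_symm₁₂ hc₁₂ l i j k),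
    fun i j k => congrArg (evalAt y) (covD_symm₂₃ hc₂₃ l i j k),
    fun k => by simp only [Ty, ← map_sum, covD_trace hΓ hΓ0 hc₁₂ htr, map_zero]⟩
  have hK : ∑ l, pair cy (Ty l) ^ 2 ≤ 1 / 2 * pair cy cy * ∑ l, pair (Ty l) (Ty l) := by
    by_cases h0 : pair cy cy = 0
    · have hz (i j k) : cy i j k = 0 := by
        have := sq_le_pair cy i j k
        rw [h0] at this
        exact pow_eq_zero_iff two_ne_zero |>.1 (le_antisymm this (sq_nonneg _))
      simp [pair, hz]
    · obtain ⟨α, β, hαβ⟩ := (hc y).exists_crossProduct_ne_zero h0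
      -- The columns α, β are chosen independent at y. Their cross product is smooth and null
      -- everywhere, but is known to be nonzero only at y, which suffices.
      let n : Fin 3 → smoothFun :=
        crossProduct (fun i => c i α.1 α.2) (fun i => c i β.1 β.2)
      have hny (z i) : evalAt z (n i) = crossProduct (fun i => evalAt z (c i α.1 α.2))
          (fun i => evalAt z (c i β.1 β.2)) i := by
        simp only [n, cross_apply]
        fin_cases i <;> simp
      have hnc (j k) : ∑ i, n i * c i j k = 0 := ext' fun z => by
        obtain ⟨m, hm, hm'⟩ := hn z
        simp only [map_sum, map_mul, map_zero, hny]
        exact det_of_null hm (hm' _ _) (hm' _ _) (hm' j k)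
      refine kato (hc y) (n := fun i => evalAt y (n i)) (fun h0 => hαβ ?_) (fun j k => ?_) hTh
        (fun l i j k => congrArg (evalAt y) (hT l i j k)) fun j k => ?_
      · rw [← h0]; exact funext fun i => (hny y i).symm
      · have := congrArg (evalAt y) (hnc j k)
        simpa only [map_sum, map_mul, map_zero] using this
      · have := congrArg (evalAt y) (covD_null (D := D) (Γ := Γ) hc₁₂ hnc j k)
        simp only [map_sum, map_mul, map_zero] at this
        rw [← this]
        refine Finset.sum_congr rfl fun l _ => Finset.sum_congr rfl fun i _ => ?_
        rw [show Ty l i j k = evalAt y (covD D Γ c j l i k) from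
          congrArg (evalAt y) ((covD_symm₁₂ hc₁₂ l i j k).trans (hT l j i k))]
  have hD (l) : along (X l) (cubicNormSq f X) y = 2 * pair cy (Ty l) := by
    have h1 : evalAt y (D l (pair c c)) = along (X l) (cubicNormSq f X) y := by rw [hA]; rfl
    rw [← h1, pair_self_deriv hΓ hΓ0, map_add, map_pair, map_pair]
    change pair (Ty l) cy + pair cy (Ty l) = _
    rw [show pair (Ty l) cy = pair cy (Ty l) by simp only [pair, mul_comm]]
    ring
  have hS : 0 ≤ ∑ l, pair (Ty l) (Ty l) := Finset.sum_nonneg fun l _ => pair_self_nonneg _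
  have ha := pair_self_nonneg cy
  simp only [hD, mul_pow, ← Finset.mul_sum]
  rw [hAy, hL]
  have hZ1 := (abs_le.1 hZ).1
  have hZ2 := mul_le_mul_of_nonneg_left hZ1 ha
  generalize (∑ i, ∑ j, ∑ k, cy i j k * ∑ l, commOp (fun a b d => evalAt y (τ a b d))
    (fun a b d => evalAt y (Γ a b d)) (fun a b d e => evalAt y (D a (Γ b d e))) cy l k i j l) = Z
    at hZ1 hZ2 ⊢
  generalize 81 * (189 * B y ^ 2 + 18 * B y) = K at hZ1 hZ2 ⊢
  generalize ∑ l, pair (Ty l) (Ty l) = S at *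
  generalize ∑ l, pair cy (Ty l) ^ 2 = U at *
  generalize pair cy cy = a at *
  constructor <;> linarith

end Inequality

/-! ### Unique continuation by a Gaussian barrier -/

section MaximumPrinciple

/-- The second derivative test at a local maximum. -/
theorem second_deriv_nonpos {v v₁ : ℝ → ℝ} {v₂ : ℝ} (h1 : ∀ᶠ t in 𝓝 0, HasDerivAt v (v₁ t) t)
    (h2 : HasDerivAt v₁ v₂ 0) (hmax : IsLocalMax v 0) : v₁ 0 = 0 ∧ v₂ ≤ 0 := by
  have h0 : v₁ 0 = 0 := hmax.hasDerivAt_eq_zero h1.self_of_nhds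
  refine ⟨h0, le_of_not_gt fun hpos => ?_⟩
  have hd : deriv v =ᶠ[𝓝 0] v₁ := h1.mono fun t ht => ht.deriv
  -- A positive second derivative would make the maximum a minimum too, so v would be locally
  -- constant and its second derivative zero.
  have hmin : IsLocalMin v 0 := isLocalMin_of_deriv_deriv_pos
    (by rwa [hd.deriv_eq, h2.deriv]) (by rw [h1.self_of_nhds.deriv, h0])
    h1.self_of_nhds.continuousAt
  have hc : v =ᶠ[𝓝 0] fun _ => v 0 := by
    filter_upwards [hmax, hmin] with t ht1 ht2 using le_antisymm ht1 ht2
  have h3 : v₁ =ᶠ[𝓝 0] fun _ => 0 := by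
    filter_upwards [hc.eventuallyEq_nhds, h1] with t ht ht1
    rw [← ht1.deriv, ht.deriv_eq, deriv_const]
  have := h2.deriv
  rw [h3.deriv_eq, deriv_const] at this
  exact hpos.ne this

/-- The second derivative test for `log a + M b`. -/
theorem log_add_second_deriv {a a₁ b b₁ : ℝ → ℝ} {a₂ b₂ M : ℝ} (ha : ∀ t, HasDerivAt a (a₁ t) t)
    (ha' : HasDerivAt a₁ a₂ 0) (hb : ∀ t, HasDerivAt b (b₁ t) t) (hb' : HasDerivAt b₁ b₂ 0)
    (hpos : ∀ t, 0 < a t) (hmax : IsLocalMax (fun t => Real.log (a t) + M * b t) 0) :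
    a₁ 0 / a 0 + M * b₁ 0 = 0 ∧ a₂ / a 0 - (a₁ 0 / a 0) ^ 2 + M * b₂ ≤ 0 := by
  refine second_deriv_nonpos (v₁ := fun t => a₁ t / a t + M * b₁ t)
    (.of_forall fun t => ((ha t).log (hpos t).ne').add ((hb t).const_mul M)) ?_ hmax
  have h0 := (hpos 0).ne'
  have := (ha'.div (ha 0) h0).add (hb'.const_mul M)
  refine this.congr_deriv ?_
  field_simp

variable {A : E3 → ℝ} (hA : ContDiff ℝ ∞ A)

include hA in
theorem hasDerivAt_line (y w : E3) (t : ℝ) :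
    HasDerivAt (fun s : ℝ => A (y + s • w)) (fderiv ℝ A (y + t • w) w) t := by
  have h1 : HasDerivAt (fun s : ℝ => y + s • w) w t := by
    simpa using ((hasDerivAt_id t).smul_const w).const_add y
  exact (hA.differentiable (by simp) _).hasFDerivAt.comp_hasDerivAt t h1

include hA in
theorem hasDerivAt_line_fderiv (y w : E3) :
    HasDerivAt (fun s : ℝ => fderiv ℝ A (y + s • w) w) (fderiv ℝ (fderiv ℝ A) y w w) 0 := by
  have h1 : ContDiff ℝ ∞ fun z => fderiv ℝ A z w :=
    (hA.fderiv_right (m := ∞) (by simp)).clm_apply contDiff_const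
  refine (hasDerivAt_line h1 y w 0).congr_deriv ?_
  rw [zero_smul, add_zero, fderiv_clm_apply
    ((hA.fderiv_right (m := ∞) (by simp)).differentiable (by simp) _) (differentiableAt_const w)]
  simp

theorem hasDerivAt_gaussian_line (α e : ℝ) (w₀ w : E3) (t : ℝ) :
    HasDerivAt (fun s : ℝ => Real.exp (-α * ‖w₀ + s • w‖ ^ 2) - e)
      (-2 * α * (inner ℝ w₀ w + t * ‖w‖ ^ 2) * Real.exp (-α * ‖w₀ + t • w‖ ^ 2)) t := by
  have e1 (s : ℝ) : ‖w₀ + s • w‖ ^ 2 = ‖w₀‖ ^ 2 + 2 * (s * inner ℝ w₀ w) + s ^ 2 * ‖w‖ ^ 2 := by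
    rw [norm_add_sq_real, inner_smul_right, norm_smul, mul_pow, Real.norm_eq_abs, sq_abs]
  simp only [e1]
  have h1 : HasDerivAt (fun s : ℝ => -α * (‖w₀‖ ^ 2 + 2 * (s * inner ℝ w₀ w) + s ^ 2 * ‖w‖ ^ 2))
      (-α * (2 * inner ℝ w₀ w + 2 * t * ‖w‖ ^ 2)) t := by
    refine HasDerivAt.const_mul _ ?_
    have h2 := (((hasDerivAt_id t).mul_const (inner ℝ w₀ w)).const_mul 2).const_add (‖w₀‖ ^ 2)
    have h3 := ((hasDerivAt_id t).pow 2).mul_const (‖w‖ ^ 2)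
    refine (h2.add h3).congr_deriv ?_
    simp
  refine (h1.exp.sub_const e).congr_deriv ?_
  ring

theorem hasDerivAt_gaussian_line_deriv (α : ℝ) (w₀ w : E3) :
    HasDerivAt (fun t : ℝ => -2 * α * (inner ℝ w₀ w + t * ‖w‖ ^ 2) *
        Real.exp (-α * ‖w₀ + t • w‖ ^ 2))
      ((4 * α ^ 2 * inner ℝ w₀ w ^ 2 - 2 * α * ‖w‖ ^ 2) * Real.exp (-α * ‖w₀‖ ^ 2)) 0 := by
  have h1 := hasDerivAt_gaussian_line α 0 w₀ w 0
  simp only [sub_zero] at h1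
  have h2 := (((hasDerivAt_id (0 : ℝ)).mul_const (‖w‖ ^ 2)).const_add
    (inner ℝ w₀ w)).const_mul (-2 * α)
  refine (h2.mul h1).congr_deriv ?_
  simp
  ring

variable {X : Fin 3 → E3 → E3} {β : E3 → E3} {K : E3 → ℝ}

/-- An interior maximum of `log (A + ε) + M η` with a Gaussian barrier `η` bounds `M`. -/
theorem barrier_le (hA0 : ∀ y, 0 ≤ A y) {y q : E3} {α e M ε : ℝ} (hε : 0 < ε) (hK : 0 ≤ K y)
    (h1 : -(K y * A y) ≤ ∑ l, fderiv ℝ (fderiv ℝ A) y (X l y) (X l y) + fderiv ℝ A y (β y))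
    (h2 : -(K y * A y ^ 2) ≤
      A y * (∑ l, fderiv ℝ (fderiv ℝ A) y (X l y) (X l y) + fderiv ℝ A y (β y)) -
        ∑ l, fderiv ℝ A y (X l y) ^ 2)
    (hA : ContDiff ℝ ∞ A)
    (hmax : IsLocalMax (fun z => Real.log (A z + ε) + M * (Real.exp (-α * ‖z - q‖ ^ 2) - e)) y) :
    M * ((4 * α ^ 2 * ∑ l, inner ℝ (y - q) (X l y) ^ 2 -
      2 * α * (∑ l, ‖X l y‖ ^ 2 + inner ℝ (y - q) (β y))) * Real.exp (-α * ‖y - q‖ ^ 2)) ≤ K y := by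
  have key (w : E3) := log_add_second_deriv (M := M) (a := fun t : ℝ => A (y + t • w) + ε)
    (b := fun t : ℝ => Real.exp (-α * ‖(y - q) + t • w‖ ^ 2) - e)
    (fun t => (hasDerivAt_line hA y w t).add_const ε) (hasDerivAt_line_fderiv hA y w)
    (fun t => hasDerivAt_gaussian_line α e (y - q) w t)
    (hasDerivAt_gaussian_line_deriv α (y - q) w)
    (fun t => add_pos_of_nonneg_of_pos (hA0 _) hε) (by
      have hc : ContinuousAt (fun t : ℝ => y + t • w) 0 := by fun_prop
      have := hmax
      rw [show y = (fun t : ℝ => y + t • w) 0 by simp] at this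
      have h3 := IsLocalMax.comp_continuous (g := fun t : ℝ => y + t • w) this hc
      simp only [Function.comp_def, add_sub_right_comm _ _ q] at h3
      exact h3)
  set a := A y + ε with ha
  have hapos : 0 < a := add_pos_of_nonneg_of_pos (hA0 _) hε
  simp only [zero_smul, add_zero, zero_mul] at key
  rw [← ha] at key
  set G := Real.exp (-α * ‖y - q‖ ^ 2)
  -- The drift direction β enters through the first order condition, the directions Xₗ through the
  -- second order one.
  have hβ := (key (β y)).1
  have hs := Finset.sum_nonpos fun l (_ : l ∈ Finset.univ) => (key (X l y)).2
  simp only [Finset.sum_add_distrib, Finset.sum_sub_distrib, ← Finset.mul_sum, ← Finset.sum_mul,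
    div_pow, ← Finset.sum_div] at hs
  generalize ∑ l, fderiv ℝ (fderiv ℝ A) y (X l y) (X l y) = S at *
  generalize ∑ l, fderiv ℝ A y (X l y) ^ 2 = U at *
  generalize fderiv ℝ A y (β y) = b at *
  -- This is L log (A + ε) ≥ −K for L = ∑ D²(Xₗ,Xₗ) + D(β): `h2` handles the part of order A², and ε
  -- times `h1` the part of order εA, with A² + εA ≤ (A + ε)².
  have h3 : -K y ≤ S / a - U / a ^ 2 + b / a := by
    have : S / a - U / a ^ 2 + b / a = (A y * (S + b) - U + ε * (S + b)) / a ^ 2 := by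
      rw [ha]; field_simp; ring
    rw [this, le_div_iff₀ (by positivity)]
    have h4 := mul_le_mul_of_nonneg_left h1 hε.le
    have h5 := mul_nonneg hK (mul_nonneg hε.le (hA0 y))
    have h6 := mul_nonneg hK (sq_nonneg ε)
    rw [ha]
    nlinarith
  linarith

theorem exp_neg_mul_sq_lt {α s R : ℝ} (hα : 0 < α) (hs : 0 ≤ s) (hsR : s < R) :
    Real.exp (-α * R ^ 2) < Real.exp (-α * s ^ 2) := by
  have : s ^ 2 < R ^ 2 := pow_lt_pow_left₀ hsR hs two_ne_zero
  exact Real.exp_lt_exp.2 (by nlinarith)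

/-- The choice of α makes the quadratic term 4α²Q beat 2αN by 4αc₀, so the operator applied to the
Gaussian is bounded below by a positive constant. -/
theorem barrier_lower {α Q N c₀ c₁ G g : ℝ} (hα0 : 0 < α) (hα : 2 * α * c₀ = c₁ + 2 * c₀)
    (hc₀ : 0 < c₀) (hQ : c₀ ≤ Q) (hN : N ≤ c₁) (hG : 0 < G) (hg : G ≤ g) :
    4 * α * c₀ * G ≤ (4 * α ^ 2 * Q - 2 * α * N) * g := by
  have h1 : 4 * α * c₀ ≤ 4 * α ^ 2 * Q - 2 * α * N := by
    have h2 : 2 * α * (2 * α * c₀) ≤ 2 * α * (2 * α * Q) := by gcongr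
    have h3 : 2 * α * N ≤ 2 * α * c₁ := by gcongr
    rw [hα] at h2
    linarith
  have h4 : 0 < 4 * α * c₀ := by positivity
  exact mul_le_mul h1 hg hG.le (h4.le.trans h1)

/-- Strong unique continuation from a ball for nonnegative functions `A` such that `log A` is a
subsolution of an elliptic equation. -/
theorem eq_zero_of_ball (hX : ∀ l, Continuous (X l)) (hβ : Continuous β) (hK : Continuous K) (hK0 : ∀ y, 0 ≤ K y)
    (hell : ∀ y w, w ≠ 0 → 0 < ∑ l, (inner ℝ w (X l y) : ℝ) ^ 2) (hA : ContDiff ℝ ∞ A)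
    (hA0 : ∀ y, 0 ≤ A y)
    (h1 : ∀ y, -(K y * A y) ≤
      ∑ l, fderiv ℝ (fderiv ℝ A) y (X l y) (X l y) + fderiv ℝ A y (β y))
    (h2 : ∀ y, -(K y * A y ^ 2) ≤
      A y * (∑ l, fderiv ℝ (fderiv ℝ A) y (X l y) (X l y) + fderiv ℝ A y (β y)) -
        ∑ l, fderiv ℝ A y (X l y) ^ 2)
    {q : E3} {r : ℝ} (hr : 0 < r) (hball : ∀ y, ‖y - q‖ < r → A y = 0) (p : E3) : A p = 0 := by
  by_contra hp
  have hAp : 0 < A p := lt_of_le_of_ne (hA0 p) (Ne.symm hp)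
  have hrp : r ≤ ‖p - q‖ := le_of_not_gt fun hlt => hp (hball p hlt)
  set R := ‖p - q‖ + 1 with hR
  -- The comparison takes place on a shell whose inner sphere lies in the ball where A = 0 and whose
  -- interior contains p. Removing the centre keeps the gradient of the Gaussian away from zero.
  let S : Set E3 := {y | r / 2 ≤ ‖y - q‖ ∧ ‖y - q‖ ≤ R}
  have hnc : Continuous fun y : E3 => ‖y - q‖ := by fun_prop
  have hS : IsCompact S := by
    refine (isCompact_closedBall q R).of_isClosed_subset
      ((isClosed_le continuous_const hnc).inter (isClosed_le hnc continuous_const)) ?_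
    intro y hy
    rw [mem_closedBall_iff_norm]
    exact hy.2
  have hpS : p ∈ S := ⟨by linarith, by linarith⟩
  have hne : S.Nonempty := ⟨p, hpS⟩
  obtain ⟨c₀, hc₀, hQ⟩ : ∃ c₀ : ℝ, 0 < c₀ ∧ ∀ y ∈ S,
      c₀ ≤ ∑ l, (inner ℝ (y - q) (X l y) : ℝ) ^ 2 := by
    obtain ⟨yQ, hyQ, hQ⟩ := hS.exists_isMinOn hne
      (f := fun y => ∑ l, (inner ℝ (y - q) (X l y) : ℝ) ^ 2) (by fun_prop)
    refine ⟨_, hell yQ (yQ - q) fun h0 => ?_, fun y hy => hQ hy⟩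
    have := hyQ.1
    rw [h0, norm_zero] at this
    linarith
  have hbdd (g : E3 → ℝ) (hg : Continuous g) : ∃ c : ℝ, 0 ≤ c ∧ ∀ y ∈ S, g y ≤ c := by
    obtain ⟨yN, -, hN⟩ := hS.exists_isMaxOn hne hg.continuousOn
    exact ⟨|g yN|, abs_nonneg _, fun y hy => (hN hy).trans (le_abs_self _)⟩
  obtain ⟨c₁, hc₁, hN⟩ := hbdd (fun y => ∑ l, ‖X l y‖ ^ 2 + (inner ℝ (y - q) (β y) : ℝ))
    (by fun_prop)
  obtain ⟨k, hk0, hk⟩ := hbdd K hK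
  obtain ⟨a, ha0, ha⟩ := hbdd A hA.continuous
  obtain ⟨α, hα0, hα⟩ : ∃ α : ℝ, 0 < α ∧ 2 * α * c₀ = c₁ + 2 * c₀ :=
    ⟨c₁ / (2 * c₀) + 1, by positivity, by field_simp⟩
  obtain ⟨G, hG⟩ : ∃ G, G = Real.exp (-α * R ^ 2) := ⟨_, rfl⟩
  have hG0 : 0 < G := hG ▸ Real.exp_pos _
  obtain ⟨κ, hκ'⟩ : ∃ κ, κ = 4 * α * c₀ * G := ⟨_, rfl⟩
  have hκ : 0 < κ := by rw [hκ']; positivity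
  obtain ⟨L, hL⟩ : ∃ L, L = Real.log (a + 1) := ⟨_, rfl⟩
  have hL0 : 0 ≤ L := hL ▸ Real.log_nonneg (by linarith)
  let η : E3 → ℝ := fun y => Real.exp (-α * ‖y - q‖ ^ 2) - G
  have hη : Continuous η := by fun_prop
  obtain ⟨m, hm'⟩ : ∃ m, m = Real.exp (-α * (r / 2) ^ 2) - G := ⟨_, rfl⟩
  have hm : 0 < m := by
    rw [hm', hG]; exact sub_pos.2 (exp_neg_mul_sq_lt hα0 (by linarith) (by linarith))
  have hηp : 0 < η p := by
    simp only [η, hG]; exact sub_pos.2 (exp_neg_mul_sq_lt hα0 (norm_nonneg _) (by linarith))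
  obtain ⟨e, he⟩ : ∃ e, e = η p := ⟨_, rfl⟩
  -- M is large enough to exclude an interior maximum (`hM1`), to contradict A p > 0 at the end
  -- (`hM2`) and to keep ε ≤ 1 (`hM3`).
  obtain ⟨M, hM0, hM1, hM2, hM3⟩ : ∃ M : ℝ, 0 < M ∧ k < M * κ ∧ L + |Real.log (A p)| < M * e ∧
      L ≤ M * m := by
    rw [← he] at hηp
    have h3 : 0 ≤ (L + |Real.log (A p)|) / e := by positivity
    have h4 : 0 ≤ L / m := by positivity
    have h5 : 0 ≤ k / κ := by positivity
    refine ⟨k / κ + (L + |Real.log (A p)|) / e + L / m + 1, by positivity, ?_, ?_, ?_⟩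
    · rw [← div_lt_iff₀ hκ]; linarith
    · rw [← div_lt_iff₀ hηp]; linarith
    · rw [← div_le_iff₀ hm]; linarith
  -- On the inner sphere, where A = 0 and η = m, this makes v equal to L; on the outer sphere η = 0
  -- and v ≤ log (a + 1) = L.
  obtain ⟨ε, hε⟩ : ∃ ε, ε = Real.exp (L - M * m) := ⟨_, rfl⟩
  have hε0 : 0 < ε := hε ▸ Real.exp_pos _
  have hε1 : ε ≤ 1 := hε ▸ Real.exp_le_one_iff.2 (by linarith)
  let v : E3 → ℝ := fun y => Real.log (A y + ε) + M * η y
  have hv : Continuous v := (hA.continuous.add continuous_const).log (fun y =>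
    (add_pos_of_nonneg_of_pos (hA0 y) hε0).ne') |>.add (continuous_const.mul hη)
  obtain ⟨z, hz, hzmax⟩ := hS.exists_isMaxOn hne hv.continuousOn
  have hvz : v z ≤ L := by
    rcases hz.1.eq_or_lt with h3 | h3
    · have h4 : A z = 0 := hball z (by linarith)
      have h5 : η z = m := by simp only [η, ← h3, hm']
      simp only [v, h4, h5, zero_add, hε, Real.log_exp]
      linarith
    rcases hz.2.eq_or_lt with h4 | h4
    · have h5 : η z = 0 := by simp only [η, h4, hG, sub_self]
      simp only [v, h5, mul_zero, add_zero]
      rw [hL]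
      exact Real.log_le_log (add_pos_of_nonneg_of_pos (hA0 z) hε0) (add_le_add (ha z hz) hε1)
    · exfalso
      have hnhds : S ∈ 𝓝 z := Filter.mem_of_superset
        (((isOpen_lt continuous_const hnc).inter (isOpen_lt hnc continuous_const)).mem_nhds ⟨h3, h4⟩)
        fun y hy => ⟨hy.1.le, hy.2.le⟩
      have h5 := barrier_le hA0 hε0 (hK0 z) (h1 z) (h2 z) hA
        (hzmax.isLocalMax hnhds)
      have h6 := barrier_lower hα0 hα hc₀ (hQ z hz) (hN z hz) hG0
        (hG ▸ (exp_neg_mul_sq_lt hα0 (norm_nonneg (z - q)) h4).le)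
      have h7 := mul_le_mul_of_nonneg_left h6 hM0.le
      rw [← hκ'] at h7
      exact absurd hM1 (not_lt.2 ((h7.trans h5).trans (hk z hz)))
  have hvp : v p ≤ L := (hzmax hpS).trans hvz
  have h3 : Real.log (A p) ≤ Real.log (A p + ε) := Real.log_le_log hAp (by linarith)
  simp only [v, ← he] at hvp
  linarith [neg_abs_le (Real.log (A p))]

end MaximumPrinciple

/-! ### Consequences on a chart: unique continuation, closedness and totally geodesic pieces -/

section Local

variable {f : E3 → ImO} {X : Fin 3 → E3 → E3}

theorem HasNullVector.of_basis {y : E3} {v w : Fin 3 → E3}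
    (hv : ∀ i j, met f y (v i) (v j) = if i = j then 1 else 0)
    (hw : ∀ i j, met f y (w i) (w j) = if i = j then 1 else 0)
    (hn : HasNullVector fun i j k => cub f y (v i) (v j) (v k)) :
    HasNullVector fun i j k => cub f y (w i) (w j) (w k) := by
  obtain ⟨n, hn0, hn⟩ := hn
  choose a ha using fun i => exists_eq_sum hv (w i)
  obtain ⟨m, hm⟩ := exists_eq_sum hw (∑ i, n i • v i)
  refine ⟨m, fun h0 => hn0 ?_, fun j k => ?_⟩
  · have h1 : ∑ i, n i • v i = 0 := by rw [hm, h0]; simp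
    exact funext (Fintype.linearIndependent_iff.1 (linearIndependent_of_met hv) n h1)
  · have e1 := cub_sum f y w m (Pi.single j 1) (Pi.single k 1)
    simp only [Pi.single_apply, ite_smul, one_smul, zero_smul, Finset.sum_ite_eq',
      Finset.mem_univ, if_true, mul_ite, mul_one, mul_zero, ite_mul, zero_mul] at e1
    rw [← e1, ← hm, ha j, ha k, cub_sum]
    rw [Finset.sum_comm]
    refine Finset.sum_eq_zero fun b _ => ?_
    rw [Finset.sum_comm]
    refine Finset.sum_eq_zero fun d _ => ?_
    have := hn b d
    calc _ = a j b * a k d * ∑ i, n i * cub f y (v i) (v b) (v d) := by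
          rw [Finset.mul_sum]; exact Finset.sum_congr rfl fun i _ => by ring
      _ = 0 := by rw [this, mul_zero]

/-- The Gram matrix of the slices of a cubic tensor. -/
def gram (c : Fin 3 → Fin 3 → Fin 3 → ℝ) : Matrix (Fin 3) (Fin 3) ℝ :=
  Matrix.of fun a b => ∑ j, ∑ k, c a j k * c b j k

/-- Since nᵀGn = |n⌟c|² for the Gram matrix G, null vectors of c are the kernel of G. This expresses
their existence as a closed condition on c. -/
theorem hasNullVector_iff_det (c : Fin 3 → Fin 3 → Fin 3 → ℝ) :
    HasNullVector c ↔ (gram c).det = 0 := by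
  rw [← Matrix.exists_mulVec_eq_zero_iff]
  refine exists_congr fun n => and_congr_right fun _ => ⟨fun hn => ?_, fun hn => ?_⟩
  · ext a
    calc _ = ∑ j, ∑ k, c a j k * ∑ b, n b * c b j k := by
          simp only [Matrix.mulVec, dotProduct, gram, Matrix.of_apply, Finset.sum_mul,
            Finset.mul_sum]
          rw [Finset.sum_comm]
          refine Finset.sum_congr rfl fun j _ => ?_
          rw [Finset.sum_comm]
          exact Finset.sum_congr rfl fun k _ => Finset.sum_congr rfl fun b _ => by ring
      _ = 0 := by simp [hn]
  · have h1 : ∑ j, ∑ k, (∑ a, n a * c a j k) ^ 2 = ∑ a, n a * (gram c).mulVec n a := by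
      simp only [Matrix.mulVec, dotProduct, gram, Matrix.of_apply, Fin.sum_univ_three]
      ring
    rw [hn] at h1
    simp only [Pi.zero_apply, mul_zero, Finset.sum_const_zero] at h1
    rw [Finset.sum_eq_zero_iff_of_nonneg fun j _ => Finset.sum_nonneg fun k _ => sq_nonneg _] at h1
    intro j k
    have h2 := h1 j (Finset.mem_univ j)
    rw [Finset.sum_eq_zero_iff_of_nonneg fun k _ => sq_nonneg _] at h2
    exact pow_eq_zero_iff two_ne_zero |>.1 (h2 k (Finset.mem_univ k))

theorem along_along {g : E3 → ℝ} (hg : ContDiff ℝ ∞ g) {Y : E3 → E3} (hY : ContDiff ℝ ∞ Y)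
    (y : E3) : along Y (along Y g) y =
      fderiv ℝ (fderiv ℝ g) y (Y y) (Y y) + fderiv ℝ g y (fderiv ℝ Y y (Y y)) := by
  have hg1 : DifferentiableAt ℝ (fderiv ℝ g) y :=
    (hg.fderiv_right (m := ∞) (by simp)).differentiable (by simp) y
  have : fderiv ℝ (along Y g) y = fderiv ℝ (fun z => (fderiv ℝ g z) (Y z)) y := rfl
  rw [along, this, fderiv_clm_apply hg1 (hY.differentiable (by simp) y)]
  simp [add_comm]

theorem IsSmoothFrame.ext_fderiv (hX : IsSmoothFrame f X) {G : Type*} [NormedAddCommGroup G]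
    [NormedSpace ℝ G] {g : E3 → G} {y : E3} (hg : ∀ l, along (X l) g y = 0) : fderiv ℝ g y = 0 := by
  ext u
  obtain ⟨a, rfl⟩ := exists_eq_sum (hX.orth y) u
  rw [map_sum]
  refine Finset.sum_eq_zero fun i _ => ?_
  rw [map_smul]
  exact (congrArg (a i • ·) (hg i)).trans (smul_zero _)

variable (h : LagOn f Set.univ)

include h

/-- A Lagrangian immersion whose fundamental cubic has null vectors is totally geodesic if it is
so on an open set. -/
theorem LagOn.cub_eq_zero_of_ball
    (hn : ∀ y (v : Fin 3 → E3), (∀ i j, met f y (v i) (v j) = if i = j then 1 else 0) →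
      HasNullVector fun i j k => cub f y (v i) (v j) (v k))
    {q : E3} (hq : ∀ᶠ y in 𝓝 q, ∀ u v w, cub f y u v w = 0) (p u v w : E3) :
    cub f p u v w = 0 := by
  obtain ⟨X, hX⟩ := h.exists_isSmoothFrame
  obtain ⟨K, hK, hKb⟩ := h.exists_laplacian_bound hX fun y => by
    simp only [h.cubic_eq hX]; exact hn y _ (hX.orth y)
  set A := cubicNormSq f X with hAdef
  have hA : ContDiff ℝ ∞ A := h.contDiff_cubicNormSq hX
  have hA0 (y) : 0 ≤ A y := pair_self_nonneg _
  let β : E3 → E3 := fun y => ∑ l, (fderiv ℝ (X l) y (X l y) -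
    ∑ m, (conn f X l l m y + 1 / 4 * torsion f X l l m y) • X m y)
  have hXc (l) : Continuous (X l) := (hX.smooth l).continuous
  have hβ : Continuous β := by
    refine continuous_finsetSum _ fun l _ => Continuous.sub ?_ ?_
    · exact (((hX.smooth l).fderiv_right (m := ∞) (by simp)).clm_apply (hX.smooth l)).continuous
    · exact continuous_finsetSum _ fun m _ =>
        ((h.contDiff_conn hX l l m).continuous.add
          (continuous_const.mul (h.contDiff_torsion hX l l m).continuous)).smul (hXc m)
  have hlap (y) : frameLaplacian f X A y =
      ∑ l, fderiv ℝ (fderiv ℝ A) y (X l y) (X l y) + fderiv ℝ A y (β y) := by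
    simp only [frameLaplacian, along_along hA (hX.smooth _), β, map_sum, map_sub, map_smul,
      smul_eq_mul, Finset.sum_add_distrib, Finset.sum_sub_distrib, add_sub_assoc]
    rfl
  have hell (y w : E3) (hw : w ≠ 0) : 0 < ∑ l, (inner ℝ w (X l y) : ℝ) ^ 2 := by
    refine lt_of_le_of_ne (Finset.sum_nonneg fun l _ => sq_nonneg _) fun h0 => hw ?_
    have h1 := (Finset.sum_eq_zero_iff_of_nonneg fun l _ => sq_nonneg _).1 h0.symm
    have h2 (l) : inner ℝ w (X l y) = (0 : ℝ) :=
      pow_eq_zero_iff two_ne_zero |>.1 (h1 l (Finset.mem_univ l))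
    obtain ⟨a, ha⟩ := exists_eq_sum (hX.orth y) w
    have : inner ℝ w w = (0 : ℝ) := by
      calc (inner ℝ w w : ℝ) = inner ℝ w (∑ i, a i • X i y) := by rw [← ha]
        _ = 0 := by simp [inner_sum, inner_smul_right, h2]
    exact inner_self_eq_zero.1 this
  obtain ⟨r, hr, hball⟩ := Metric.eventually_nhds_iff.1 hq
  have hAz : A p = 0 := by
    -- The bound K is replaced by |K| because the barrier argument needs it nonnegative.
    refine eq_zero_of_ball (X := X) (β := β) (K := fun y => |K y|) hXc hβ hK.abs
      (fun y => abs_nonneg _) hell hA hA0 (fun y => ?_) (fun y => ?_) (q := q) hr (fun y hy => ?_) p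
    · rw [← hlap]
      exact (neg_le_neg (mul_le_mul_of_nonneg_right (le_abs_self (K y)) (hA0 y))).trans (hKb y).1
    · rw [← hlap]
      exact (neg_le_neg (mul_le_mul_of_nonneg_right (le_abs_self (K y))
        (sq_nonneg (A y)))).trans (hKb y).2
    · have h0 := hball (show dist y q < r by rwa [dist_eq_norm])
      simp only [hAdef, cubicNormSq, h.cubic_eq hX, h0, pair, mul_zero, Finset.sum_const_zero]
  have hz (i j k) : cub f p (X i p) (X j p) (X k p) = 0 := by
    have := sq_le_pair (fun i j k => cubic f X i j k p) i j k
    rw [← cubicNormSq, ← hAdef, hAz, h.cubic_eq hX] at this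
    exact pow_eq_zero_iff two_ne_zero |>.1 (le_antisymm this (sq_nonneg _))
  obtain ⟨a, rfl⟩ := exists_eq_sum (hX.orth p) u
  obtain ⟨b, rfl⟩ := exists_eq_sum (hX.orth p) v
  obtain ⟨d, rfl⟩ := exists_eq_sum (hX.orth p) w
  rw [cub_sum]
  simp only [hz, mul_zero, Finset.sum_const_zero]

/-- The null vectors of the fundamental cubic persist under limits. -/
theorem LagOn.hasNullVector_of_dense {S : Set E3} (hS : Dense S)
    (hn : ∀ y ∈ S, ∀ v : Fin 3 → E3, (∀ i j, met f y (v i) (v j) = if i = j then 1 else 0) →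
      HasNullVector fun i j k => cub f y (v i) (v j) (v k))
    (y : E3) (v : Fin 3 → E3) (hv : ∀ i j, met f y (v i) (v j) = if i = j then 1 else 0) :
    HasNullVector fun i j k => cub f y (v i) (v j) (v k) := by
  obtain ⟨X, hX⟩ := h.exists_isSmoothFrame
  refine HasNullVector.of_basis (hX.orth y) hv ?_
  have hcont : Continuous fun z => (gram fun i j k => cubic f X i j k z).det := by
    refine Continuous.matrix_det (continuous_matrix fun a b => ?_)
    simp only [gram, Matrix.of_apply]
    exact continuous_finsetSum _ fun j _ => continuous_finsetSum _ fun k _ =>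
      (h.contDiff_cubic hX a j k).continuous.mul (h.contDiff_cubic hX b j k).continuous
  have h0 := hcont.ext_on hS continuous_const fun z hz => (hasNullVector_iff_det _).1 <| by
    simp only [h.cubic_eq hX]; exact hn z hz _ (hX.orth z)
  have := (hasNullVector_iff_det _).2 (congrFun h0 y)
  simpa only [h.cubic_eq hX] using this

/-- If the fundamental cubic vanishes, then the span of the position vector and the tangent space
is parallel. -/
theorem LagOn.inner_eq_zero_of_cub (hc : ∀ y u v w, cub f y u v w = 0) {a : ImO} {q : E3}
    (hq : inner ℝ (f q) a = (0 : ℝ)) (hq' : ∀ u, inner ℝ (fderiv ℝ f q u) a = (0 : ℝ)) (p : E3) :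
    inner ℝ (f p) a = (0 : ℝ) ∧ ∀ u, inner ℝ (fderiv ℝ f p u) a = (0 : ℝ) := by
  obtain ⟨X, hX⟩ := h.exists_isSmoothFrame
  -- When C vanishes, the derivatives of (f, F₀, F₁, F₂) stay in their span and are given by a skew
  -- matrix. So the squared length Q of the projection of a to this span is constant.
  let Q : E3 → ℝ := fun y => inner ℝ (f y) a ^ 2 + ∑ i, inner ℝ (frameVec f X i y) a ^ 2
  have hF (i) := h.contDiff_frameVec hX i
  have hdF (i y) : DifferentiableAt ℝ (frameVec f X i) y := (hF i).differentiable (by simp) y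
  have hfa : ContDiff ℝ ∞ fun y => (inner ℝ (f y) a : ℝ) := h.contDiff.inner ℝ contDiff_const
  have hFa (i) : ContDiff ℝ ∞ fun y => (inner ℝ (frameVec f X i y) a : ℝ) :=
    (hF i).inner ℝ contDiff_const
  have hQ : ContDiff ℝ ∞ Q := (hfa.pow 2).add (ContDiff.sum fun i _ => (hFa i).pow 2)
  have hdf (y u) : fderiv ℝ (fun y => (inner ℝ (f y) a : ℝ)) y u = inner ℝ (fderiv ℝ f y u) a := by
    rw [fderiv_inner_apply ℝ (h.differentiableAt trivial) (differentiableAt_const a)]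
    simp
  have hdFa (i y u) : fderiv ℝ (fun y => (inner ℝ (frameVec f X i y) a : ℝ)) y u =
      inner ℝ (fderiv ℝ (frameVec f X i) y u) a := by
    rw [fderiv_inner_apply ℝ (hdF i y) (differentiableAt_const a)]
    simp
  have hstr (l i y) : along (X l) (frameVec f X i) y =
      (if l = i then (-1 : ℝ) else 0) • f y + ∑ m, conn f X l i m y • frameVec f X m y := by
    have fr := h.isLagFrame_frameVec hX y
    rw [fr.eq_sum (along (X l) (frameVec f X i) y)]
    have e1 : inner ℝ (f y) (along (X l) (frameVec f X i) y) = if l = i then (-1 : ℝ) else 0 := by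
      rw [h.along_frameVec hX, inner_add_right, h.inner_hess trivial, h.inner_fderiv trivial,
        hX.orth]
      split_ifs <;> simp
    have e2 (m) : inner ℝ (cross (f y) (frameVec f X m y)) (along (X l) (frameVec f X i) y) =
        (0 : ℝ) := by
      rw [real_inner_comm]
      exact (h.cubic_eq hX l i m y).trans (hc _ _ _ _)
    rw [e1]
    simp only [e2, zero_smul, Finset.sum_const_zero, add_zero]
    congr 1
    exact Finset.sum_congr rfl fun m _ => by rw [real_inner_comm]; rfl
  have hQ0 (y) : fderiv ℝ Q y = 0 := hX.ext_fderiv fun l => by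
    have d1 := ((hfa.differentiable (by simp) y).hasFDerivAt.pow 2)
    have d2 := HasFDerivAt.fun_sum (u := Finset.univ) fun i _ =>
      ((hFa i).differentiable (by simp) y).hasFDerivAt.pow 2
    have d3 : fderiv ℝ Q y = _ := (d1.add d2).fderiv
    rw [along, d3]
    simp only [add_apply, _root_.sum_apply, smul_apply, hdf, hdFa]
    have e1 (i) : fderiv ℝ (frameVec f X i) y (X l y) = _ := hstr l i y
    have e2 : fderiv ℝ f y (X l y) = frameVec f X l y := rfl
    have s := h.conn_antisymm hX l
    have s0 (i) : conn f X l i i y = 0 := by linarith [s i i y]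
    simp only [e1, e2, inner_add_left, inner_smul_left, conj_trivial,
      Fin.sum_univ_three, s0, s 1 0, s 2 0, s 2 1]
    fin_cases l <;> simp <;> ring
  have hconst := is_const_of_fderiv_eq_zero (hQ.differentiable (by simp)) hQ0 p q
  have hQq : Q q = 0 := by
    simp only [Q, hq, frameVec, along, hq']
    simp
  rw [hQq] at hconst
  have hs : 0 ≤ ∑ i, (inner ℝ (frameVec f X i p) a : ℝ) ^ 2 :=
    Finset.sum_nonneg fun i _ => sq_nonneg _
  have h1 : (inner ℝ (f p) a : ℝ) ^ 2 + ∑ i, (inner ℝ (frameVec f X i p) a : ℝ) ^ 2 = 0 := hconst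
  have h2 : ∑ i, (inner ℝ (frameVec f X i p) a : ℝ) ^ 2 = 0 := by
    linarith [sq_nonneg (inner ℝ (f p) a : ℝ)]
  refine ⟨pow_eq_zero_iff two_ne_zero |>.1 (by linarith), fun u => ?_⟩
  have h3 := (Finset.sum_eq_zero_iff_of_nonneg fun i _ => sq_nonneg _).1 h2
  obtain ⟨b, rfl⟩ := exists_eq_sum (hX.orth p) u
  rw [map_sum, sum_inner]
  refine Finset.sum_eq_zero fun i _ => ?_
  rw [map_smul, inner_smul_left]
  have : inner ℝ (fderiv ℝ f p (X i p)) a = (0 : ℝ) :=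
    pow_eq_zero_iff two_ne_zero |>.1 (h3 i (Finset.mem_univ i))
  rw [this, mul_zero]

end Local

/-! ### Connectedness arguments on L -/

section Global

variable {L : Type*} [TopologicalSpace L] [ChartedSpace E3 L] [IsManifold 𝓘(ℝ, E3) ∞ L]
  {x : L → ImO}

theorem IsLagrangianImmersion.exists_isOrthonormalBasis (hx : IsLagrangianImmersion x) (p : L) :
    ∃ v, IsOrthonormalBasis x p v := by
  obtain ⟨ψ, -, -, rfl, hψ, hτ⟩ := hx.exists_param p
  obtain ⟨v, hv⟩ := hψ.exists_orthonormal (y := 0) trivial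
  obtain ⟨τ, -, hm, -⟩ := hτ 0
  exact ⟨fun i => τ (v i), fun i j => (hm _ _).trans (hv i j)⟩

/-- If the stabilizers are isomorphic to `S₃` on a dense set, then the fundamental cubic has null
vectors everywhere. -/
theorem IsLagrangianImmersion.hasNullVector_of_dense (hx : IsLagrangianImmersion x) {U : Set L}
    (hU : Dense U) (hS : ∀ p ∈ U, HasS3StabilizerAt x p) {p : L} {v : Fin 3 → E3}
    (hv : IsOrthonormalBasis x p v) :
    HasNullVector fun i j k => fundamentalCubic x p (v i) (v j) (v k) := by
  obtain ⟨ψ, -, ho, rfl, hψ, hτ⟩ := hx.exists_param p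
  obtain ⟨τ, -, hm, hc⟩ := hτ 0
  have hv' (i j) : met (x ∘ ψ) 0 (τ.symm (v i)) (τ.symm (v j)) = if i = j then 1 else 0 := by
    rw [← hm, τ.apply_symm_apply, τ.apply_symm_apply]; exact hv i j
  have := hψ.hasNullVector_of_dense (hU.preimage ho) (fun y hy w hw => ?_) 0 _ hv'
  · simpa only [← hc, τ.apply_symm_apply] using this
  · obtain ⟨σ, -, hm, hc⟩ := hτ y
    have := hx.hasNullVector_of_hasS3 (v := fun i => σ (w i))
      (fun i j => (hm _ _).trans (hw i j)) (hS _ hy)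
    simpa only [hc] using this

/-- An immersion whose fundamental cubic vanishes identically is simple. -/
theorem IsLagrangianImmersion.isSimple_of_fundamentalCubic_eq_zero [ConnectedSpace L]
    (hx : IsLagrangianImmersion x) (h0 : ∀ p, fundamentalCubic x p = 0) : IsSimple x := by
  obtain ⟨p₀⟩ : Nonempty L := inferInstance
  set V : Submodule ℝ ImO := Submodule.span ℝ {x p₀} ⊔ LinearMap.range (dx x p₀).toLinearMap with hV
  have hxp (p) : x p ≠ 0 := fun h => by simpa [h] using hx.mem_sphere p
  have key (a : ImO) (ha : a ∈ Vᗮ) (p : L) : inner ℝ (x p) a = (0 : ℝ) := by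
    -- Requiring orthogonality of the tangent space as well makes the condition propagate across
    -- each parametrized neighbourhood, so that Z is both open and closed.
    let Z : Set L := {p | inner ℝ (x p) a = (0 : ℝ) ∧ ∀ u, inner ℝ (dx x p u) a = (0 : ℝ)}
    have hprop (p : L) : ∃ W : Set L, IsOpen W ∧ p ∈ W ∧ ∀ q ∈ W, q ∈ Z → W ⊆ Z := by
      obtain ⟨ψ, -, ho, rfl, hψ, hτ⟩ := hx.exists_param p
      have hc (y u v w) : cub (x ∘ ψ) y u v w = 0 := by
        obtain ⟨τ, -, -, hc⟩ := hτ y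
        rw [← hc, h0]; rfl
      have hd (y) : ψ y ∈ Z ↔ inner ℝ ((x ∘ ψ) y) a = (0 : ℝ) ∧
          ∀ u, inner ℝ (fderiv ℝ (x ∘ ψ) y u) a = (0 : ℝ) := by
        obtain ⟨τ, hτ, -⟩ := hτ y
        refine and_congr Iff.rfl ⟨fun h u => by rw [hτ]; exact h _, fun h u => ?_⟩
        rw [← τ.apply_symm_apply u, ← hτ]; exact h _
      refine ⟨Set.range ψ, ho.isOpen_range, ⟨0, rfl⟩, ?_⟩
      rintro _ ⟨q, rfl⟩ hq _ ⟨y, rfl⟩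
      obtain ⟨h1, h2⟩ := (hd q).1 hq
      exact (hd y).2 (hψ.inner_eq_zero_of_cub hc h1 h2 y)
    have hZ : IsClopen Z := by
      refine ⟨⟨isOpen_iff_mem_nhds.2 fun p hp => ?_⟩, isOpen_iff_mem_nhds.2 fun p hp => ?_⟩
      · obtain ⟨W, hW, hpW, h⟩ := hprop p
        exact mem_of_superset (hW.mem_nhds hpW) fun q hq hqZ => hp (h q hq hqZ hpW)
      · obtain ⟨W, hW, hpW, h⟩ := hprop p
        exact mem_of_superset (hW.mem_nhds hpW) (h p hpW hp)
    have hp₀ : p₀ ∈ Z := by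
      rw [Submodule.mem_orthogonal] at ha
      exact ⟨ha _ (Submodule.mem_sup_left (Submodule.mem_span_singleton_self _)),
        fun u => ha _ (Submodule.mem_sup_right ⟨u, rfl⟩)⟩
    exact ((hZ.eq_univ ⟨p₀, hp₀⟩).symm ▸ Set.mem_univ p : p ∈ Z).1
  refine ⟨V, ?_, fun p => ?_⟩
  · have h1 : Module.finrank ℝ (Submodule.span ℝ {x p₀}) = 1 := finrank_span_singleton (hxp p₀)
    have h2 : Module.finrank ℝ (LinearMap.range (dx x p₀).toLinearMap) = 3 := by
      rw [LinearMap.finrank_range_of_inj (hx.immersion p₀)]; simp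
    -- The position vector is orthogonal to the tangent space, so the dimensions add up to 1 + 3.
    have h3 : Submodule.span ℝ {x p₀} ⊓ LinearMap.range (dx x p₀).toLinearMap = ⊥ := by
      rw [Submodule.eq_bot_iff]
      rintro z ⟨hz1, u, rfl⟩
      obtain ⟨r, hr⟩ := Submodule.mem_span_singleton.1 hz1
      obtain ⟨ψ, -, -, hp, hψ, hτ⟩ := hx.exists_param p₀
      obtain ⟨τ, hτ, -⟩ := hτ 0
      have h4 := hψ.inner_fderiv (y := 0) trivial (τ.symm u)
      rw [hτ, τ.apply_symm_apply, Function.comp, hp] at h4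
      have h5 : dx x p₀ u = r • x p₀ := hr.symm
      rw [h5, inner_smul_right, mul_eq_zero] at h4
      rcases h4 with h4 | h4
      · rw [← hr, h4, zero_smul]
      · exact absurd (inner_self_eq_zero.1 h4) (hxp p₀)
    have h4 := Submodule.finrank_sup_add_finrank_inf_eq (Submodule.span ℝ {x p₀})
      (LinearMap.range (dx x p₀).toLinearMap)
    rw [h3, finrank_bot, h1, h2] at h4
    exact h4
  · rw [← Submodule.orthogonal_orthogonal V, Submodule.mem_orthogonal]
    intro a ha
    rw [real_inner_comm]
    exact key a ha p

/-- On a non-simple Lagrangian immersion whose fundamental cubic has null vectors, the fundamental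
cubic does not vanish on an open dense set. -/
theorem IsLagrangianImmersion.dense_ne_zero [ConnectedSpace L]
    (hx : IsLagrangianImmersion x) (hns : ¬ IsSimple x)
    (hn : ∀ p v, IsOrthonormalBasis x p v →
      HasNullVector fun i j k => fundamentalCubic x p (v i) (v j) (v k)) :
    ∃ U : Set L, IsOpen U ∧ Dense U ∧ ∀ p ∈ U, fundamentalCubic x p ≠ 0 := by
  -- Unique continuation on charts makes the interior of the zero set of C closed as well. It is
  -- therefore empty, since Z = L would make L simple.
  let Z : Set L := interior {p | fundamentalCubic x p = 0}
  have hprop (p : L) : ∃ W : Set L, IsOpen W ∧ p ∈ W ∧ ∀ q ∈ W, q ∈ Z → W ⊆ Z := by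
    obtain ⟨ψ, hcont, ho, rfl, hψ, hτ⟩ := hx.exists_param p
    have hd (y) : fundamentalCubic x (ψ y) = 0 ↔ ∀ u v w, cub (x ∘ ψ) y u v w = 0 := by
      obtain ⟨τ, -, -, hc⟩ := hτ y
      refine ⟨fun h u v w => by rw [← hc, h]; rfl, fun h => ?_⟩
      funext u v w
      rw [← τ.apply_symm_apply u, ← τ.apply_symm_apply v, ← τ.apply_symm_apply w, hc, h]
      rfl
    refine ⟨Set.range ψ, ho.isOpen_range, ⟨0, rfl⟩, ?_⟩
    rintro _ ⟨q, rfl⟩ hq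
    refine interior_maximal ?_ ho.isOpen_range
    rintro _ ⟨y, rfl⟩
    refine (hd y).2 (hψ.cub_eq_zero_of_ball (fun z v hv => ?_) (q := q) ?_ y)
    · obtain ⟨σ, -, hm, hc⟩ := hτ z
      have := hn (ψ z) (fun i => σ (v i)) fun i j => (hm _ _).trans (hv i j)
      simpa only [hc] using this
    · filter_upwards [hcont.continuousAt.preimage_mem_nhds (mem_interior_iff_mem_nhds.1 hq)]
        with z hz using (hd z).1 hz
  have hZ : IsClopen Z := by
    refine ⟨⟨isOpen_iff_mem_nhds.2 fun p hp => ?_⟩, isOpen_interior⟩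
    obtain ⟨W, hW, hpW, h⟩ := hprop p
    exact mem_of_superset (hW.mem_nhds hpW) fun q hq hqZ => hp (h q hq hqZ hpW)
  have hZe : Z = ∅ := by
    rcases isClopen_iff.1 hZ with h | h
    · exact h
    · refine absurd (hx.isSimple_of_fundamentalCubic_eq_zero fun p => ?_) hns
      have : p ∈ Z := h ▸ Set.mem_univ p
      exact (interior_subset this : p ∈ {p | fundamentalCubic x p = 0})
  have hopen : IsOpen {p | fundamentalCubic x p ≠ 0} := by
    refine isOpen_iff_mem_nhds.2 fun p hp => ?_
    obtain ⟨ψ, hcont, ho, rfl, hψ, hτ⟩ := hx.exists_param p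
    obtain ⟨u, v, w, h⟩ : ∃ u v w, cub (x ∘ ψ) 0 u v w ≠ 0 := by
      by_contra! h
      obtain ⟨τ, -, -, hc⟩ := hτ 0
      refine hp ?_
      funext u v w
      rw [← τ.apply_symm_apply u, ← τ.apply_symm_apply v, ← τ.apply_symm_apply w, hc, h]
      rfl
    have hc : Continuous fun y => cub (x ∘ ψ) y u v w := by
      have h1 := hψ.contDiff.fderiv_right (m := ∞) (by simp)
      have h2 := h1.fderiv_right (m := ∞) (by simp)
      exact ((((h2.clm_apply contDiff_const).clm_apply contDiff_const).inner ℝ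
        (hψ.contDiff.cross (h1.clm_apply contDiff_const))).continuous)
    refine mem_of_superset (ho.image_mem_nhds (hc.continuousAt.eventually_ne h)) ?_
    rintro _ ⟨y, hy, rfl⟩ h0
    obtain ⟨τ, -, -, hτc⟩ := hτ y
    refine hy ?_
    rw [← hτc, h0]
    rfl
  refine ⟨_, hopen, ?_, fun p hp => hp⟩
  exact interior_eq_empty_iff_dense_compl.1 hZe

end Global

end S6
end

/-! ### The theorem -/

theorem lemma6p3 {L : Type*} [TopologicalSpace L] [ChartedSpace S6.E3 L]
    [IsManifold 𝓘(ℝ, S6.E3) ∞ L] [ConnectedSpace L] (x : L → S6.ImO)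
    (hx : S6.IsLagrangianImmersion x) (hns : ¬ S6.IsSimple x) :
    ((∃ U : Set L, IsOpen U ∧ Dense U ∧ ∀ p ∈ U, S6.HasS3StabilizerAt x p) ↔
        S6.SatisfiesChenEquality x) ∧
      (S6.SatisfiesChenEquality x →
        ∀ p, S6.fundamentalCubic x p ≠ 0 → S6.HasS3StabilizerAt x p) := by
  have hchen (h : S6.SatisfiesChenEquality x) (p : L) (v : Fin 3 → S6.E3)
      (hv : S6.IsOrthonormalBasis x p v) :
      S6.HasNullVector fun i j k => S6.fundamentalCubic x p (v i) (v j) (v k) :=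
    (hx.chenInvariant_eq_two_iff hv).1 (h p v hv)
  have hS3 (h : S6.SatisfiesChenEquality x) (p : L) (h0 : S6.fundamentalCubic x p ≠ 0) :
      S6.HasS3StabilizerAt x p := by
    obtain ⟨v, hv⟩ := hx.exists_isOrthonormalBasis p
    exact hx.hasS3_of_hasNullVector hv (hchen h p v hv) h0
  refine ⟨⟨?_, fun h => ?_⟩, hS3⟩
  -- Only the density of U matters here, since null vectors persist in the limit.
  · rintro ⟨U, -, hU, hS⟩ p v hv
    exact (hx.chenInvariant_eq_two_iff hv).2 (hx.hasNullVector_of_dense hU hS hv)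
  · obtain ⟨U, hU, hd, h0⟩ := hx.dense_ne_zero hns (hchen h)
    exact ⟨U, hU, hd, fun p hp => hS3 h p (h0 p hp)⟩
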